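/- **Setting.** Let $F$ be a brane tiling of the closed connected oriented surface $M_g$ of genus $g\ge 1$: a tiling of $M_g$ by convex polygonal tiles (so every tile has at least three sides and every vertex lies on at least three edges; only the combinatorics is used, i.e. the tiling is a finite connected cellular decomposition of $M_g$) whose 1-skeleton is a bipartite graph with vertices coloured black and white. Let $Q$ be the dual quiver: its vertices $V(Q)$ are the tiles, its arrows $E(Q)$ are the edges of the tiling, directed so that they go clockwise around black vertices (hence anticlockwise around white ones). An arrow $a$ goes from $t(a)$ to $h(a)$, and $uv$ means "first $u$, then $v$". Let $W\in\mathbb{C}Q/[\mathbb{C}Q,\mathbb{C}Q]$ be the sum of the cycles of arrows around the black vertices minus the sum of those around the white vertices, let $\partial/\partial X_a$ be the cyclic derivative (permute each occurrence of $a$ cyclically to the front and delete it), and put $A=A_F=\mathbb{C}Q/\langle \partial W/\partial X_a : a\in E(Q)\rangle$, with idempotents $e_i$ ($i\in V(Q)$). For an arrow $a$ let $\omega^{br}_{a,B}$ and $\omega^{br}_{a,W}$ be the paths from $h(a)$ to $t(a)$ that run once around the black, respectively white, endpoint of $a$, omitting $a$. Let $\omega_j$ be a simple loop at the tile $j$ (once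 around a vertex of $j$; all of these have the same class in $A$). Call $F$ *consistent* if for all paths $u,v$ of $Q$ ending at the same tile $j$: if $[u][\omega_j]^n=[v][\omega_j]^n$ in $A$ for some $n\ge 0$, then $[u]=[v]$ in $A$. **Theorem.** Let $F$ be a consistent brane tiling of $M_g$, $g\ge 1$. Regard $\mathrm{Hom}_{\mathbb{C}}(e_iA,e_jA)$ as a left $A$-module by $(b\varphi)(v)=\varphi(vb)$. Then $$0\to A\xrightarrow{ev}\bigoplus_{i\in V(Q)}\mathrm{Hom}_{\mathbb{C}}(e_iA,e_iA)\xrightarrow{d}\bigoplus_{a\in E(Q)}\mathrm{Hom}_{\mathbb{C}}(e_{h(a)}A,e_{t(a)}A)\xrightarrow{r}\bigoplus_{a\in E(Q)}\mathrm{Hom}_{\mathbb{C}}(e_{t(a)}A,e_{h(a)}A)\xrightarrow{p}\bigoplus_{i\in V(Q)}\mathrm{Hom}_{\mathbb{C}}(e_iA,e_iA)\to 0$$ is an exact sequence of left $A$-modules, and all its terms after $A$ are injective; that is, it is an injective resolution of $A$ of length 3. Here * $ev(x)_i(v)=vx$; * $d(\varphi)_a(v)=a\,\varphi_{h(a)}(v)-\varphi_{t(a)}(av)$;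 * $r(\psi)_a=\alpha_{\psi,a,B}-\alpha_{\psi,a,W}$ where, if $\omega^{br}_{a,B}=b_1\cdots b_n$, then $\alpha_{\psi,a,B}(v)=\sum_{k=1}^n b_1\cdots b_{k-1}\,\psi_{b_k}(b_{k+1}\cdots b_n v)$, and similarly for $W$; * $p(\nu)_i(v)=\sum_{a:\,h(a)=i}\nu_a(av)-\sum_{a:\,t(a)=i}a\,\nu_a(v)$. The analogous sequence of right $A$-modules is an injective resolution of $A$ as a right $A$-module: it is built from the $\mathrm{Hom}_{\mathbb{C}}(Ae_i,Ae_j)$ with $(\varphi b)(v)=\varphi(bv)$, i.e. it is the sequence given by the formulas above for the opposite algebra $A^{op}$, with all arrows and paths reversed. Moreover, $A$ is Gorenstein: it has finite injective dimension both as a left and as a right module over itself. -/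

import Mathlib

universe u

noncomputable section

/-! ### The path algebra of a finite quiver -/

/-- The complex path algebra of a quiver: the vector space with basis the paths (including the
trivial path at each vertex).  The product `u * v` is "first `u`, then `v`". -/
def PathAlgebra (V : Type u) [Quiver.{u} V] : Type u :=
  (Σ i j : V, Quiver.Path i j) →₀ ℂ

namespace PathAlgebra

variable {V : Type u} [Quiver.{u} V]

instance : AddCommGroup (PathAlgebra V) :=
  inferInstanceAs (AddCommGroup ((Σ i j : V, Quiver.Path i j) →₀ ℂ))

instance : Module ℂ (PathAlgebra V) :=
  inferInstanceAs (Module ℂ ((Σ i j : V, Quiver.Path i j) →₀ ℂ))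

/-- The basis element of a path. -/
def ofPath {i j : V} (p : Quiver.Path i j) : PathAlgebra V :=
  Finsupp.single ⟨i, j, p⟩ (1 : ℂ)

/-- Linear extension of a function on paths. -/
def lift {M : Type u} [AddCommGroup M] [Module ℂ M] (f : (Σ i j : V, Quiver.Path i j) → M) :
    PathAlgebra V →ₗ[ℂ] M :=
  Finsupp.linearCombination ℂ f

theorem lift_ofPath {M : Type u} [AddCommGroup M] [Module ℂ M]
    (f : (Σ i j : V, Quiver.Path i j) → M) {i j : V} (p : Quiver.Path i j) :
    lift f (ofPath p) = f ⟨i, j, p⟩ := by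
  refine (Finsupp.linearCombination_single (R := ℂ) (v := f) 1 ⟨i, j, p⟩).trans ?_
  rw [one_smul]

theorem hom_ext {M : Type u} [AddCommGroup M] [Module ℂ M] {f g : PathAlgebra V →ₗ[ℂ] M}
    (h : ∀ (i j : V) (p : Quiver.Path i j), f (ofPath p) = g (ofPath p)) : f = g := by
  refine Finsupp.lhom_ext' fun a => LinearMap.ext_ring ?_
  exact h a.1 a.2.1 a.2.2

open Classical in
/-- Concatenation of basis paths; zero if they are not composable. -/
def mulBasis (p q : Σ i j : V, Quiver.Path i j) : PathAlgebra V :=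
  if h : q.1 = p.2.1 then ofPath (p.2.2.comp (q.2.2.cast h rfl)) else 0

/-- The multiplication of the path algebra, as a bilinear map. -/
def mulLin : PathAlgebra V →ₗ[ℂ] PathAlgebra V →ₗ[ℂ] PathAlgebra V :=
  lift fun p => lift fun q => mulBasis p q

instance : Mul (PathAlgebra V) := ⟨fun x y => mulLin x y⟩

theorem mul_def (x y : PathAlgebra V) : x * y = mulLin x y := rfl

theorem ofPath_mul_ofPath {i j k : V} (p : Quiver.Path i j) (q : Quiver.Path j k) :
    ofPath p * ofPath q = ofPath (p.comp q) := by
  simp [mul_def, mulLin, lift_ofPath, mulBasis]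

theorem ofPath_mul_ofPath_of_ne {i j k l : V} (p : Quiver.Path i j) (q : Quiver.Path k l)
    (h : k ≠ j) : ofPath p * ofPath q = 0 := by
  simp [mul_def, mulLin, lift_ofPath, mulBasis, h]

theorem mul_assoc' (x y z : PathAlgebra V) : x * y * z = x * (y * z) := by
  have h3 : ∀ {i j k l : V} (p : Quiver.Path i j) (q : Quiver.Path k l),
      mulLin (ofPath p * ofPath q) = mulLin (ofPath p) ∘ₗ mulLin (ofPath q) := by
    refine fun {i j k l} p q => hom_ext fun m n r => ?_
    change ofPath p * ofPath q * ofPath r = ofPath p * (ofPath q * ofPath r)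
    by_cases h1 : k = j
    · subst h1
      rw [ofPath_mul_ofPath]
      by_cases h2 : m = l
      · subst h2
        rw [ofPath_mul_ofPath, ofPath_mul_ofPath, ofPath_mul_ofPath, Quiver.Path.comp_assoc]
      · rw [ofPath_mul_ofPath_of_ne _ _ h2, ofPath_mul_ofPath_of_ne _ _ h2, mul_def _ 0, map_zero]
    · rw [ofPath_mul_ofPath_of_ne _ _ h1, mul_def 0, map_zero, LinearMap.zero_apply]
      by_cases h2 : m = l
      · subst h2
        rw [ofPath_mul_ofPath, ofPath_mul_ofPath_of_ne _ _ h1]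
      · rw [ofPath_mul_ofPath_of_ne _ _ h2, mul_def _ 0, map_zero]
  have h2 : ∀ {i j : V} (p : Quiver.Path i j),
      mulLin.flip z ∘ₗ mulLin (ofPath p) = mulLin (ofPath p) ∘ₗ mulLin.flip z :=
    fun p => hom_ext fun _ _ q => LinearMap.congr_fun (h3 p q) z
  have h1 : mulLin.flip z ∘ₗ mulLin.flip y = mulLin.flip (y * z) :=
    hom_ext fun _ _ p => LinearMap.congr_fun (h2 p) y
  exact LinearMap.congr_fun h1 x

variable [Finite V]

/-- The unit is the sum of all trivial paths. -/
instance : One (PathAlgebra V) :=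
  ⟨∑ i ∈ Set.finite_univ.toFinset, ofPath (Quiver.Path.nil : Quiver.Path (i : V) i)⟩

theorem one_def : (1 : PathAlgebra V) =
    ∑ i ∈ Set.finite_univ.toFinset, ofPath (Quiver.Path.nil : Quiver.Path (i : V) i) := rfl

theorem one_mul' (x : PathAlgebra V) : 1 * x = x := by
  have key : mulLin (1 : PathAlgebra V) = LinearMap.id := by
    refine hom_ext fun i j p => ?_
    rw [one_def, map_sum, LinearMap.sum_apply, Finset.sum_eq_single i]
    · exact (ofPath_mul_ofPath _ _).trans (by simp)
    · intro k _ hk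
      exact ofPath_mul_ofPath_of_ne _ _ (Ne.symm hk)
    · simp
  exact congrArg (fun f => f x) key

theorem mul_one' (x : PathAlgebra V) : x * 1 = x := by
  have key : (mulLin (V := V)).flip 1 = LinearMap.id := by
    refine hom_ext fun i j p => ?_
    rw [LinearMap.flip_apply, one_def, map_sum, Finset.sum_eq_single j]
    · exact (ofPath_mul_ofPath _ _).trans (by simp)
    · intro k _ hk
      exact ofPath_mul_ofPath_of_ne _ _ hk
    · simp
  exact congrArg (fun f => f x) key

instance : Ring (PathAlgebra V) :=
  { (inferInstance : AddCommGroup (PathAlgebra V)), (inferInstance : Mul (PathAlgebra V)),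
    (inferInstance : One (PathAlgebra V)) with
    mul_assoc := mul_assoc'
    one_mul := one_mul'
    mul_one := mul_one'
    zero_mul := fun x => by rw [mul_def, map_zero, LinearMap.zero_apply]
    mul_zero := fun x => by rw [mul_def, map_zero]
    left_distrib := fun x y z => by rw [mul_def, map_add]; rfl
    right_distrib := fun x y z => by rw [mul_def, map_add]; rfl }

instance : Algebra ℂ (PathAlgebra V) :=
  Algebra.ofModule
    (fun c x y => by rw [mul_def, map_smul]; rfl)
    (fun c x y => by rw [mul_def, map_smul]; rfl)

end PathAlgebra

/-! ### Brane tilings -/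

/-- A brane tiling of a closed connected oriented surface, as a combinatorial map: `E` is the set of
edges of the bipartite graph, `σB e` (resp. `σW e`) is the edge after `e` in clockwise
(resp. anticlockwise) order around the black (resp. white) endpoint of `e`.  Black (white) vertices
are the cycles of `σB` (`σW`), and a tile with `2m` sides is an `m`-cycle of `σB * σW⁻¹`.  The graph
is connected; as the tiles are convex polygons, every vertex lies on at least three edges and
every tile has at least three (hence, by bipartiteness, at least four) sides. -/
structure BraneTiling (E : Type u) where
  σB : Equiv.Perm E
  σW : Equiv.Perm E
  nonempty : Nonempty E
  connected : MulAction.IsPretransitive (Subgroup.closure {σB, σW}) E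
  three_le_black : ∀ e, 3 ≤ Function.minimalPeriod σB e
  three_le_white : ∀ e, 3 ≤ Function.minimalPeriod σW e
  three_le_tile : ∀ e, 3 ≤ 2 * Function.minimalPeriod (σB * σW⁻¹) e

namespace BraneTiling

section

variable {E : Type u} (F : BraneTiling E)

/-- The black vertices of the bipartite graph. -/
def BlackVertex : Type u := Quotient (Equiv.Perm.SameCycle.setoid F.σB)

/-- The white vertices of the bipartite graph. -/
def WhiteVertex : Type u := Quotient (Equiv.Perm.SameCycle.setoid F.σW)

/-- The tiles; these are the vertices of the dual quiver `Q`. -/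
def Tile : Type u := Quotient (Equiv.Perm.SameCycle.setoid (F.σB * F.σW⁻¹))

/-- The tile in which the arrow dual to `e` starts.  Two arrows start at the same tile iff they lie
in the same cycle of `σB * σW⁻¹`, i.e. iff one gets from one to the other by repeatedly passing from
an arrow to its predecessor at the white vertex and on to the successor of that at the black
vertex. -/
def t (e : E) : F.Tile := Quotient.mk _ e

/-- The tile in which the arrow dual to `e` ends: the next arrow clockwise around the black
vertex of `e` starts there. -/
def h (e : E) : F.Tile := F.t (F.σB e)

/-- The tile in which the arrow `e` ends is also where the next arrow around the white vertex
starts. -/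
theorem h_eq_t_white (e : E) : F.h e = F.t (F.σW e) := by
  refine (Quotient.sound ?_).symm
  exact ⟨1, by simp⟩

/-- The surface has genus `g`: `V - E + F = 2 - 2g`. -/
def HasGenus (g : ℕ) : Prop :=
  ((Nat.card F.BlackVertex : ℤ) + Nat.card F.WhiteVertex) - Nat.card E + Nat.card F.Tile = 2 - 2 * g

/-- The dual quiver `Q`: an edge of the tiling is an arrow between the two adjacent tiles, going
clockwise around its black vertex. -/
instance quiver : Quiver.{u} F.Tile := ⟨fun i j => {e : E // F.t e = i ∧ F.h e = j}⟩

/-- An edge, as an arrow of `Q`. -/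
def arrow (e : E) : F.t e ⟶ F.h e := ⟨e, rfl, rfl⟩

instance [Finite E] : Finite F.Tile := inferInstanceAs (Finite (Quotient _))

instance [Finite E] : Finite F.BlackVertex := inferInstanceAs (Finite (Quotient _))

instance [Finite E] : Finite F.WhiteVertex := inferInstanceAs (Finite (Quotient _))

/-- The cycle `e, σ e, σ² e, …` of arrows once around a vertex, starting with `e`. -/
def vertexCycle (σ : Equiv.Perm E) (e : E) : List E :=
  (List.range (Function.minimalPeriod σ e)).map fun m => (σ ^ m) e

/-- The broken loop from `h e` to `t e` around the black vertex of `e`. -/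
def brokenB (e : E) : List E := (vertexCycle F.σB e).tail

/-- The broken loop from `h e` to `t e` around the white vertex of `e`. -/
def brokenW (e : E) : List E := (vertexCycle F.σW e).tail

end

variable {E : Type u} [Finite E] (F : BraneTiling E)

/-- The edge variable `X_e` in the path algebra `ℂQ`. -/
def X (e : E) : PathAlgebra F.Tile := PathAlgebra.ofPath (F.arrow e).toPath

/-- The element of `ℂQ` given by the product of the arrows in a list. -/
def wordElem (l : List E) : PathAlgebra F.Tile := (l.map F.X).prod

/-- The potential `W`: the sum over the black vertices of the cycle of arrows around the vertex minus
the same sum over the white vertices.  The cycles are written with a chosen first arrow, i.e. this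
is a representative in `ℂQ` of the class in `ℂQ / [ℂQ, ℂQ]`; the derivatives below only depend
on the latter. -/
def potential : PathAlgebra F.Tile :=
  ∑ᶠ v : F.BlackVertex, F.wordElem (vertexCycle F.σB (Quotient.out v)) -
    ∑ᶠ v : F.WhiteVertex, F.wordElem (vertexCycle F.σW (Quotient.out v))

open Classical in
/-- `derivAux a p r` is the sum, over all ways to write the path `p` as `u a v`, of `(v r) u`. -/
def derivAux (a : E) : {i j : F.Tile} → Quiver.Path i j → PathAlgebra F.Tile → PathAlgebra F.Tile
  | _, _, .nil, _ => 0
  | _, _, .cons q b, r =>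
    (if b.1 = a then r * PathAlgebra.ofPath q else 0) +
      derivAux a q (PathAlgebra.ofPath b.toPath * r)

/-- The cyclic derivative `∂/∂X_a`: on a path `p` it is the sum, over all occurrences of `a` in `p`,
`p = u a v`, of `v u`, the result of cyclically permuting that occurrence to the front and deleting
it.  (It vanishes on paths that are not closed, as then `v u = 0`.) -/
def cyclicDeriv (a : E) : PathAlgebra F.Tile →ₗ[ℂ] PathAlgebra F.Tile :=
  PathAlgebra.lift fun p =>
    F.derivAux a p.2.2 (PathAlgebra.ofPath (Quiver.Path.nil : Quiver.Path p.2.1 p.2.1))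

/-- The algebra `A_F = ℂQ / ⟨∂W/∂X_a : a ∈ E(Q)⟩` of the tiling. -/
def Alg : Type u :=
  RingQuot fun x y : PathAlgebra F.Tile => ∃ a : E, x = F.cyclicDeriv a F.potential ∧ y = 0

instance : Ring F.Alg := inferInstanceAs (Ring (RingQuot _))

instance : Algebra ℂ F.Alg := inferInstanceAs (Algebra ℂ (RingQuot _))

/-- The quotient map `ℂQ → A_F`. -/
def toAlg : PathAlgebra F.Tile →ₐ[ℂ] F.Alg := RingQuot.mkAlgHom ℂ _

/-- The class `[u]` in `A_F` of a path `u`. -/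
def cls {i j : F.Tile} (u : Quiver.Path i j) : F.Alg := F.toAlg (PathAlgebra.ofPath u)

/-- The class in `A_F` of the simple loop at `t e` that starts with the arrow `e` and goes once around
the black vertex of `e`. -/
def simpleLoop (e : E) : F.Alg := F.toAlg (F.wordElem (vertexCycle F.σB e))

/-- Two paths ending at the tile `j` are weakly equivalent if `u ωⱼⁿ ∼ v ωⱼⁿ` for some `n`, where `ωⱼ`
is a simple loop at `j` (they are all F-term equivalent) and `∼` is F-term equivalence, i.e.
equality of classes in `A_F`. -/
def WeaklyEquivalent {i i' j : F.Tile} (u : Quiver.Path i j) (v : Quiver.Path i' j) : Prop :=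
  ∃ (e : E) (n : ℕ), F.t e = j ∧ F.cls u * F.simpleLoop e ^ n = F.cls v * F.simpleLoop e ^ n

/-- A tiling is consistent if weak equivalence implies F-term equivalence. -/
def IsConsistent : Prop :=
  ∀ (i i' j : F.Tile) (u : Quiver.Path i j) (v : Quiver.Path i' j),
    F.WeaklyEquivalent u v → F.cls u = F.cls v

end BraneTiling

/-! ### The complex of modules `Hom_ℂ(eᵢA, eⱼA)` -/

/-- The data in an algebra `A` from which the complex is built: elements `e i` (the idempotents) for
`i : V`, elements `x a` (the arrows) for `a : E`, the start `src a` and the end `tgt a` of each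
arrow, and for each arrow two words in the arrows, `wB a` and `wW a` (the two broken loops from
`tgt a` to `src a`).  It is only used for the data `BraneTiling.data` of a tiling and its opposite. -/
structure ArrowData (V E A : Type u) where
  e : V → A
  x : E → A
  src : E → V
  tgt : E → V
  wB : E → List E
  wW : E → List E

namespace ArrowData

variable {V E A : Type u}

/-- The same data in the opposite algebra: arrows and words are reversed. -/
def op (D : ArrowData V E A) : ArrowData V E Aᵐᵒᵖ where
  e i := MulOpposite.op (D.e i)
  x a := MulOpposite.op (D.x a)
  src := D.tgt
  tgt := D.src
  wB a := (D.wB a).reverse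
  wW a := (D.wW a).reverse

variable [Ring A] [Algebra ℂ A] (D : ArrowData V E A)

/-- The right ideal `eᵢA`. -/
def corner (i : V) : Submodule ℂ A := LinearMap.range (LinearMap.mulLeft ℂ (D.e i))

/-- The map `A → eᵢA`, `v ↦ eᵢ v`.  It is the identity on elements of `eᵢA`. -/
def toCorner (i : V) : A →ₗ[ℂ] D.corner i := (LinearMap.mulLeft ℂ (D.e i)).rangeRestrict

theorem coe_toCorner (i : V) (v : A) : (D.toCorner i v : A) = D.e i * v := rfl

/-- Right multiplication by `b` on `eᵢA`. -/
def mulRight (i : V) (b : A) : D.corner i →ₗ[ℂ] D.corner i :=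
  (LinearMap.mulRight ℂ b).restrict (by
    rintro _ ⟨v, rfl⟩
    exact ⟨v * b, by simp [mul_assoc]⟩)

theorem coe_mulRight (i : V) (b : A) (v : D.corner i) : (D.mulRight i b v : A) = v * b := rfl

theorem mulRight_toCorner (i : V) (b v : A) :
    D.mulRight i b (D.toCorner i v) = D.toCorner i (v * b) :=
  Subtype.ext (by simp [coe_mulRight, coe_toCorner, mul_assoc])

/-- `Hom_ℂ(eᵢA, eⱼA)`. -/
def HomC (i j : V) : Type u := D.corner i →ₗ[ℂ] D.corner j

instance (i j : V) : AddCommGroup (D.HomC i j) :=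
  inferInstanceAs (AddCommGroup (D.corner i →ₗ[ℂ] D.corner j))

instance (i j : V) : FunLike (D.HomC i j) (D.corner i) (D.corner j) :=
  inferInstanceAs (FunLike (D.corner i →ₗ[ℂ] D.corner j) _ _)

/-- The left `A`-module structure on `Hom_ℂ(eᵢA, eⱼA)` coming from the right module `eᵢA`:
`(b • φ) v = φ (v b)`. -/
instance (i j : V) : Module A (D.HomC i j) where
  smul b φ := LinearMap.comp φ (D.mulRight i b)
  one_smul φ := LinearMap.ext fun v =>
    congrArg φ (Subtype.ext (by simp [coe_mulRight]))
  mul_smul b c φ := LinearMap.ext fun v =>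
    congrArg φ (Subtype.ext (by simp [coe_mulRight, mul_assoc]))
  smul_zero b := rfl
  zero_smul φ := LinearMap.ext fun v =>
    (congrArg φ (Subtype.ext (by simp [coe_mulRight]))).trans (LinearMap.map_zero φ)
  smul_add b φ ψ := rfl
  add_smul b c φ := LinearMap.ext fun v =>
    (congrArg φ (Subtype.ext (by simp [coe_mulRight, mul_add]) :
      _ = D.mulRight i b v + D.mulRight i c v)).trans (LinearMap.map_add φ _ _)

theorem smul_apply {i j : V} (b : A) (φ : D.HomC i j) (v : D.corner i) :
    (b • φ) v = φ (D.mulRight i b v) := rfl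

theorem add_apply {i j : V} (φ ψ : D.HomC i j) (v : D.corner i) : (φ + ψ) v = φ v + ψ v := rfl

theorem homC_ext {i j : V} {φ ψ : D.HomC i j} (h : ∀ v, φ v = ψ v) : φ = ψ := LinearMap.ext h

/-- `⊕ᵢ Hom_ℂ(eᵢA, eᵢA)`, the sum over the (finitely many) vertices. -/
abbrev VertexTerm : Type u := ∀ i : V, D.HomC i i

/-- `⊕ₐ Hom_ℂ(e_{h(a)}A, e_{t(a)}A)`, the sum over the (finitely many) arrows. -/
abbrev ArrowTerm : Type u := ∀ a : E, D.HomC (D.tgt a) (D.src a)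

/-- `⊕ₐ Hom_ℂ(e_{t(a)}A, e_{h(a)}A)`, the sum over the (finitely many) arrows. -/
abbrev CoarrowTerm : Type u := ∀ a : E, D.HomC (D.src a) (D.tgt a)

/-- `ev(x)ᵢ(v) = v x`. -/
def ev : A →ₗ[A] D.VertexTerm where
  toFun x i := D.mulRight i x
  map_add' x y := funext fun _ => D.homC_ext fun v =>
    Subtype.ext (mul_add (v : A) x y)
  map_smul' b x := funext fun _ => D.homC_ext fun v =>
    Subtype.ext (mul_assoc (v : A) b x).symm

/-- `d(φ)ₐ(v) = a φ_{h(a)}(v) - φ_{t(a)}(a v)`. -/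
def d : D.VertexTerm →ₗ[A] D.ArrowTerm where
  toFun φ a :=
    (D.toCorner (D.src a) ∘ₗ LinearMap.mulLeft ℂ (D.x a) ∘ₗ (D.corner _).subtype ∘ₗ φ (D.tgt a)) -
      (φ (D.src a) ∘ₗ D.toCorner (D.src a) ∘ₗ LinearMap.mulLeft ℂ (D.x a) ∘ₗ (D.corner _).subtype)
  map_add' φ ψ := funext fun a => D.homC_ext fun v => by
    change D.toCorner _ (D.x a * ((φ _ v + ψ _ v : D.corner _) : A)) -
        (φ _ (D.toCorner _ (D.x a * v)) + ψ _ (D.toCorner _ (D.x a * v))) =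
      (D.toCorner _ (D.x a * (φ _ v : A)) - φ _ (D.toCorner _ (D.x a * v))) +
      (D.toCorner _ (D.x a * (ψ _ v : A)) - ψ _ (D.toCorner _ (D.x a * v)))
    rw [Submodule.coe_add, mul_add, map_add]
    abel
  map_smul' b φ := funext fun a => D.homC_ext fun v => by
    change D.toCorner _ (D.x a * (φ _ (D.mulRight _ b v) : A)) -
        φ _ (D.mulRight _ b (D.toCorner _ (D.x a * v))) =
      D.toCorner _ (D.x a * (φ _ (D.mulRight _ b v) : A)) -
        φ _ (D.toCorner _ (D.x a * (v * b)))
    rw [mulRight_toCorner, mul_assoc]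

/-- The product in `A` of the arrows in a word. -/
def word (w : List E) : A := (w.map D.x).prod

/-- For a word `w = b₁ ⋯ bₙ` and a family `ψ` of maps `ψ_b : e_{h(b)}A → e_{t(b)}A`, the sum over all
positions `k` of the compositions `v ↦ b₁ ⋯ b_{k-1} ψ_{b_k}(b_{k+1} ⋯ bₙ v)`. -/
def along (ψ : D.ArrowTerm) : List E → (A →ₗ[ℂ] A)
  | [] => 0
  | b :: w =>
    ((D.corner _).subtype ∘ₗ (ψ b : D.corner _ →ₗ[ℂ] D.corner _) ∘ₗ D.toCorner (D.tgt b) ∘ₗ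
      LinearMap.mulLeft ℂ (D.word w)) +
      LinearMap.mulLeft ℂ (D.x b) ∘ₗ along ψ w

theorem along_cons (ψ : D.ArrowTerm) (b : E) (w : List E) (v : A) :
    D.along ψ (b :: w) v =
      (ψ b (D.toCorner (D.tgt b) (D.word w * v)) : A) + D.x b * D.along ψ w v := rfl

theorem along_add (φ ψ : D.ArrowTerm) (w : List E) (v : A) :
    D.along (φ + ψ) w v = D.along φ w v + D.along ψ w v := by
  induction w with
  | nil => simp [along]
  | cons b w ih =>
    rw [along_cons, along_cons, along_cons, ih, Pi.add_apply, add_apply, Submodule.coe_add, mul_add]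
    abel

theorem along_smul (b : A) (ψ : D.ArrowTerm) (w : List E) (v : A) :
    D.along (b • ψ) w v = D.along ψ w (v * b) := by
  induction w with
  | nil => simp [along]
  | cons c w ih =>
    rw [along_cons, along_cons, ih, Pi.smul_apply, smul_apply, mulRight_toCorner, mul_assoc]

/-- `r(ψ)ₐ` is the difference of the maps `e_{t(a)}A → e_{h(a)}A` obtained from `ψ` along the two
broken loops of `a`. -/
def r : D.ArrowTerm →ₗ[A] D.CoarrowTerm where
  toFun ψ a :=
    D.toCorner (D.tgt a) ∘ₗ (D.along ψ (D.wB a) - D.along ψ (D.wW a)) ∘ₗ (D.corner _).subtype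
  map_add' φ ψ := funext fun a => D.homC_ext fun v => by
    change D.toCorner _ (D.along (φ + ψ) (D.wB a) v - D.along (φ + ψ) (D.wW a) v) =
      D.toCorner _ (D.along φ (D.wB a) v - D.along φ (D.wW a) v) +
        D.toCorner _ (D.along ψ (D.wB a) v - D.along ψ (D.wW a) v)
    rw [along_add, along_add, ← map_add]
    congr 1
    abel
  map_smul' b ψ := funext fun a => D.homC_ext fun v => by
    change D.toCorner _ (D.along (b • ψ) (D.wB a) v - D.along (b • ψ) (D.wW a) v) =
      D.toCorner _ (D.along ψ (D.wB a) (v * b) - D.along ψ (D.wW a) (v * b))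
    rw [along_smul, along_smul]

open Classical in
/-- `v ↦ ∑_{h(a) = i} νₐ(a v) - ∑_{t(a) = i} a νₐ(v)`. -/
def around [Fintype E] (ν : D.CoarrowTerm) (i : V) : A →ₗ[ℂ] A :=
  (∑ a ∈ Finset.univ.filter (fun a => D.tgt a = i),
      (D.corner _).subtype ∘ₗ (ν a : D.corner _ →ₗ[ℂ] D.corner _) ∘ₗ D.toCorner (D.src a) ∘ₗ
        LinearMap.mulLeft ℂ (D.x a)) -
    ∑ a ∈ Finset.univ.filter (fun a => D.src a = i),
      LinearMap.mulLeft ℂ (D.x a) ∘ₗ (D.corner _).subtype ∘ₗ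
        (ν a : D.corner _ →ₗ[ℂ] D.corner _) ∘ₗ D.toCorner (D.src a)

open Classical in
theorem around_apply [Fintype E] (ν : D.CoarrowTerm) (i : V) (v : A) :
    D.around ν i v =
      ∑ a ∈ Finset.univ.filter (fun a => D.tgt a = i), (ν a (D.toCorner (D.src a) (D.x a * v)) : A) -
        ∑ a ∈ Finset.univ.filter (fun a => D.src a = i),
          D.x a * (ν a (D.toCorner (D.src a) v) : A) := by
  rw [around, LinearMap.sub_apply, LinearMap.sum_apply, LinearMap.sum_apply]
  rfl

/-- `p(ν)ᵢ(v) = ∑_{h(a) = i} νₐ(a v) - ∑_{t(a) = i} a νₐ(v)`. -/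
def p [Fintype E] : D.CoarrowTerm →ₗ[A] D.VertexTerm where
  toFun ν i := D.toCorner i ∘ₗ D.around ν i ∘ₗ (D.corner i).subtype
  map_add' ν ξ := funext fun i => D.homC_ext fun v => by
    change D.toCorner i (D.around (ν + ξ) i v) =
      D.toCorner i (D.around ν i v) + D.toCorner i (D.around ξ i v)
    rw [← map_add, around_apply, around_apply, around_apply]
    simp only [Pi.add_apply, add_apply, Submodule.coe_add, mul_add, Finset.sum_add_distrib]
    congr 1
    abel
  map_smul' b ν := funext fun i => D.homC_ext fun v => by
    change D.toCorner i (D.around (b • ν) i v) = D.toCorner i (D.around ν i (v * b))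
    rw [around_apply, around_apply]
    simp only [Pi.smul_apply, smul_apply, mulRight_toCorner, mul_assoc]

/-- `0 → A → ⊕ᵢ Hom(eᵢA, eᵢA) → ⊕ₐ Hom(e_{h(a)}A, e_{t(a)}A) → ⊕ₐ Hom(e_{t(a)}A, e_{h(a)}A) →
⊕ᵢ Hom(eᵢA, eᵢA) → 0`, with the maps `ev, d, r, p`, is an injective resolution of the left
`A`-module `A`: the terms after `A` are injective `A`-modules and the sequence is exact. -/
def IsInjectiveResolution [Fintype E] : Prop :=
  Module.Injective A D.VertexTerm ∧ Module.Injective A D.ArrowTerm ∧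
  Module.Injective A D.CoarrowTerm ∧
  Function.Injective D.ev ∧ Function.Exact D.ev D.d ∧ Function.Exact D.d D.r ∧
  Function.Exact D.r D.p ∧ Function.Surjective D.p

end ArrowData

/-- The idempotents, arrows and broken loops in the algebra `A_F` of a tiling. -/
def BraneTiling.data {E : Type u} [Finite E] (F : BraneTiling E) :
    ArrowData F.Tile E F.Alg where
  e i := F.cls (Quiver.Path.nil : Quiver.Path i i)
  x a := F.cls (F.arrow a).toPath
  src := F.t
  tgt := F.h
  wB := F.brokenB
  wW := F.brokenW

/-- A (not necessarily Noetherian) ring is Gorenstein if it has finite injective dimension both as a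
left and as a right module over itself. -/
def IsGorensteinRing (A : Type u) [Ring A] : Prop :=
  (∃ n : ℕ, CategoryTheory.HasInjectiveDimensionLE (ModuleCat.of A A) n) ∧
  (∃ n : ℕ, CategoryTheory.HasInjectiveDimensionLE (ModuleCat.of Aᵐᵒᵖ A) n)

end

/-! The sequence is the `A`-dual of a complex of bimodules `P₃ → P₂ → P₁ → P₀ → A`, where `P₃ = P₀ =
⊕ᵢ Aeᵢ ⊗ eᵢA`, `P₂ = ⊕ₐ Ae_{h(a)} ⊗ e_{t(a)}A` and `P₁ = ⊕ₐ Ae_{t(a)} ⊗ e_{h(a)}A`. A left linear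
map `Aeₛ ⊗ eₜA → A` is the same as a `ℂ`-linear map `eₜA → eₛA`, and under this identification `ev,
d, r, p` are the transposes of `bdry₀, …, bdry₃`. If the bimodule complex is exact, it is a bounded
exact complex of projective left modules, hence contractible (`exists_contraction`), so its dual is
exact as well (`IsTiling.exact`). The terms are injective because they are coinduced from `ℂ`
(`injective_homC`).

Exactness at `A`, `P₀` and `P₁` is formal and holds for every algebra with such a presentation
(`projVertex_sub_sect₀_mem`, `projArrow_mem`). At `P₂` and `P₃` four facts are used: the sum `ω` of
the simple loops is central; it is regular; `⋂ ωⁿA = 0`; and `A` has a grading in which `ω` has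
degree `0` while every tile carries a closed path of non-zero degree. Given a cycle `c` in `P₂`,
summing `c` over a full turn around a vertex gives elements `f` that depend only on the tile and
whose change along an arrow `b` is `(1 ⊗ ω - ω ⊗ 1) c_b`. So `f` is parallel modulo the image of `1
⊗ ω - ω ⊗ 1`. Parallel families vanish, since a closed path of non-zero degree shifts the finitely
many homogeneous components (`mem_of_transport`). Hence `f = (1 ⊗ ω - ω ⊗ 1) S`, and as `1 ⊗ ω - ω ⊗
1` is injective (`loopDiff_injective`), `c` is the boundary of `S` (`projCoarrow_mem`). Injectivity
of `P₃ → P₂` is the same vanishing argument modulo `0`.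

The four facts come from the tiling as follows. The relations equate paths with paths, so the
classes of paths are a basis of `A` (`exists_basis_embedding`), and consistency, a statement about
paths, makes `ω` regular. Every path can be completed to a power of `ω`, whereas no `eᵢ` is
divisible by `ω`; this gives `⋂ ωⁿA = 0`. The grading is a class in the first cohomology of the
surface, non-zero because `g ≥ 1`, found by a dimension count from the Euler characteristic
(`exists_cocycle`). All these properties are collected in `IsTiling`, which is stable under passing
to the opposite algebra; this gives the statement for right modules. -/

noncomputable section

open scoped TensorProduct

/-! ### Products along the iterates of a permutation -/

/-- The product `x a * x (σ a) * ⋯ * x (σ ^ (n - 1) a)`. -/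
def iterProd {E B : Type*} [Monoid B] (x : E → B) (σ : Equiv.Perm E) (a : E) (n : ℕ) : B :=
  ((List.range n).map fun k => x ((σ ^ k) a)).prod

section iterProd

variable {E B : Type*} [Monoid B] (x : E → B) (σ : Equiv.Perm E)

@[simp]
theorem iterProd_zero (a : E) : iterProd x σ a 0 = 1 := rfl

theorem iterProd_succ (a : E) (n : ℕ) :
    iterProd x σ a (n + 1) = iterProd x σ a n * x ((σ ^ n) a) := by
  simp [iterProd, List.range_succ]

theorem iterProd_succ' (a : E) (n : ℕ) :
    iterProd x σ a (n + 1) = x a * iterProd x σ (σ a) n := by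
  simp only [iterProd, List.range_succ_eq_map, List.map_cons, List.prod_cons, List.map_map]
  simp [Function.comp_def, pow_succ]

theorem iterProd_add (a : E) (m n : ℕ) :
    iterProd x σ a (m + n) = iterProd x σ a m * iterProd x σ ((σ ^ m) a) n := by
  induction n with
  | zero => simp
  | succ n ih =>
    rw [← add_assoc, iterProd_succ, ih, iterProd_succ, mul_assoc, ← Equiv.Perm.mul_apply, ← pow_add,
      add_comm n m]

theorem map_range_prod (a : E) (n : ℕ) :
    (((List.range n).map fun k => (σ ^ k) a).map x).prod = iterProd x σ a n := by
  simp [iterProd, Function.comp_def]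

end iterProd

theorem Equiv.Perm.pow_minimalPeriod_apply {E : Type*} (σ : Equiv.Perm E) (a : E) :
    (σ ^ Function.minimalPeriod σ a) a = a := by
  rw [Equiv.Perm.coe_pow]
  exact Function.isPeriodicPt_minimalPeriod σ a

theorem Equiv.Perm.minimalPeriod_pos {E : Type*} [Finite E] (σ : Equiv.Perm E) (a : E) :
    0 < Function.minimalPeriod σ a :=
  Function.minimalPeriod_pos_of_mem_periodicPts (Function.mem_periodicPts.2
    ⟨orderOf σ, orderOf_pos σ, by
      rw [Function.IsPeriodicPt, Function.IsFixedPt, ← Equiv.Perm.coe_pow, pow_orderOf_eq_one]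
      rfl⟩)

theorem Equiv.Perm.minimalPeriod_apply' {E : Type*} [Finite E] (σ : Equiv.Perm E) (a : E) :
    Function.minimalPeriod σ (σ a) = Function.minimalPeriod σ a :=
  Function.minimalPeriod_apply (Function.minimalPeriod_pos_iff_mem_periodicPts.1
    (σ.minimalPeriod_pos a))

theorem Equiv.Perm.minimalPeriod_pow_apply {E : Type*} [Finite E] (σ : Equiv.Perm E) (n : ℕ)
    (a : E) : Function.minimalPeriod σ ((σ ^ n) a) = Function.minimalPeriod σ a := by
  induction n with
  | zero => simp
  | succ n ih => rw [pow_succ', Equiv.Perm.mul_apply, σ.minimalPeriod_apply', ih]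

theorem BraneTiling.vertexCycle_tail {E : Type*} (σ : Equiv.Perm E) (a : E) :
    (BraneTiling.vertexCycle σ a).tail =
      (List.range (Function.minimalPeriod σ a - 1)).map fun k => (σ ^ k) (σ a) := by
  rw [BraneTiling.vertexCycle]
  cases Function.minimalPeriod σ a with
  | zero => simp
  | succ n => simp [List.range_succ_eq_map, Function.comp_def, pow_succ]

/-! ### The two-sided complex -/

section sandwich

variable {A : Type u} [Ring A] [Algebra ℂ A]

/-- The map `u ⊗ v ↦ u x ⊗ y v`, as a map of left `A`-modules. -/
def sandwich (x y : A) : A ⊗[ℂ] A →ₗ[A] A ⊗[ℂ] A :=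
  TensorProduct.AlgebraTensorModule.map (LinearMap.toSpanSingleton A A x) (LinearMap.mulLeft ℂ y)

@[simp]
theorem sandwich_tmul (x y u v : A) : sandwich x y (u ⊗ₜ[ℂ] v) = (u * x) ⊗ₜ[ℂ] (y * v) := by
  simp [sandwich]

/-- A map of left modules out of `A ⊗ A` is determined by its values on the `1 ⊗ v`. -/
theorem tensor_hom_ext {M : Type*} [AddCommGroup M] [Module A M] {f g : A ⊗[ℂ] A →ₗ[A] M}
    (h : ∀ v : A, f (1 ⊗ₜ[ℂ] v) = g (1 ⊗ₜ[ℂ] v)) : f = g := by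
  ext t
  induction t using TensorProduct.induction_on with
  | zero => simp
  | add s t hs ht => rw [map_add, map_add, hs, ht]
  | tmul u v =>
    have : u ⊗ₜ[ℂ] v = u • (1 : A) ⊗ₜ[ℂ] v := by simp [TensorProduct.smul_tmul']
    rw [this, map_smul, map_smul, h]

theorem sandwich_comp (x y x' y' : A) (t : A ⊗[ℂ] A) :
    sandwich x y (sandwich x' y' t) = sandwich (x' * x) (y * y') t := by
  have : sandwich x y ∘ₗ sandwich x' y' = sandwich (x' * x) (y * y') :=
    tensor_hom_ext fun v => by simp [mul_assoc]
  exact LinearMap.congr_fun this t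

@[simp]
theorem sandwich_one_one (t : A ⊗[ℂ] A) : sandwich (1 : A) 1 t = t := by
  have : sandwich (1 : A) 1 = LinearMap.id := tensor_hom_ext fun v => by simp
  exact LinearMap.congr_fun this t

/-- The left linear map `u ⊗ v ↦ u φ(v)` on `A ⊗ A`. -/
def pairing {A M : Type u} [Ring A] [Algebra ℂ A] [AddCommGroup M] [Module ℂ M] [Module A M]
    [IsScalarTower ℂ A M] (φ : A →ₗ[ℂ] M) : A ⊗[ℂ] A →ₗ[A] M :=
  TensorProduct.AlgebraTensorModule.lift (LinearMap.toSpanSingleton A (A →ₗ[ℂ] M) φ)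

@[simp]
theorem pairing_tmul {A M : Type u} [Ring A] [Algebra ℂ A] [AddCommGroup M] [Module ℂ M]
    [Module A M] [IsScalarTower ℂ A M] (φ : A →ₗ[ℂ] M) (u v : A) :
    pairing φ (u ⊗ₜ[ℂ] v) = u • φ v := by
  simp [pairing]

end sandwich

namespace ArrowData

variable {V E A : Type u}

/-- A word in the arrows that is a path from `i` to `j`. -/
inductive IsPath (D : ArrowData V E A) : V → List E → V → Prop
  | nil (i : V) : IsPath D i [] i
  | cons {a : E} {l : List E} {j : V} :
    IsPath D (D.tgt a) l j → IsPath D (D.src a) (a :: l) j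

variable [Ring A] [Algebra ℂ A]

/-- The properties of the algebra of a consistent tiling on which the exactness of the complex
depends.  They are invariant under passing to the opposite algebra. -/
structure IsTiling [Fintype V] (D : ArrowData V E A) (σB σW : Equiv.Perm E) (ω : A)
    (θ : E → ℚ) : Prop where
  idem : CompleteOrthogonalIdempotents D.e
  e_mul_x : ∀ a, D.e (D.src a) * D.x a = D.x a
  x_mul_e : ∀ a, D.x a * D.e (D.tgt a) = D.x a
  src_black : ∀ a, D.src (σB a) = D.tgt a
  src_white : ∀ a, D.src (σW a) = D.tgt a
  sameCycle : ∀ a b, D.src a = D.src b → (σB * σW⁻¹).SameCycle a b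
  wB_eq : ∀ a, D.wB a = (BraneTiling.vertexCycle σB a).tail
  wW_eq : ∀ a, D.wW a = (BraneTiling.vertexCycle σW a).tail
  word_eq : ∀ a, D.word (D.wB a) = D.word (D.wW a)
  loop_eq : ∀ a, D.x a * D.word (D.wB a) = D.e (D.src a) * ω
  central : ∀ y, ω * y = y * ω
  regular : ∀ y, ω * y = 0 → y = 0
  separated : ∀ y, (∀ n : ℕ, ∃ z, y = ω ^ n * z) → y = 0
  degree_black : ∀ a, θ a + ((D.wB a).map θ).sum = 0
  degree_white : ∀ a, θ a + ((D.wW a).map θ).sum = 0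
  exists_degree_ne_zero : ∀ i, ∃ l, D.IsPath i l i ∧ (l.map θ).sum ≠ 0
  exists_lift : ∀ (B : Type u) [Ring B] [Algebra ℂ B] (ε : V → B) (y : E → B),
    CompleteOrthogonalIdempotents ε → (∀ a, ε (D.src a) * y a = y a) →
    (∀ a, y a * ε (D.tgt a) = y a) →
    (∀ a, ((D.wB a).map y).prod = ((D.wW a).map y).prod) →
    ∃ f : A →ₐ[ℂ] B, (∀ i, f (D.e i) = ε i) ∧ ∀ a, f (D.x a) = y a
  adjoin_eq_top : Algebra.adjoin ℂ (Set.range D.e ∪ Set.range D.x) = ⊤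

open Classical in
/-- The sum over all positions `w = w₁ b w₂` in a word of `u w₁ ⊗ w₂ v` placed at `b`. -/
def placements (D : ArrowData V E A) : List E → (A ⊗[ℂ] A →ₗ[A] (E → A ⊗[ℂ] A))
  | [] => 0
  | b :: w => LinearMap.single A (fun _ => A ⊗[ℂ] A) b ∘ₗ sandwich 1 (D.word w) +
      placements D w ∘ₗ sandwich (D.x b) 1

variable (D : ArrowData V E A)

/-- The projection to `⊕ᵢ Aeᵢ ⊗ eᵢA`. -/
def projVertex : (V → A ⊗[ℂ] A) →ₗ[A] (V → A ⊗[ℂ] A) :=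
  LinearMap.pi fun i => sandwich (D.e i) (D.e i) ∘ₗ LinearMap.proj i

/-- The projection to `⊕ₐ Ae_{t(a)} ⊗ e_{h(a)}A`. -/
def projArrow : (E → A ⊗[ℂ] A) →ₗ[A] (E → A ⊗[ℂ] A) :=
  LinearMap.pi fun a => sandwich (D.e (D.src a)) (D.e (D.tgt a)) ∘ₗ LinearMap.proj a

/-- The projection to `⊕ₐ Ae_{h(a)} ⊗ e_{t(a)}A`. -/
def projCoarrow : (E → A ⊗[ℂ] A) →ₗ[A] (E → A ⊗[ℂ] A) :=
  LinearMap.pi fun a => sandwich (D.e (D.tgt a)) (D.e (D.src a)) ∘ₗ LinearMap.proj a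

/-- The map `⊕ᵢ Aeᵢ ⊗ eᵢA → ⊕ₐ Ae_{h(a)} ⊗ e_{t(a)}A`. -/
def bdry₃ : (V → A ⊗[ℂ] A) →ₗ[A] (E → A ⊗[ℂ] A) :=
  LinearMap.pi fun a => sandwich (D.e (D.tgt a)) (D.x a) ∘ₗ LinearMap.proj (D.tgt a) -
    sandwich (D.x a) (D.e (D.src a)) ∘ₗ LinearMap.proj (D.src a)

/-- The map `⊕ₐ Ae_{h(a)} ⊗ e_{t(a)}A → ⊕ₐ Ae_{t(a)} ⊗ e_{h(a)}A`. -/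
def bdry₂ [Fintype E] : (E → A ⊗[ℂ] A) →ₗ[A] (E → A ⊗[ℂ] A) :=
  ∑ a, (D.placements (D.wB a) - D.placements (D.wW a)) ∘ₗ
    sandwich (D.e (D.tgt a)) (D.e (D.src a)) ∘ₗ LinearMap.proj a

open Classical in
/-- The map `⊕ₐ Ae_{t(a)} ⊗ e_{h(a)}A → ⊕ᵢ Aeᵢ ⊗ eᵢA`. -/
def bdry₁ [Fintype E] : (E → A ⊗[ℂ] A) →ₗ[A] (V → A ⊗[ℂ] A) :=
  ∑ a, (LinearMap.single A (fun _ => A ⊗[ℂ] A) (D.tgt a) ∘ₗ sandwich (D.x a) (D.e (D.tgt a)) -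
    LinearMap.single A (fun _ => A ⊗[ℂ] A) (D.src a) ∘ₗ sandwich (D.e (D.src a)) (D.x a)) ∘ₗ
    LinearMap.proj a

/-- The map `⊕ᵢ Aeᵢ ⊗ eᵢA → A` given by the multiplication. -/
def bdry₀ [Fintype V] : (V → A ⊗[ℂ] A) →ₗ[A] A :=
  ∑ i, pairing LinearMap.id ∘ₗ sandwich (D.e i) (D.e i) ∘ₗ LinearMap.proj i

theorem projVertex_apply (s : V → A ⊗[ℂ] A) (i : V) :
    D.projVertex s i = sandwich (D.e i) (D.e i) (s i) := rfl

theorem projArrow_apply (c : E → A ⊗[ℂ] A) (a : E) :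
    D.projArrow c a = sandwich (D.e (D.src a)) (D.e (D.tgt a)) (c a) := rfl

theorem projCoarrow_apply (c : E → A ⊗[ℂ] A) (a : E) :
    D.projCoarrow c a = sandwich (D.e (D.tgt a)) (D.e (D.src a)) (c a) := rfl

theorem bdry₃_apply (s : V → A ⊗[ℂ] A) (a : E) :
    D.bdry₃ s a = sandwich (D.e (D.tgt a)) (D.x a) (s (D.tgt a)) -
      sandwich (D.x a) (D.e (D.src a)) (s (D.src a)) := rfl

theorem bdry₂_apply [Fintype E] (c : E → A ⊗[ℂ] A) :
    D.bdry₂ c = ∑ a, (D.placements (D.wB a) (D.projCoarrow c a) -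
      D.placements (D.wW a) (D.projCoarrow c a)) := by
  simp [bdry₂, projCoarrow_apply]

open Classical in
theorem bdry₁_apply [Fintype E] (c : E → A ⊗[ℂ] A) :
    D.bdry₁ c = ∑ a, (Pi.single (D.tgt a) (sandwich (D.x a) (D.e (D.tgt a)) (c a)) -
      Pi.single (D.src a) (sandwich (D.e (D.src a)) (D.x a) (c a))) := by
  simp [bdry₁]

theorem bdry₀_apply [Fintype V] (s : V → A ⊗[ℂ] A) :
    D.bdry₀ s = ∑ i, pairing LinearMap.id (D.projVertex s i) := by
  simp [bdry₀, projVertex_apply]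

end ArrowData

/-! ### The bimodule maps compose to zero. -/

namespace ArrowData

variable {V E A : Type u} [Ring A] [Algebra ℂ A] (D : ArrowData V E A)

/-- The part of `ArrowData.IsTiling` that concerns the vertices of one colour. -/
structure IsColour (σ : Equiv.Perm E) (w : E → List E) (ω : A) : Prop where
  e_mul_x : ∀ a, D.e (D.src a) * D.x a = D.x a
  x_mul_e : ∀ a, D.x a * D.e (D.tgt a) = D.x a
  src_apply : ∀ a, D.src (σ a) = D.tgt a
  word_eq : ∀ a, w a = (BraneTiling.vertexCycle σ a).tail
  loop_eq : ∀ a, D.x a * D.word (w a) = D.e (D.src a) * ω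

variable {D}

theorem IsTiling.black [Fintype V] {σB σW : Equiv.Perm E} {ω : A} {θ : E → ℚ}
    (H : D.IsTiling σB σW ω θ) : D.IsColour σB D.wB ω :=
  ⟨H.e_mul_x, H.x_mul_e, H.src_black, H.wB_eq, H.loop_eq⟩

theorem IsTiling.white [Fintype V] {σB σW : Equiv.Perm E} {ω : A} {θ : E → ℚ}
    (H : D.IsTiling σB σW ω θ) : D.IsColour σW D.wW ω :=
  ⟨H.e_mul_x, H.x_mul_e, H.src_white, H.wW_eq, fun a => by rw [← H.word_eq, H.loop_eq]⟩

-- The index `k` is the position of `b` in the word. The part before `b` has length `k`, the part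
-- after it `n - 1 - k`.
open Classical in
theorem placements_range (σ : Equiv.Perm E) (a : E) (n : ℕ) (t : A ⊗[ℂ] A) (b : E) :
    D.placements ((List.range n).map fun k => (σ ^ k) a) t b =
      ∑ k ∈ Finset.range n, if (σ ^ k) a = b then
        sandwich (iterProd D.x σ a k) (iterProd D.x σ ((σ ^ (k + 1)) a) (n - 1 - k)) t else 0 := by
  induction n generalizing a t with
  | zero => simp [placements]
  | succ n ih =>
    have h : ((List.range (n + 1)).map fun k => (σ ^ k) a) =
        a :: (List.range n).map fun k => (σ ^ k) (σ a) := by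
      simp [List.range_succ_eq_map, Function.comp_def, pow_succ]
    rw [h, Finset.sum_range_succ', placements, add_comm, LinearMap.add_apply, Pi.add_apply,
      LinearMap.comp_apply, LinearMap.comp_apply, LinearMap.single_apply, ih]
    congr 1
    · refine Finset.sum_congr rfl fun k _ => ?_
      rw [pow_succ σ k, Equiv.Perm.mul_apply, sandwich_comp, mul_one, iterProd_succ']
      simp only [pow_succ, Equiv.Perm.mul_apply, Nat.add_sub_cancel, Nat.sub_sub, add_comm 1 k]
    · by_cases hab : a = b
      · subst hab
        simp [ArrowData.word, iterProd, Function.comp_def]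
      · simp [hab]

/-- The component at an arrow of the sum of the `placements` along the broken loops of one
colour. -/
def cycleSum (x : E → A) (σ : Equiv.Perm E) (c : E → A ⊗[ℂ] A) (b : E) : A ⊗[ℂ] A :=
  ∑ k ∈ Finset.range (Function.minimalPeriod σ b - 1),
    sandwich (iterProd x σ ((σ⁻¹ ^ k) b) k)
      (iterProd x σ (σ b) (Function.minimalPeriod σ b - 1 - 1 - k)) (c ((σ⁻¹ ^ (k + 1)) b))

/-- Regrouping by position: the arrow whose broken loop has `b` in position `k` is `σ⁻¹ ^ (k + 1)`
applied to `b`. -/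
theorem sum_placements [Fintype E] (σ : Equiv.Perm E) (c : E → A ⊗[ℂ] A) (b : E) :
    ∑ a, D.placements (BraneTiling.vertexCycle σ a).tail (c a) b = cycleSum D.x σ c b := by
  classical
  have h1 : ∀ (k : ℕ) (a : E), (σ ^ k) (σ a) = b ↔ a = (σ⁻¹ ^ (k + 1)) b := by
    intro k a
    rw [← Equiv.Perm.mul_apply, ← pow_succ, inv_pow, Equiv.Perm.eq_inv_iff_eq]
  have h2 : ∀ (k : ℕ) (a : E), a = (σ⁻¹ ^ (k + 1)) b →
      Function.minimalPeriod σ a = Function.minimalPeriod σ b := by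
    intro k a h
    rw [← (h1 k a).2 h, ← Equiv.Perm.mul_apply, ← pow_succ, Equiv.Perm.minimalPeriod_pow_apply]
  have h3 : ∀ a, D.placements (BraneTiling.vertexCycle σ a).tail (c a) b =
      ∑ k ∈ Finset.range (Function.minimalPeriod σ b - 1), if a = (σ⁻¹ ^ (k + 1)) b then
        sandwich (iterProd D.x σ ((σ⁻¹ ^ k) b) k)
          (iterProd D.x σ (σ b) (Function.minimalPeriod σ b - 1 - 1 - k)) (c a) else 0 := by
    intro a
    rw [BraneTiling.vertexCycle_tail, placements_range]
    simp only [h1]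
    by_cases hab : Function.minimalPeriod σ a = Function.minimalPeriod σ b
    · rw [hab]
      refine Finset.sum_congr rfl fun k _ => ?_
      split_ifs with h
      · have e1 : σ a = (σ⁻¹ ^ k) b := by
          rw [h, pow_succ', Equiv.Perm.mul_apply, ← Equiv.Perm.mul_apply, mul_inv_cancel, Equiv.Perm.one_apply]
        rw [pow_succ', Equiv.Perm.mul_apply, (h1 k a).2 h, e1]
      · rfl
    · rw [Finset.sum_eq_zero, Finset.sum_eq_zero]
      · exact fun k _ => if_neg fun h => hab (h2 k a h)
      · exact fun k _ => if_neg fun h => hab (h2 k a h)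
  simp only [h3, cycleSum]
  rw [Finset.sum_comm]
  refine Finset.sum_congr rfl fun k _ => ?_
  simp

theorem IsTiling.bdry₂_apply_apply [Fintype V] [Fintype E] {σB σW : Equiv.Perm E} {ω : A}
    {θ : E → ℚ} (H : D.IsTiling σB σW ω θ) (c : E → A ⊗[ℂ] A) (b : E) :
    D.bdry₂ c b = cycleSum D.x σB (D.projCoarrow c) b - cycleSum D.x σW (D.projCoarrow c) b := by
  rw [bdry₂_apply, Finset.sum_apply]
  simp only [Pi.sub_apply, Finset.sum_sub_distrib, H.wB_eq, H.wW_eq, sum_placements]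

theorem _root_.Equiv.Perm.inv_pow_apply_eq {E : Type*} (σ : Equiv.Perm E) (b : E) {k : ℕ}
    (hk : k ≤ Function.minimalPeriod σ b) :
    (σ⁻¹ ^ k) b = (σ ^ (Function.minimalPeriod σ b - k)) b := by
  rw [inv_pow, Equiv.Perm.inv_eq_iff_eq, ← Equiv.Perm.mul_apply, ← pow_add,
    Nat.add_sub_cancel' hk, σ.pow_minimalPeriod_apply]

section IsColour

variable {A : Type u} [Ring A] {D : ArrowData V E A} {σ : Equiv.Perm E} {w : E → List E} {ω : A}

theorem IsColour.word_eq_iterProd (C : D.IsColour σ w ω) (a : E) :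
    D.word (w a) = iterProd D.x σ (σ a) (Function.minimalPeriod σ a - 1) := by
  rw [C.word_eq, BraneTiling.vertexCycle_tail, word, map_range_prod]

theorem IsColour.iterProd_loop [Finite E] (C : D.IsColour σ w ω) (a : E) :
    iterProd D.x σ a (Function.minimalPeriod σ a) = D.e (D.src a) * ω := by
  rw [← C.loop_eq, C.word_eq_iterProd, ← iterProd_succ',
    Nat.sub_add_cancel (σ.minimalPeriod_pos a)]

theorem IsColour.e_mul_iterProd_succ (C : D.IsColour σ w ω) (a : E) (n : ℕ) :
    D.e (D.src a) * iterProd D.x σ a (n + 1) = iterProd D.x σ a (n + 1) := by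
  rw [iterProd_succ', ← mul_assoc, C.e_mul_x]

theorem IsColour.iterProd_succ_mul_e (C : D.IsColour σ w ω) (a : E) (n : ℕ) :
    iterProd D.x σ a (n + 1) * D.e (D.src ((σ ^ (n + 1)) a)) = iterProd D.x σ a (n + 1) := by
  rw [iterProd_succ, mul_assoc, pow_succ', Equiv.Perm.mul_apply, C.src_apply, C.x_mul_e]

theorem IsColour.isPath_range (C : D.IsColour σ w ω) (a : E) (n : ℕ) :
    D.IsPath (D.src a) ((List.range n).map fun k => (σ ^ k) a) (D.src ((σ ^ n) a)) := by
  induction n generalizing a with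
  | zero => exact .nil _
  | succ n ih =>
    rw [List.range_succ_eq_map, List.map_cons, List.map_map]
    refine .cons ?_
    have := ih (σ a)
    rw [C.src_apply] at this
    simpa [Function.comp_def, pow_succ] using this

theorem IsColour.isPath [Finite E] (C : D.IsColour σ w ω) (a : E) :
    D.IsPath (D.tgt a) (w a) (D.src a) := by
  have := C.isPath_range (σ a) (Function.minimalPeriod σ a - 1)
  rw [← BraneTiling.vertexCycle_tail, ← Equiv.Perm.mul_apply, ← pow_succ,
    Nat.sub_add_cancel (σ.minimalPeriod_pos a), σ.pow_minimalPeriod_apply, C.src_apply,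
    ← C.word_eq] at this
  exact this

end IsColour

theorem IsPath.e_mul_word {A : Type u} [Ring A] {D : ArrowData V E A}
    (h1 : ∀ a, D.e (D.src a) * D.x a = D.x a)
    (h2 : ∀ a, D.x a * D.e (D.tgt a) = D.x a) {i j : V} {l : List E} (h : D.IsPath i l j) :
    D.e i * D.word l = D.word l * D.e j := by
  induction h with
  | nil i => simp [word]
  | @cons a l j _ ih =>
    have : D.word (a :: l) = D.x a * D.word l := by simp [word]
    rw [this, ← mul_assoc, h1, mul_assoc, ← ih, ← mul_assoc, h2]

open Classical in
theorem bdry₁_single [Fintype E] (a : E) (t : A ⊗[ℂ] A) :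
    D.bdry₁ (Pi.single a t) = Pi.single (D.tgt a) (sandwich (D.x a) (D.e (D.tgt a)) t) -
      Pi.single (D.src a) (sandwich (D.e (D.src a)) (D.x a) t) := by
  rw [bdry₁_apply, Finset.sum_eq_single a]
  · simp
  · intro b _ hb
    simp [Pi.single_eq_of_ne hb]
  · simp

-- Along a path the target contribution of each arrow cancels the source contribution of the next
-- one, so only the two ends survive.
open Classical in
theorem bdry₁_placements [Fintype E] (h1 : ∀ a, D.e (D.src a) * D.x a = D.x a)
    (h2 : ∀ a, D.x a * D.e (D.tgt a) = D.x a) {i j : V} {l : List E} (h : D.IsPath i l j)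
    (t : A ⊗[ℂ] A) (hi : sandwich (D.e i) 1 t = t) (hj : sandwich 1 (D.e j) t = t) :
    D.bdry₁ (D.placements l t) = Pi.single j (sandwich (D.word l) (D.e j) t) -
      Pi.single i (sandwich (D.e i) (D.word l) t) := by
  induction h generalizing t with
  | nil i => simp [word, placements, hi, hj]
  | @cons a l j hl ih =>
    have hw : D.word (a :: l) = D.x a * D.word l := by simp [word]
    have h3 : sandwich (D.x a) (D.word l) t = sandwich (D.x a) (D.e (D.tgt a) * D.word l) t := by
      conv_lhs => rw [← hj]
      rw [sandwich_comp, one_mul, hl.e_mul_word h1 h2]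
    have h4 : sandwich 1 (D.e j) (sandwich (D.x a) 1 t) = sandwich (D.x a) 1 t := by
      conv_rhs => rw [← hj]
      rw [sandwich_comp, sandwich_comp, one_mul, mul_one, one_mul, mul_one]
    have h5 : sandwich (D.e (D.tgt a)) 1 (sandwich (D.x a) 1 t) = sandwich (D.x a) 1 t := by
      rw [sandwich_comp, h2, one_mul]
    rw [placements, LinearMap.add_apply, map_add, LinearMap.comp_apply, LinearMap.comp_apply,
      LinearMap.single_apply, bdry₁_single, ih _ h5 h4]
    simp only [sandwich_comp, hw, one_mul, mul_one, h2, h3]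
    abel

variable [Fintype V] [Fintype E] {σB σW : Equiv.Perm E} {ω : A} {θ : E → ℚ}

theorem IsTiling.bdry₁_bdry₂ (H : D.IsTiling σB σW ω θ) (c : E → A ⊗[ℂ] A) :
    D.bdry₁ (D.bdry₂ c) = 0 := by
  classical
  rw [bdry₂_apply, map_sum]
  refine Finset.sum_eq_zero fun a _ => ?_
  have ht : sandwich 1 (D.e (D.src a)) (D.projCoarrow c a) = D.projCoarrow c a := by
    rw [projCoarrow_apply, sandwich_comp, mul_one, H.idem.idem]
  have ht' : sandwich (D.e (D.tgt a)) 1 (D.projCoarrow c a) = D.projCoarrow c a := by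
    rw [projCoarrow_apply, sandwich_comp, one_mul, H.idem.idem]
  rw [map_sub, bdry₁_placements H.e_mul_x H.x_mul_e (H.black.isPath a) _ ht' ht,
    bdry₁_placements H.e_mul_x H.x_mul_e (H.white.isPath a) _ ht' ht, H.word_eq, sub_self]

theorem IsTiling.bdry₀_bdry₁ (H : D.IsTiling σB σW ω θ) (c : E → A ⊗[ℂ] A) :
    D.bdry₀ (D.bdry₁ c) = 0 := by
  classical
  rw [bdry₁_apply, map_sum]
  refine Finset.sum_eq_zero fun a _ => ?_
  have key : ∀ (i : V) (t : A ⊗[ℂ] A), D.bdry₀ (Pi.single i t) =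
      pairing LinearMap.id (sandwich (D.e i) (D.e i) t) := by
    intro i t
    rw [bdry₀_apply, Finset.sum_eq_single i]
    · rw [projVertex_apply, Pi.single_eq_same]
    · intro j _ hj
      simp [projVertex_apply, Pi.single_eq_of_ne hj]
    · simp
  have h2 : pairing LinearMap.id ∘ₗ sandwich (D.x a) (D.e (D.tgt a)) =
      pairing LinearMap.id ∘ₗ sandwich (D.e (D.src a)) (D.x a) := by
    refine tensor_hom_ext fun v => ?_
    simp only [LinearMap.comp_apply, sandwich_tmul, pairing_tmul, LinearMap.id_apply, one_mul,
      smul_eq_mul, ← mul_assoc]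
    rw [H.x_mul_e, H.e_mul_x]
  have h3 := LinearMap.congr_fun h2 (c a)
  simp only [LinearMap.comp_apply] at h3
  rw [map_sub, key, key, sandwich_comp, sandwich_comp, H.idem.idem, H.idem.idem, H.x_mul_e,
    H.e_mul_x, h3, sub_self]

theorem IsTiling.projCoarrow_bdry₃ (H : D.IsTiling σB σW ω θ) (s : V → A ⊗[ℂ] A) :
    D.projCoarrow (D.bdry₃ s) = D.bdry₃ s := by
  funext a
  rw [projCoarrow_apply, bdry₃_apply, map_sub, sandwich_comp, sandwich_comp, H.idem.idem,
    H.idem.idem, H.x_mul_e, H.e_mul_x]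

/-- The sum telescopes around the vertex. The ends that remain involve only the broken loop of `b`,
whose class is the same for both colours; hence `bdry₂_bdry₃`. -/
theorem IsColour.cycleSum_bdry₃ {σ : Equiv.Perm E} {w : E → List E} (C : D.IsColour σ w ω)
    (s : V → A ⊗[ℂ] A) (b : E) : cycleSum D.x σ (D.bdry₃ s) b =
      sandwich (D.e (D.src b)) (D.word (w b) * D.e (D.src b)) (s (D.src b)) -
      sandwich (D.e (D.tgt b) * D.word (w b)) (D.e (D.tgt b)) (s (D.tgt b)) := by
  set d := Function.minimalPeriod σ b with hd
  have hd0 : 0 < d := σ.minimalPeriod_pos b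
  let β : ℕ → E := fun k => (σ⁻¹ ^ k) b
  have hβ : ∀ k, σ (β (k + 1)) = β k := fun k => by
    simp only [β]
    rw [pow_succ', Equiv.Perm.mul_apply, ← Equiv.Perm.mul_apply, mul_inv_cancel,
      Equiv.Perm.one_apply]
  -- The telescoping quantity. The idempotents matter only when one of the two products is empty, at
  -- `k = 0` and `k = d - 1`.
  let Hk : ℕ → A ⊗[ℂ] A := fun k =>
    sandwich (D.e (D.src (β k)) * iterProd D.x σ (β k) k)
      (iterProd D.x σ (σ b) (d - 1 - k) * D.e (D.src (β k))) (s (D.src (β k)))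
  have key : cycleSum D.x σ (D.bdry₃ s) b = ∑ k ∈ Finset.range (d - 1), (Hk k - Hk (k + 1)) := by
    refine Finset.sum_congr rfl fun k hk => ?_
    rw [Finset.mem_range] at hk
    have e1 : D.tgt (β (k + 1)) = D.src (β k) := by rw [← C.src_apply, hβ]
    have e2 : iterProd D.x σ (σ b) (d - 1 - 1 - k) * D.x (β (k + 1)) =
        iterProd D.x σ (σ b) (d - 1 - k) := by
      have : d - 1 - k = (d - 1 - 1 - k) + 1 := by omega
      rw [this, iterProd_succ]
      congr 2
      simp only [β]
      rw [σ.inv_pow_apply_eq b (by omega), ← Equiv.Perm.mul_apply, ← pow_succ]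
      congr 2
      omega
    have e3 : D.x (β (k + 1)) * iterProd D.x σ (β k) k =
        D.e (D.src (β (k + 1))) * iterProd D.x σ (β (k + 1)) (k + 1) := by
      rw [C.e_mul_iterProd_succ, iterProd_succ', hβ]
    have e4 : d - 1 - (k + 1) = d - 1 - 1 - k := by omega
    change sandwich (iterProd D.x σ (β k) k) (iterProd D.x σ (σ b) (d - 1 - 1 - k))
      (D.bdry₃ s (β (k + 1))) = _
    rw [bdry₃_apply, map_sub, sandwich_comp, sandwich_comp, e2, e3]
    simp only [Hk, e4]
    rw [e1, ← e2, mul_assoc, ← e1, C.x_mul_e]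
  rw [key, Finset.sum_range_sub']
  have h0 : β 0 = b := rfl
  have h1 : β (d - 1) = σ b := by
    simp only [β]
    rw [σ.inv_pow_apply_eq b (by omega)]
    have : d - (d - 1) = 1 := by omega
    rw [← hd, this, pow_one]
  simp only [Hk, h0, h1, C.src_apply, C.word_eq_iterProd, ← hd, iterProd_zero, mul_one, one_mul,
    Nat.sub_zero, Nat.sub_self]

theorem IsTiling.bdry₂_bdry₃ (H : D.IsTiling σB σW ω θ) (s : V → A ⊗[ℂ] A) :
    D.bdry₂ (D.bdry₃ s) = 0 := by
  funext b
  rw [H.bdry₂_apply_apply, H.projCoarrow_bdry₃, H.black.cycleSum_bdry₃, H.white.cycleSum_bdry₃,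
    H.word_eq, sub_self, Pi.zero_apply]

end ArrowData

/-! ### Exactness at the vertex and arrow terms, from generators and relations. -/

namespace ArrowData

variable {V E A : Type u} [Ring A] [Algebra ℂ A] {D : ArrowData V E A}

/-- A subspace stable under left multiplication by generators is a left ideal. This serves as
induction on the length of a path. -/
theorem mem_of_mul_mem (hD : Algebra.adjoin ℂ (Set.range D.e ∪ Set.range D.x) = ⊤)
    (S : Submodule ℂ A) (h1 : 1 ∈ S)
    (he : ∀ i, ∀ y ∈ S, D.e i * y ∈ S) (hx : ∀ a, ∀ y ∈ S, D.x a * y ∈ S) (y : A) : y ∈ S := by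
  have h : ∀ z ∈ Algebra.adjoin ℂ (Set.range D.e ∪ Set.range D.x), ∀ y ∈ S, z * y ∈ S := by
    intro z hz
    induction hz using Algebra.adjoin_induction with
    | mem z hz =>
      rcases hz with ⟨i, rfl⟩ | ⟨a, rfl⟩
      · exact he i
      · exact hx a
    | algebraMap c =>
      intro y hy
      rw [← Algebra.smul_def]
      exact S.smul_mem c hy
    | add z z' _ _ hz hz' =>
      intro y hy
      rw [add_mul]
      exact S.add_mem (hz y hy) (hz' y hy)
    | mul z z' _ _ hz hz' =>
      intro y hy
      rw [mul_assoc]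
      exact hz _ (hz' y hy)
  have := h y (by rw [hD]; trivial) 1 h1
  rwa [mul_one] at this

variable [Fintype V] {σB σW : Equiv.Perm E} {ω : A} {θ : E → ℚ}

theorem IsTiling.eq_top_of_mul_mem (H : D.IsTiling σB σW ω θ) (S : Submodule ℂ A) (h1 : 1 ∈ S)
    (he : ∀ i, ∀ y ∈ S, D.e i * y ∈ S) (hx : ∀ a, ∀ y ∈ S, D.x a * y ∈ S) (y : A) : y ∈ S :=
  mem_of_mul_mem H.adjoin_eq_top S h1 he hx y

/-- The section `x ↦ ∑ᵢ x eᵢ ⊗ eᵢ` of the multiplication. -/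
def sect₀ (D : ArrowData V E A) : A →ₗ[A] (V → A ⊗[ℂ] A) :=
  LinearMap.pi fun i => LinearMap.toSpanSingleton A _ (D.e i ⊗ₜ[ℂ] D.e i)

theorem sect₀_apply (x : A) (i : V) : D.sect₀ x i = (x * D.e i) ⊗ₜ[ℂ] D.e i := by
  simp [sect₀, TensorProduct.smul_tmul']

theorem IsTiling.e_mul_self (H : D.IsTiling σB σW ω θ) (i : V) : D.e i * D.e i = D.e i :=
  H.idem.idem i

theorem IsTiling.e_mul_e [DecidableEq V] (H : D.IsTiling σB σW ω θ) (i j : V) :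
    D.e i * D.e j = if i = j then D.e i else 0 := by
  split_ifs with h
  · rw [← h, H.idem.idem]
  · exact H.idem.ortho h

theorem IsTiling.bdry₀_sect₀ (H : D.IsTiling σB σW ω θ) (x : A) : D.bdry₀ (D.sect₀ x) = x := by
  rw [bdry₀_apply]
  simp only [projVertex_apply, sect₀_apply, sandwich_tmul, pairing_tmul, LinearMap.id_apply,
    smul_eq_mul, mul_assoc, H.e_mul_self]
  rw [← Finset.mul_sum, H.idem.complete, mul_one]

theorem bdry₀_single [DecidableEq V] (i : V) (t : A ⊗[ℂ] A) : D.bdry₀ (Pi.single i t) =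
    pairing LinearMap.id (sandwich (D.e i) (D.e i) t) := by
  rw [bdry₀_apply, Finset.sum_eq_single i]
  · rw [projVertex_apply, Pi.single_eq_same]
  · intro j _ hj
    simp [projVertex_apply, Pi.single_eq_of_ne hj]
  · simp

variable [Fintype E]

/-- By left linearity it suffices to treat `f v = (eᵢ ⊗ eᵢv - veᵢ ⊗ eᵢ)ᵢ`. This vanishes at `v = 1`,
and prepending an arrow to `v` multiplies `f v` by the arrow on the left, up to a boundary. -/
theorem IsTiling.projVertex_sub_sect₀_mem (H : D.IsTiling σB σW ω θ) (s : V → A ⊗[ℂ] A) :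
    D.projVertex s - D.sect₀ (D.bdry₀ s) ∈ LinearMap.range D.bdry₁ := by
  classical
  let f : A →ₗ[ℂ] (V → A ⊗[ℂ] A) :=
    (D.projVertex.restrictScalars ℂ) ∘ₗ (LinearMap.pi fun _ => TensorProduct.mk ℂ A A 1) -
      D.sect₀.restrictScalars ℂ
  have hf : ∀ v i, f v i = D.e i ⊗ₜ[ℂ] (D.e i * v) - (v * D.e i) ⊗ₜ[ℂ] D.e i := by
    intro v i
    simp [f, projVertex_apply, sect₀_apply]
  have hmem : ∀ v, f v ∈ LinearMap.range D.bdry₁ := by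
    intro v
    refine H.eq_top_of_mul_mem (((LinearMap.range D.bdry₁).restrictScalars ℂ).comap f) ?_ ?_ ?_ v
    · refine ⟨0, ?_⟩
      rw [map_zero]
      funext i
      rw [hf, mul_one, one_mul, sub_self]
      rfl
    · intro i y hy
      have : f (D.e i * y) = D.e i • f y := by
        funext k
        rw [Pi.smul_apply, hf, hf, smul_sub, TensorProduct.smul_tmul', TensorProduct.smul_tmul',
          smul_eq_mul, smul_eq_mul, ← mul_assoc, ← mul_assoc, H.e_mul_e, H.e_mul_e]
        congr 1
        by_cases h : k = i
        · subst h; simp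
        · simp [h, Ne.symm h]
      change f _ ∈ LinearMap.range D.bdry₁
      rw [this]
      exact Submodule.smul_mem _ _ hy
    · intro a y hy
      have : f (D.x a * y) = D.x a • f y - D.bdry₁ (Pi.single a (1 ⊗ₜ[ℂ] y)) := by
        funext k
        rw [bdry₁_single, Pi.sub_apply, Pi.smul_apply, hf, hf, smul_sub, TensorProduct.smul_tmul',
          TensorProduct.smul_tmul', smul_eq_mul, smul_eq_mul, sandwich_tmul, sandwich_tmul,
          one_mul, one_mul, Pi.sub_apply, ← mul_assoc, ← mul_assoc]
        have e1 : (D.x a * D.e k) ⊗ₜ[ℂ] (D.e k * y) =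
            (Pi.single (D.tgt a) (D.x a ⊗ₜ[ℂ] (D.e (D.tgt a) * y)) : V → A ⊗[ℂ] A) k := by
          rw [← H.x_mul_e, mul_assoc, H.e_mul_e]
          by_cases h : k = D.tgt a
          · subst h; simp
          · simp [h, Ne.symm h]
        have e2 : D.e k ⊗ₜ[ℂ] (D.e k * D.x a * y) =
            (Pi.single (D.src a) (D.e (D.src a) ⊗ₜ[ℂ] (D.x a * y)) : V → A ⊗[ℂ] A) k := by
          rw [← H.e_mul_x, ← mul_assoc, H.e_mul_e]
          by_cases h : k = D.src a
          · subst h; simp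
          · simp [h]
        rw [e1, e2]
        abel
      change f _ ∈ LinearMap.range D.bdry₁
      rw [this]
      exact Submodule.sub_mem _ (Submodule.smul_mem _ _ hy) ⟨_, rfl⟩
  have hzero : (LinearMap.range D.bdry₁).mkQ ∘ₗ (D.projVertex - D.sect₀ ∘ₗ D.bdry₀) = 0 := by
    refine LinearMap.pi_ext' fun i => tensor_hom_ext fun v => ?_
    rw [LinearMap.zero_comp, LinearMap.zero_apply, LinearMap.comp_apply, LinearMap.comp_apply,
      Submodule.mkQ_apply, Submodule.Quotient.mk_eq_zero]
    have : (D.projVertex - D.sect₀ ∘ₗ D.bdry₀)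
        (LinearMap.single A (fun _ => A ⊗[ℂ] A) i ((1 : A) ⊗ₜ[ℂ] v)) = D.e i • f v := by
      funext k
      rw [LinearMap.sub_apply, LinearMap.comp_apply, LinearMap.single_apply, bdry₀_single,
        Pi.sub_apply, Pi.smul_apply, projVertex_apply, sect₀_apply, hf, smul_sub, sandwich_tmul,
        TensorProduct.smul_tmul', TensorProduct.smul_tmul', pairing_tmul, one_mul, smul_eq_mul,
        smul_eq_mul, smul_eq_mul, LinearMap.id_apply, ← mul_assoc, H.e_mul_self, ← mul_assoc,
        H.e_mul_e]
      congr 1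
      by_cases h : k = i
      · subst h; simp
      · simp [h, Ne.symm h]
    rw [this]
    exact Submodule.smul_mem _ _ (hmem v)
  have := LinearMap.congr_fun hzero s
  rwa [LinearMap.zero_apply, LinearMap.comp_apply, Submodule.mkQ_apply,
    Submodule.Quotient.mk_eq_zero] at this

theorem bdry₂_single [DecidableEq E] (a : E) (t : A ⊗[ℂ] A) :
    D.bdry₂ (Pi.single a t) =
      D.placements (D.wB a) (sandwich (D.e (D.tgt a)) (D.e (D.src a)) t) -
        D.placements (D.wW a) (sandwich (D.e (D.tgt a)) (D.e (D.src a)) t) := by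
  rw [bdry₂_apply, Finset.sum_eq_single a]
  · rw [projCoarrow_apply, Pi.single_eq_same]
  · intro b _ hb
    simp [projCoarrow_apply, Pi.single_eq_of_ne hb]
  · simp

/-- Modulo the image of `bdry₂` there is a universal derivation `δ` sending each arrow to its own
generator: the relations are respected because their derivatives are exactly what `bdry₂` kills. The
map `u ⊗ v ↦ u δ(v)` then turns `bdry₁` into minus the quotient map, so a cycle has trivial class.
-/
theorem IsTiling.projArrow_mem (H : D.IsTiling σB σW ω θ) (c : E → A ⊗[ℂ] A)
    (hc : D.bdry₁ c = 0) : D.projArrow c ∈ LinearMap.range D.bdry₂ := by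
  classical
  let R : Submodule A (E → A ⊗[ℂ] A) := LinearMap.range D.bdry₂
  let Q := (E → A ⊗[ℂ] A) ⧸ R
  -- The derivation is encoded as an algebra map into `End (A × Q)`: an arrow acts diagonally plus
  -- the off-diagonal map `N a : A → Q`. On a word the off-diagonal entries add up to its
  -- `placements`.
  let N : E → (A × Q) →ₗ[ℂ] (A × Q) := fun a =>
    LinearMap.inr ℂ A Q ∘ₗ R.mkQ.restrictScalars ℂ ∘ₗ
      (LinearMap.single A (fun _ => A ⊗[ℂ] A) a).restrictScalars ℂ ∘ₗ
      TensorProduct.mk ℂ A A (D.e (D.src a)) ∘ₗ LinearMap.mulLeft ℂ (D.e (D.tgt a)) ∘ₗ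
      LinearMap.fst ℂ A Q
  let ε : V → Module.End ℂ (A × Q) := fun i => Algebra.lsmul ℂ ℂ (A × Q) (D.e i)
  let y : E → Module.End ℂ (A × Q) := fun a => Algebra.lsmul ℂ ℂ (A × Q) (D.x a) + N a
  have hε : ∀ i v q, ε i (v, q) = (D.e i * v, D.e i • q) := fun i v q => rfl
  have hy : ∀ a v q, y a (v, q) = (D.x a * v, D.x a • q +
      R.mkQ (Pi.single a (D.e (D.src a) ⊗ₜ[ℂ] (D.e (D.tgt a) * v)))) := by
    intro a v q
    change D.x a • (v, q) + N a (v, q) = _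
    refine Prod.ext ?_ rfl
    change D.x a • v + 0 = _
    rw [add_zero, smul_eq_mul]
  have hword : ∀ {i j : V} {l : List E}, D.IsPath i l j → ∀ v q, (l.map y).prod (v, q) =
      (D.word l * v, D.word l • q + R.mkQ (D.placements l (D.e i ⊗ₜ[ℂ] (D.e j * v)))) := by
    intro i j l hl
    induction hl with
    | nil i => intro v q; simp [word, placements]
    | @cons a l j hl ih =>
      intro v q
      have hw : D.word (a :: l) = D.x a * D.word l := by simp [word]
      rw [List.map_cons, List.prod_cons, Module.End.mul_apply, ih, hy, hw]
      refine Prod.ext (mul_assoc _ _ _).symm ?_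
      change D.x a • (_ + _) + _ = _
      have e1 : D.placements l ((D.e (D.src a) * D.x a) ⊗ₜ[ℂ] (D.e j * v)) =
          D.x a • D.placements l (D.e (D.tgt a) ⊗ₜ[ℂ] (D.e j * v)) := by
        rw [← map_smul, TensorProduct.smul_tmul', smul_eq_mul, H.x_mul_e, H.e_mul_x]
      rw [placements, LinearMap.add_apply, LinearMap.comp_apply, LinearMap.comp_apply,
        LinearMap.single_apply, sandwich_tmul, sandwich_tmul, mul_one, one_mul, map_add, e1,
        map_smul, smul_add, smul_smul, ← mul_assoc, ← mul_assoc, hl.e_mul_word H.e_mul_x H.x_mul_e, add_assoc]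
      exact congrArg _ (add_comm _ _)
  obtain ⟨f, hfe, hfx⟩ := H.exists_lift (Module.End ℂ (A × Q)) ε y
    (H.idem.map (Algebra.lsmul ℂ ℂ (A × Q)).toRingHom)
    (fun a => by
      refine LinearMap.ext fun ⟨v, q⟩ => ?_
      rw [Module.End.mul_apply, hy, hε, ← mul_assoc, H.e_mul_x, smul_add, smul_smul, H.e_mul_x,
        ← map_smul, ← Pi.single_smul, TensorProduct.smul_tmul', smul_eq_mul, H.e_mul_self])
    (fun a => by
      refine LinearMap.ext fun ⟨v, q⟩ => ?_
      rw [Module.End.mul_apply, hε, hy, hy, ← mul_assoc, H.x_mul_e, smul_smul, H.x_mul_e,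
        ← mul_assoc, H.e_mul_self])
    (fun a => by
      refine LinearMap.ext fun ⟨v, q⟩ => ?_
      rw [hword (H.black.isPath a), hword (H.white.isPath a), H.word_eq]
      congr 2
      rw [← sub_eq_zero, ← map_sub, Submodule.mkQ_apply, Submodule.Quotient.mk_eq_zero]
      -- The off-diagonal parts of the two broken loops of `a` differ by the boundary of the
      -- generator at `a`.
      refine ⟨Pi.single a (1 ⊗ₜ[ℂ] v), ?_⟩
      rw [bdry₂_single, sandwich_tmul, one_mul])
  let δ : A →ₗ[ℂ] Q := LinearMap.snd ℂ A Q ∘ₗ LinearMap.applyₗ ((1 : A), (0 : Q)) ∘ₗ f.toLinearMap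
  have hδ : ∀ v, f v (1, 0) = (v, δ v) := by
    intro v
    refine Prod.ext ?_ rfl
    let S : Submodule ℂ A := LinearMap.ker (LinearMap.fst ℂ A Q ∘ₗ
      LinearMap.applyₗ ((1 : A), (0 : Q)) ∘ₗ f.toLinearMap - LinearMap.id)
    have hS : ∀ v, v ∈ S ↔ (f v (1, 0)).1 = v := fun v => by
      rw [LinearMap.mem_ker, LinearMap.sub_apply, sub_eq_zero]
      rfl
    refine (hS v).1 (H.eq_top_of_mul_mem S ?_ ?_ ?_ v)
    · rw [hS, map_one]; rfl
    · intro i v hv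
      rw [hS] at hv ⊢
      rw [map_mul, hfe, Module.End.mul_apply]
      exact congrArg (D.e i * ·) hv
    · intro a v hv
      rw [hS] at hv ⊢
      rw [map_mul, hfx, Module.End.mul_apply]
      change ((y a) ((f v (1, 0)).1, (f v (1, 0)).2)).1 = _
      rw [hv, hy]
  have hδe : ∀ i v, δ (D.e i * v) = D.e i • δ v := by
    intro i v
    have := hδ (D.e i * v)
    rw [map_mul, hfe, Module.End.mul_apply, hδ, hε] at this
    exact (congrArg Prod.snd this).symm
  have hδx : ∀ a v, δ (D.x a * v) = D.x a • δ v +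
      R.mkQ (Pi.single a (D.e (D.src a) ⊗ₜ[ℂ] (D.e (D.tgt a) * v))) := by
    intro a v
    have := hδ (D.x a * v)
    rw [map_mul, hfx, Module.End.mul_apply, hδ, hy] at this
    exact (congrArg Prod.snd this).symm
  let h : (V → A ⊗[ℂ] A) →ₗ[A] Q := ∑ i, pairing δ ∘ₗ LinearMap.proj i
  have hs : ∀ i t, h (Pi.single i t) = pairing δ t := by
    intro i t
    simp only [h, LinearMap.sum_apply, LinearMap.comp_apply, LinearMap.proj_apply]
    rw [Finset.sum_eq_single i]
    · rw [Pi.single_eq_same]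
    · intro j _ hj
      rw [Pi.single_eq_of_ne hj, map_zero]
    · simp
  have key : h ∘ₗ D.bdry₁ = -(R.mkQ ∘ₗ D.projArrow) := by
    refine LinearMap.pi_ext' fun a => tensor_hom_ext fun v => ?_
    rw [LinearMap.comp_apply, LinearMap.comp_apply, LinearMap.comp_apply, LinearMap.neg_apply,
      LinearMap.comp_apply, LinearMap.single_apply, bdry₁_single, map_sub, hs, hs, sandwich_tmul,
      sandwich_tmul, pairing_tmul, pairing_tmul, one_mul, one_mul, hδe, hδx, smul_add, smul_smul,
      smul_smul, H.x_mul_e, H.e_mul_x, sub_add_cancel_left, ← map_smul, ← Pi.single_smul,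
      TensorProduct.smul_tmul', smul_eq_mul, H.e_mul_self]
    congr 2
    funext b
    rw [projArrow_apply]
    by_cases hb : b = a
    · subst hb
      simp
    · rw [Pi.single_eq_of_ne hb, Pi.single_eq_of_ne hb, map_zero]
  have := LinearMap.congr_fun key c
  rw [LinearMap.comp_apply, hc, map_zero, LinearMap.neg_apply, LinearMap.comp_apply,
    eq_comm, neg_eq_zero, Submodule.mkQ_apply, Submodule.Quotient.mk_eq_zero] at this
  exact this

end ArrowData

/-! ### The grading, and transport along closed paths. -/

namespace ArrowData

variable {V E A : Type u} [Ring A] [Algebra ℂ A] {D : ArrowData V E A}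
  {σB σW : Equiv.Perm E} {ω : A} {θ : E → ℚ}

/-- The projections to the homogeneous components of `A` for the grading in which an arrow `a` has
degree `θ a` and `ω` has degree `0`. -/
structure IsGrading (D : ArrowData V E A) (ω : A) (θ : E → ℚ) (pr : ℚ → A →ₗ[ℂ] A) : Prop where
  mul_word : ∀ α u l, pr (α + (l.map θ).sum) (u * D.word l) = pr α u * D.word l
  mul_e : ∀ α u i, pr α (u * D.e i) = pr α u * D.e i
  mul_loop : ∀ α u, pr α (u * ω) = pr α u * ω
  exists_sum : ∀ u, ∃ f : ℚ →₀ A, (∀ α, f α = pr α u) ∧ (f.sum fun _ y => y) = u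

/-- A path of non-zero degree is not empty, so it has a first arrow. -/
theorem IsTiling.exists_src_eq [Fintype V] (H : D.IsTiling σB σW ω θ) (i : V) :
    ∃ a, D.src a = i := by
  obtain ⟨l, hl, h⟩ := H.exists_degree_ne_zero i
  cases hl with
  | nil => simp at h
  | cons _ => exact ⟨_, rfl⟩

theorem word_nil : D.word [] = 1 := rfl

theorem word_cons (a : E) (l : List E) : D.word (a :: l) = D.x a * D.word l := by simp [word]

-- The grading is the algebra map `A → A[ℚ]` that sends `xₐ` to `xₐ` in degree `θ a`. It exists
-- since both broken loops of `a` have degree `-θ a`. The projections are the coefficients of this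
-- map.
open AddMonoidAlgebra in
theorem IsTiling.exists_grading [Fintype V] (H : D.IsTiling σB σW ω θ) :
    ∃ pr : ℚ → A →ₗ[ℂ] A, D.IsGrading ω θ pr := by
  have hmap : ∀ l : List E, (l.map fun a => (single (θ a) (D.x a) : AddMonoidAlgebra A ℚ)).prod =
      single (l.map θ).sum (D.word l) := by
    intro l
    induction l with
    | nil => rfl
    | cons a l ih =>
      rw [List.map_cons, List.prod_cons, ih, single_mul_single, List.map_cons, List.sum_cons,
        word_cons]
  have hdeg : ∀ a, ((D.wB a).map θ).sum = ((D.wW a).map θ).sum := fun a => by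
    linarith [H.degree_black a, H.degree_white a]
  obtain ⟨γ, hγe, hγx⟩ := H.exists_lift (AddMonoidAlgebra A ℚ) (fun i => single 0 (D.e i))
    (fun a => single (θ a) (D.x a)) (H.idem.map (singleZeroRingHom (R := A) (M := ℚ)))
    (fun a => by rw [single_mul_single, zero_add, H.e_mul_x])
    (fun a => by rw [single_mul_single, add_zero, H.x_mul_e])
    (fun a => by rw [hmap, hmap, hdeg, H.word_eq])
  have hγw : ∀ l, γ (D.word l) = single (l.map θ).sum (D.word l) := by
    intro l
    rw [← hmap, word, map_list_prod, List.map_map]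
    congr 2
    funext a
    exact hγx a
  have hγω : γ ω = single 0 ω := by
    have : ∀ i, γ (D.e i * ω) = single 0 (D.e i * ω) := by
      intro i
      obtain ⟨a, rfl⟩ := H.exists_src_eq i
      rw [← H.loop_eq, map_mul, hγx, hγw, single_mul_single, H.degree_black]
    have h1 : ω = ∑ i, D.e i * ω := by rw [← Finset.sum_mul, H.idem.complete, one_mul]
    have h2 : single 0 ω = (singleZeroRingHom (R := A) (M := ℚ)) ω := rfl
    rw [h2, h1, map_sum, map_sum]
    exact Finset.sum_congr rfl fun i _ => this i
  have hsum : ∀ (c : ℚ) (y : A) (z : AddMonoidAlgebra A ℚ),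
      ((single c y * z).coeff.sum fun _ w => w) = y * (z.coeff.sum fun _ w => w) := by
    intro c y z
    induction z using AddMonoidAlgebra.induction_linear with
    | zero => simp
    | add f g hf hg =>
      rw [mul_add, coeff_add, coeff_add, Finsupp.sum_add_index' (fun _ => rfl) (fun _ _ _ => rfl),
        Finsupp.sum_add_index' (fun _ => rfl) (fun _ _ _ => rfl), hf, hg, mul_add]
    | single m r =>
      rw [single_mul_single, coeff_single, coeff_single, Finsupp.sum_single_index rfl,
        Finsupp.sum_single_index rfl]
  refine ⟨fun α => Finsupp.lapply α ∘ₗ (coeffLinearEquiv ℂ).toLinearMap ∘ₗ γ.toLinearMap,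
    ⟨?_, ?_, ?_, ?_⟩⟩
  · intro α u l
    change (γ (u * _)).coeff _ = (γ u).coeff _ * _
    rw [map_mul, hγw, coeff_mul_single_apply, add_neg_cancel_right]
  · intro α u i
    change (γ (u * _)).coeff _ = (γ u).coeff _ * _
    rw [map_mul, hγe, coeff_mul_single_apply, neg_zero, add_zero]
  · intro α u
    change (γ (u * _)).coeff _ = (γ u).coeff _ * _
    rw [map_mul, hγω, coeff_mul_single_apply, neg_zero, add_zero]
  · intro u
    refine ⟨(γ u).coeff, fun α => rfl, ?_⟩
    let S : A →ₗ[ℂ] A := Finsupp.lsum ℂ (fun _ : ℚ => (LinearMap.id : A →ₗ[ℂ] A)) ∘ₗ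
      (coeffLinearEquiv ℂ).toLinearMap ∘ₗ γ.toLinearMap
    have hS : ∀ v, S v = (γ v).coeff.sum fun _ w => w := fun v => rfl
    have hmem : ∀ v, v ∈ LinearMap.ker (S - LinearMap.id) ↔ ((γ v).coeff.sum fun _ w => w) = v := by
      intro v
      rw [LinearMap.mem_ker, LinearMap.sub_apply, sub_eq_zero, hS]
      rfl
    refine (hmem u).1 (H.eq_top_of_mul_mem _ ?_ ?_ ?_ u)
    · rw [hmem, map_one, one_def, coeff_single, Finsupp.sum_single_index rfl]
    · intro i y hy
      rw [hmem] at hy ⊢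
      rw [map_mul, hγe, hsum, hy]
    · intro a y hy
      rw [hmem] at hy ⊢
      rw [map_mul, hγx, hsum, hy]

/-- The path is undone arrow by arrow with broken loops; each arrow contributes one factor `ω`,
which is central. -/
theorem IsTiling.exists_word_mul_eq [Fintype V] (H : D.IsTiling σB σW ω θ) {i j : V} {l : List E}
    (hl : D.IsPath i l j) : ∃ (y : A) (n : ℕ), D.word l * y = D.e i * ω ^ n := by
  induction hl with
  | nil i => exact ⟨D.e i, 0, by simp [word]⟩
  | @cons a l j _ ih =>
    obtain ⟨y, n, h⟩ := ih
    have hc : ∀ z, ω ^ n * z = z * ω ^ n := fun z => Commute.pow_left (H.central z) n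
    refine ⟨y * D.word (D.wB a), n + 1, ?_⟩
    rw [word_cons, mul_assoc, ← mul_assoc (D.word l), h, mul_assoc (D.e _), hc, ← mul_assoc,
      ← mul_assoc, H.x_mul_e, H.loop_eq, mul_assoc, pow_succ']

theorem IsGrading.exists_tensor_sum {pr : ℚ → A →ₗ[ℂ] A} (G : D.IsGrading ω θ pr) (t : A ⊗[ℂ] A) :
    ∃ f : ℚ →₀ A ⊗[ℂ] A, (∀ α, f α = (pr α).rTensor A t) ∧ (f.sum fun _ y => y) = t := by
  classical
  induction t using TensorProduct.induction_on with
  | zero => exact ⟨0, by simp, by simp⟩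
  | add s t hs ht =>
    obtain ⟨f, hf, hf'⟩ := hs
    obtain ⟨g, hg, hg'⟩ := ht
    refine ⟨f + g, fun α => by rw [Finsupp.add_apply, hf, hg, map_add], ?_⟩
    rw [Finsupp.sum_add_index' (fun _ => rfl) (fun _ _ _ => rfl), hf', hg']
  | tmul u v =>
    obtain ⟨f, hf, hf'⟩ := G.exists_sum u
    refine ⟨f.mapRange (fun y => y ⊗ₜ[ℂ] v) (TensorProduct.zero_tmul _ _), fun α => ?_, ?_⟩
    · rw [Finsupp.mapRange_apply, hf, LinearMap.rTensor_tmul]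
    · rw [Finsupp.sum_mapRange_index (fun _ => rfl)]
      conv_rhs => rw [← hf', Finsupp.sum, TensorProduct.sum_tmul]
      rfl

theorem IsGrading.rTensor_sandwich_right {pr : ℚ → A →ₗ[ℂ] A}
    (α : ℚ) (y : A) (t : A ⊗[ℂ] A) :
    (pr α).rTensor A (sandwich 1 y t) = sandwich 1 y ((pr α).rTensor A t) := by
  induction t using TensorProduct.induction_on with
  | zero => simp
  | add s t hs ht => simp only [map_add, hs, ht]
  | tmul u v => simp

theorem IsGrading.rTensor_sandwich_left {pr : ℚ → A →ₗ[ℂ] A}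
    {α β : ℚ} {x : A} (h : ∀ u, pr β (u * x) = pr α u * x) (t : A ⊗[ℂ] A) :
    (pr β).rTensor A (sandwich x 1 t) = sandwich x 1 ((pr α).rTensor A t) := by
  induction t using TensorProduct.induction_on with
  | zero => simp
  | add s t hs ht => simp only [map_add, hs, ht]
  | tmul u v => simp [h]

/-- Modulo `U`, the family `f` satisfies `(1 ⊗ l) f i = (l ⊗ 1) f i` for every closed path `l` at
`i`. Only the right side changes the degree of the left tensor factor, by `τ ≠ 0`. So if the
component of degree `α + τ` lies in `U`, then so does `l ⊗ 1` times the component of degree `α`, and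
after completing `l` to a power of `ω` and cancelling, that component itself. Components of degree
`α + nτ` vanish for some `n`, and one descends from there. -/
theorem IsTiling.mem_of_transport [Fintype V] (H : D.IsTiling σB σW ω θ) {pr : ℚ → A →ₗ[ℂ] A}
    (G : D.IsGrading ω θ pr) (U : Submodule ℂ (A ⊗[ℂ] A))
    (hpr : ∀ α, ∀ t ∈ U, (pr α).rTensor A t ∈ U) (hl : ∀ y, ∀ t ∈ U, sandwich 1 y t ∈ U)
    (hr : ∀ x, ∀ t ∈ U, sandwich x 1 t ∈ U) (hω : ∀ t, sandwich ω 1 t ∈ U → t ∈ U)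
    (f : V → A ⊗[ℂ] A) (hf : ∀ i, sandwich (D.e i) 1 (f i) = f i)
    (hx : ∀ a, sandwich 1 (D.x a) (f (D.tgt a)) - sandwich (D.x a) 1 (f (D.src a)) ∈ U) (i : V) :
    f i ∈ U := by
  have hpath : ∀ {i j : V} {l : List E}, D.IsPath i l j →
      sandwich 1 (D.word l) (f j) - sandwich (D.word l) 1 (f i) ∈ U := by
    intro i j l h
    induction h with
    | nil i => simp [word]
    | @cons a l j _ ih =>
      have h1 := U.add_mem (hl (D.x a) _ ih) (hr (D.word l) _ (hx a))
      rw [map_sub, map_sub, sandwich_comp, sandwich_comp, sandwich_comp, sandwich_comp] at h1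
      simpa only [one_mul, mul_one, word_cons, sub_add_sub_cancel] using h1
  obtain ⟨l, hli, hτ⟩ := H.exists_degree_ne_zero i
  set τ := (l.map θ).sum
  obtain ⟨y, n, hy⟩ := H.exists_word_mul_eq hli
  have hωn : ∀ (n : ℕ) t, sandwich (ω ^ n) 1 t ∈ U → t ∈ U := by
    intro n
    induction n with
    | zero => intro t; simp
    | succ n ih =>
      intro t ht
      refine ih t (hω _ ?_)
      rwa [sandwich_comp, one_mul, ← pow_succ]
  have hstep : ∀ α, (pr (α + τ)).rTensor A (f i) ∈ U → (pr α).rTensor A (f i) ∈ U := by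
    intro α h
    have h1 := hpr (α + τ) _ (hpath hli)
    rw [map_sub, IsGrading.rTensor_sandwich_right,
      IsGrading.rTensor_sandwich_left (fun u => G.mul_word α u l)] at h1
    have h2 := hr y _ ((U.sub_mem_iff_right (hl (D.word l) _ h)).1 h1)
    rw [sandwich_comp, one_mul, hy] at h2
    refine hωn n _ ?_
    have h3 : sandwich (D.e i) 1 ((pr α).rTensor A (f i)) = (pr α).rTensor A (f i) := by
      rw [← IsGrading.rTensor_sandwich_left (fun u => G.mul_e α u i), hf]
    rw [← h3, sandwich_comp, one_mul]
    exact h2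
  obtain ⟨g, hg, hgs⟩ := G.exists_tensor_sum (f i)
  -- The degrees `α + nτ` are pairwise distinct and `f i` has finitely many components.
  have hzero : ∀ α, ∃ n : ℕ, g (α + n * τ) = 0 := by
    intro α
    by_contra! hne
    refine Set.infinite_range_of_injective (f := fun n : ℕ => α + n * τ) (fun m n h => ?_)
      (g.support.finite_toSet.subset ?_)
    · exact_mod_cast mul_right_cancel₀ hτ (add_left_cancel h)
    · rintro _ ⟨n, rfl⟩
      exact Finsupp.mem_support_iff.2 (hne n)
  have hall : ∀ α, g α ∈ U := by
    intro α
    obtain ⟨n, hn⟩ := hzero α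
    have : ∀ (n : ℕ) α, g (α + n * τ) ∈ U → g α ∈ U := by
      intro n
      induction n with
      | zero => intro α h; simpa using h
      | succ n ih =>
        intro α h
        rw [hg]
        refine hstep α ?_
        rw [← hg]
        refine ih _ ?_
        convert h using 2
        push_cast
        ring
    exact this n α (hn ▸ U.zero_mem)
  rw [← hgs]
  exact U.sum_mem fun α _ => hall α

end ArrowData

/-! ### The loop difference, and exactness at the coarrow term and at the last vertex term. -/

namespace ArrowData

section

variable {A : Type u} [Ring A] [Algebra ℂ A]

theorem sandwich_right_eq_lTensor (y : A) (t : A ⊗[ℂ] A) :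
    sandwich 1 y t = (LinearMap.mulLeft ℂ y).lTensor A t := by
  induction t using TensorProduct.induction_on with
  | zero => simp
  | add s t hs ht => rw [map_add, map_add, hs, ht]
  | tmul u v => simp

theorem sandwich_left_eq_rTensor (x : A) (t : A ⊗[ℂ] A) :
    sandwich x 1 t = (LinearMap.mulRight ℂ x).rTensor A t := by
  induction t using TensorProduct.induction_on with
  | zero => simp
  | add s t hs ht => rw [map_add, map_add, hs, ht]
  | tmul u v => simp

/-- An element of `A ⊗ A` in the image of `u ⊗ v ↦ u ωⁿ ⊗ v` for all `n` vanishes, if `⋂ A ωⁿ`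
does. -/
theorem eq_zero_of_forall_exists_sandwich_pow {ω : A}
    (h : ∀ y, (∀ n : ℕ, ∃ z, y = z * ω ^ n) → y = 0) (t : A ⊗[ℂ] A)
    (ht : ∀ n : ℕ, ∃ t', t = sandwich (ω ^ n) 1 t') : t = 0 := by
  classical
  let b := Module.Basis.ofVectorSpace ℂ A
  -- In coordinates for a basis of the right factor, every coordinate is divisible by all powers of
  -- `ω`.
  let κ := TensorProduct.equivFinsuppOfBasisRight (M := A) b
  refine κ.injective ?_
  rw [map_zero]
  ext k
  refine h _ fun n => ?_
  obtain ⟨t', rfl⟩ := ht n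
  refine ⟨κ t' k, ?_⟩
  clear ht
  induction t' using TensorProduct.induction_on with
  | zero => simp
  | add s t hs ht => simp only [map_add, Finsupp.add_apply, hs, ht, add_mul]
  | tmul u v =>
    rw [sandwich_tmul, TensorProduct.equivFinsuppOfBasisRight_apply_tmul_apply,
      TensorProduct.equivFinsuppOfBasisRight_apply_tmul_apply, one_mul, smul_mul_assoc]

/-- The map `u ⊗ v ↦ u ⊗ ω v - u ω ⊗ v`. -/
def loopDiff (ω : A) : A ⊗[ℂ] A →ₗ[A] A ⊗[ℂ] A := sandwich 1 ω - sandwich ω 1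

theorem loopDiff_apply (ω : A) (t : A ⊗[ℂ] A) :
    loopDiff ω t = sandwich 1 ω t - sandwich ω 1 t := rfl

theorem loopDiff_sandwich {ω : A} (hω : ∀ y, ω * y = y * ω) (x y : A) (t : A ⊗[ℂ] A) :
    loopDiff ω (sandwich x y t) = sandwich x y (loopDiff ω t) := by
  rw [loopDiff_apply, loopDiff_apply, map_sub, sandwich_comp, sandwich_comp, sandwich_comp,
    sandwich_comp, hω, hω, mul_one, one_mul, mul_one, one_mul]

end

variable {V E A : Type u} [Ring A] [Algebra ℂ A] {D : ArrowData V E A} [Fintype V]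
  {σB σW : Equiv.Perm E} {ω : A} {θ : E → ℚ}

theorem IsTiling.sandwich_left_injective (H : D.IsTiling σB σW ω θ) (t : A ⊗[ℂ] A)
    (ht : sandwich ω 1 t = 0) : t = 0 := by
  rw [sandwich_left_eq_rTensor] at ht
  refine Module.Flat.rTensor_preserves_injective_linearMap (M := A) (LinearMap.mulRight ℂ ω) ?_
    (ht.trans (map_zero _).symm)
  refine (injective_iff_map_eq_zero _).2 fun y hy => H.regular y ?_
  rw [H.central]
  exact hy

/-- Reduce the left factor modulo `Aω`. There `1 ⊗ ω` kills the image of `t`, yet it is injective on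
`(A/Aω) ⊗ A` by flatness over `ℂ`, so `t` itself reduces to zero. -/
theorem IsTiling.exists_of_sandwich_eq (H : D.IsTiling σB σW ω θ) (t t' : A ⊗[ℂ] A)
    (h : sandwich 1 ω t = sandwich ω 1 t') : ∃ s, t = sandwich ω 1 s := by
  let q := (LinearMap.range (LinearMap.mulRight ℂ ω)).mkQ
  have hex : Function.Exact ((LinearMap.mulRight ℂ ω).rTensor A) (q.rTensor A) :=
    rTensor_exact A (LinearMap.exact_map_mkQ_range _) (Submodule.mkQ_surjective _)
  have hinj : Function.Injective
      ((LinearMap.mulLeft ℂ ω).lTensor (A ⧸ LinearMap.range (LinearMap.mulRight ℂ ω))) :=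
    Module.Flat.lTensor_preserves_injective_linearMap _
      ((injective_iff_map_eq_zero _).2 fun y hy => H.regular y hy)
  have h0 : q.rTensor A t = 0 := by
    refine hinj ?_
    rw [map_zero]
    have : (LinearMap.mulLeft ℂ ω).lTensor _ (q.rTensor A t) =
        q.rTensor A ((LinearMap.mulLeft ℂ ω).lTensor A t) := by
      rw [← LinearMap.comp_apply, ← LinearMap.comp_apply, LinearMap.lTensor_comp_rTensor,
        LinearMap.rTensor_comp_lTensor]
    rw [this, ← sandwich_right_eq_lTensor, h, sandwich_left_eq_rTensor]
    exact hex.apply_apply_eq_zero _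
  obtain ⟨s, hs⟩ := (hex t).1 h0
  exact ⟨s, by rw [sandwich_left_eq_rTensor, hs]⟩

/-- An element of the kernel is divisible by `ω ⊗ 1`, and the quotient lies in the kernel again. So
it is divisible by all powers of `ω ⊗ 1`, and `⋂ ωⁿA = 0` applies. -/
theorem IsTiling.loopDiff_injective (H : D.IsTiling σB σW ω θ) (t : A ⊗[ℂ] A)
    (ht : loopDiff ω t = 0) : t = 0 := by
  refine eq_zero_of_forall_exists_sandwich_pow (ω := ω) (fun y hy => H.separated y fun n => ?_) t
    fun n => ?_
  · obtain ⟨z, hz⟩ := hy n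
    exact ⟨z, by rw [hz]; exact (Commute.pow_left (H.central z) n).symm⟩
  · induction n generalizing t with
    | zero => exact ⟨t, by simp⟩
    | succ n ih =>
      rw [loopDiff_apply, sub_eq_zero] at ht
      obtain ⟨s, rfl⟩ := H.exists_of_sandwich_eq t t ht
      rw [← sub_eq_zero, ← loopDiff_apply, loopDiff_sandwich H.central] at ht
      obtain ⟨s', rfl⟩ := ih s (H.sandwich_left_injective _ ht)
      exact ⟨s', by rw [sandwich_comp, one_mul, ← pow_succ]⟩

/-- A cycle is a family parallel along all arrows, so transport with `U = 0` makes it vanish. -/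
theorem IsTiling.projVertex_eq_zero (H : D.IsTiling σB σW ω θ) (s : V → A ⊗[ℂ] A)
    (hs : D.bdry₃ s = 0) : D.projVertex s = 0 := by
  obtain ⟨pr, G⟩ := H.exists_grading
  funext i
  refine (Submodule.mem_bot ℂ).1 (H.mem_of_transport G ⊥ ?_ ?_ ?_ ?_ (D.projVertex s) ?_ ?_ i)
  · rintro α t rfl; simp
  · rintro y t rfl; simp
  · rintro y t rfl; simp
  · exact fun t ht => H.sandwich_left_injective t ht
  · intro i
    rw [projVertex_apply, sandwich_comp, one_mul, H.e_mul_self]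
  · intro a
    rw [projVertex_apply, projVertex_apply, sandwich_comp, sandwich_comp, mul_one, one_mul,
      H.x_mul_e, H.e_mul_x, ← bdry₃_apply, hs]
    rfl

section colour

variable {σ : Equiv.Perm E} {w : E → List E}

/-- The sum over all positions of `c` in the cycle through `b` once around a vertex, starting and
ending in the tile where `b` starts. -/
def turnSum (x : E → A) (σ : Equiv.Perm E) (c : E → A ⊗[ℂ] A) (b : E) : A ⊗[ℂ] A :=
  ∑ k ∈ Finset.range (Function.minimalPeriod σ b),
    sandwich (iterProd x σ ((σ⁻¹ ^ k) b) k)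
      (iterProd x σ b (Function.minimalPeriod σ b - 1 - k)) (c ((σ⁻¹ ^ (k + 1)) b))

theorem IsColour.word_mul_x [Finite E] (C : D.IsColour σ w ω) (a : E) :
    D.word (w a) * D.x a = D.e (D.tgt a) * ω := by
  rw [← C.src_apply, ← C.iterProd_loop, C.word_eq_iterProd, σ.minimalPeriod_apply']
  have h := σ.minimalPeriod_pos a
  conv_rhs => rw [← Nat.sub_add_cancel h, iterProd_succ, ← Equiv.Perm.mul_apply, ← pow_succ,
    Nat.sub_add_cancel h, σ.pow_minimalPeriod_apply]

/-- The positions other than that of `b` itself make up `cycleSum`. This form shows that the turns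
around the two ends of `b` agree when `c` is a cycle. -/
theorem IsColour.turnSum_eq [Finite E] (C : D.IsColour σ w ω) (c : E → A ⊗[ℂ] A) (b : E) :
    turnSum D.x σ c b =
      sandwich 1 (D.x b) (cycleSum D.x σ c b) + sandwich (D.word (w b)) 1 (c b) := by
  have hd := σ.minimalPeriod_pos b
  rw [turnSum, cycleSum, map_sum, C.word_eq_iterProd]
  obtain ⟨d, h⟩ : ∃ d, Function.minimalPeriod σ b = d + 1 := ⟨_, (Nat.sub_add_cancel hd).symm⟩
  have hb : (σ⁻¹ ^ (d + 1)) b = b := by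
    rw [σ.inv_pow_apply_eq b h.ge, h, Nat.sub_self, pow_zero, Equiv.Perm.one_apply]
  have hb' : (σ⁻¹ ^ d) b = σ b := by
    rw [σ.inv_pow_apply_eq b (by omega), h, Nat.add_sub_cancel_left, pow_one]
  rw [h, Nat.add_sub_cancel, Finset.sum_range_succ, hb, hb', Nat.sub_self, iterProd_zero]
  congr 1
  refine Finset.sum_congr rfl fun k hk => ?_
  rw [Finset.mem_range] at hk
  rw [sandwich_comp, mul_one, ← iterProd_succ']
  congr 3
  omega

/-- Moving the base point of the turn past `b` telescopes: the inner terms agree, and what is left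
are the two terms with `c b`, where the whole loop stands on one side of the slot. -/
theorem IsColour.sandwich_turnSum [Finite E] (C : D.IsColour σ w ω) (c : E → A ⊗[ℂ] A) (b : E) :
    sandwich 1 (D.x b) (turnSum D.x σ c (σ b)) - sandwich (D.x b) 1 (turnSum D.x σ c b) =
      sandwich 1 (D.e (D.src b) * ω) (c b) - sandwich (D.e (D.tgt b) * ω) 1 (c b) := by
  have h1 : ∀ k, (σ⁻¹ ^ (k + 1)) (σ b) = (σ⁻¹ ^ k) b := fun k => by
    rw [pow_succ, Equiv.Perm.mul_apply, ← Equiv.Perm.mul_apply σ⁻¹, inv_mul_cancel,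
      Equiv.Perm.one_apply]
  have h2 : ∀ k, (σ ^ k) ((σ⁻¹ ^ k) b) = b := fun k => by
    rw [inv_pow, ← Equiv.Perm.mul_apply, mul_inv_cancel, Equiv.Perm.one_apply]
  rw [turnSum, turnSum, map_sum, map_sum, σ.minimalPeriod_apply', ← Finset.sum_sub_distrib]
  set d := Function.minimalPeriod σ b with hd
  let g : ℕ → A ⊗[ℂ] A := fun k => sandwich (iterProd D.x σ ((σ⁻¹ ^ k) (σ b)) k)
    (iterProd D.x σ b (d - k)) (c ((σ⁻¹ ^ k) b))
  have hg0 : g 0 = sandwich 1 (D.e (D.src b) * ω) (c b) := by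
    simp only [g]
    rw [Nat.sub_zero, C.iterProd_loop]
    rfl
  have hgd : g d = sandwich (D.e (D.tgt b) * ω) 1 (c b) := by
    simp only [g]
    have e1 : (σ⁻¹ ^ d) b = b := by
      rw [σ.inv_pow_apply_eq b le_rfl, ← hd, Nat.sub_self, pow_zero, Equiv.Perm.one_apply]
    have e2 : (σ⁻¹ ^ d) (σ b) = σ b := by
      rw [hd, ← σ.minimalPeriod_apply', σ.inv_pow_apply_eq (σ b) le_rfl, Nat.sub_self, pow_zero,
        Equiv.Perm.one_apply]
    rw [e1, e2, Nat.sub_self, iterProd_zero, hd, ← σ.minimalPeriod_apply', C.iterProd_loop,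
      C.src_apply]
  rw [← hg0, ← hgd, ← Finset.sum_range_sub']
  refine Finset.sum_congr rfl fun k hk => ?_
  rw [Finset.mem_range] at hk
  have e1 : d - k = (d - 1 - k) + 1 := by omega
  have e2 : d - (k + 1) = d - 1 - k := by omega
  have e3 : iterProd D.x σ ((σ⁻¹ ^ k) b) k * D.x b = iterProd D.x σ ((σ⁻¹ ^ k) b) (k + 1) := by
    rw [iterProd_succ, h2]
  simp only [g]
  rw [sandwich_comp, sandwich_comp, one_mul, mul_one, h1, e1, iterProd_succ', e2, e3]

theorem IsColour.sandwich_left_turnSum [Finite E] (C : D.IsColour σ w ω) (c : E → A ⊗[ℂ] A)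
    (hc : ∀ a, sandwich (D.e (D.tgt a)) 1 (c a) = c a) (b : E) :
    sandwich (D.e (D.src b)) 1 (turnSum D.x σ c b) = turnSum D.x σ c b := by
  have h2 : ∀ k, (σ ^ k) ((σ⁻¹ ^ k) b) = b := fun k => by
    rw [inv_pow, ← Equiv.Perm.mul_apply, mul_inv_cancel, Equiv.Perm.one_apply]
  rw [turnSum, map_sum]
  refine Finset.sum_congr rfl fun k _ => ?_
  rw [sandwich_comp, one_mul]
  cases k with
  | zero =>
    have h3 : D.tgt (σ⁻¹ b) = D.src b := by
      rw [← C.src_apply, ← Equiv.Perm.mul_apply, mul_inv_cancel, Equiv.Perm.one_apply]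
    rw [iterProd_zero, one_mul, zero_add, pow_one, ← h3]
    conv_rhs => rw [← hc, sandwich_comp, mul_one, mul_one]
  | succ k =>
    have := C.iterProd_succ_mul_e ((σ⁻¹ ^ (k + 1)) b) k
    rw [h2] at this
    rw [this]

theorem IsColour.sandwich_right_turnSum [Finite E] (C : D.IsColour σ w ω) (c : E → A ⊗[ℂ] A)
    (hc : ∀ a, sandwich 1 (D.e (D.src a)) (c a) = c a) (b : E) :
    sandwich 1 (D.e (D.src b)) (turnSum D.x σ c b) = turnSum D.x σ c b := by
  rw [C.turnSum_eq, map_add, sandwich_comp, sandwich_comp, C.e_mul_x, mul_one]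
  conv_rhs => rw [← hc, sandwich_comp]
  simp only [mul_one, one_mul]

end colour

theorem _root_.Equiv.Perm.SameCycle.apply_eq {E M : Type*} {σ : Equiv.Perm E} {f : E → M}
    (h : ∀ a, f (σ a) = f a) {a b : E} (hab : σ.SameCycle a b) : f a = f b := by
  obtain ⟨n, rfl⟩ := hab
  have h' : ∀ n : ℕ, ∀ a, f ((σ ^ n) a) = f a := by
    intro n
    induction n with
    | zero => intro a; rfl
    | succ n ih => intro a; rw [pow_succ, Equiv.Perm.mul_apply, ih, h]
  cases n with
  | ofNat n => exact (h' n a).symm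
  | negSucc n =>
    rw [zpow_negSucc]
    conv_lhs => rw [← Equiv.Perm.one_apply a, ← mul_inv_cancel (σ ^ (n + 1)), Equiv.Perm.mul_apply]
    exact h' _ _

/-- The full turns `f` of a cycle are functions on the tiles and are parallel modulo the image of
`loopDiff ω`. Transport writes them as `loopDiff ω` of some `S`, and injectivity of `loopDiff ω`
turns the transport equation into `c' = bdry₃ S`, up to idempotents. -/
theorem IsTiling.projCoarrow_mem [Fintype E] (H : D.IsTiling σB σW ω θ) (c : E → A ⊗[ℂ] A)
    (hc : D.bdry₂ c = 0) : D.projCoarrow c ∈ LinearMap.range D.bdry₃ := by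
  obtain ⟨c', hc'⟩ : ∃ c', c' = D.projCoarrow c := ⟨_, rfl⟩
  have hl : ∀ a, sandwich (D.e (D.tgt a)) 1 (c' a) = c' a := fun a => by
    rw [hc', projCoarrow_apply, sandwich_comp, one_mul, H.e_mul_self]
  have hr : ∀ a, sandwich 1 (D.e (D.src a)) (c' a) = c' a := fun a => by
    rw [hc', projCoarrow_apply, sandwich_comp, mul_one, H.e_mul_self]
  have hcyc : ∀ b, cycleSum D.x σB c' b = cycleSum D.x σW c' b := fun b => by
    rw [← sub_eq_zero, hc', ← H.bdry₂_apply_apply, hc]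
    rfl
  rw [← hc']
  clear hc hc'
  let f : E → A ⊗[ℂ] A := turnSum D.x σB c'
  have hfB : ∀ b, f b = turnSum D.x σB c' b := fun _ => rfl
  have hfW : ∀ b, f b = turnSum D.x σW c' b := fun b => by
    rw [hfB, H.black.turnSum_eq, H.white.turnSum_eq, hcyc, H.word_eq]
  have hfl : ∀ b, sandwich (D.e (D.src b)) 1 (f b) = f b := H.black.sandwich_left_turnSum c' hl
  have hfr : ∀ b, sandwich 1 (D.e (D.src b)) (f b) = f b := H.black.sandwich_right_turnSum c' hr
  have hdiff : ∀ b, sandwich 1 (D.e (D.src b) * ω) (c' b) - sandwich (D.e (D.tgt b) * ω) 1 (c' b) =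
      loopDiff ω (c' b) := fun b => by
    have h1 : sandwich 1 ω (c' b) = sandwich 1 (D.e (D.src b) * ω) (c' b) := by
      conv_lhs => rw [← hr b]
      rw [sandwich_comp, H.central, mul_one]
    have h2 : sandwich ω 1 (c' b) = sandwich (D.e (D.tgt b) * ω) 1 (c' b) := by
      conv_lhs => rw [← hl b]
      rw [sandwich_comp, mul_one]
    rw [loopDiff_apply, h1, h2]
  have hB : ∀ b, sandwich 1 (D.x b) (f (σB b)) - sandwich (D.x b) 1 (f b) = loopDiff ω (c' b) :=
    fun b => by rw [hfB, hfB, H.black.sandwich_turnSum, hdiff]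
  have hW : ∀ b, sandwich 1 (D.x b) (f (σW b)) - sandwich (D.x b) 1 (f b) = loopDiff ω (c' b) :=
    fun b => by rw [hfW, hfW, H.white.sandwich_turnSum, hdiff]
  have hregR : ∀ t : A ⊗[ℂ] A, sandwich 1 ω t = 0 → t = 0 := fun t ht => by
    rw [sandwich_right_eq_lTensor] at ht
    exact Module.Flat.lTensor_preserves_injective_linearMap (M := A) (LinearMap.mulLeft ℂ ω)
      ((injective_iff_map_eq_zero _).2 fun y hy => H.regular y hy) (ht.trans (map_zero _).symm)
  -- `hB` and `hW` have the same right side, so the two values agree after applying `1 ⊗ xₐ`. A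
  -- broken loop completes `xₐ` to `ω`, which can be cancelled.
  have heq : ∀ a, f (σB a) = f (σW a) := fun a => by
    rw [← sub_eq_zero]
    refine hregR _ ?_
    have h1 : sandwich 1 (D.x a) (f (σB a) - f (σW a)) = 0 := by
      rw [map_sub, sub_eq_zero, ← sub_left_inj, hB, hW]
    have h2 := congrArg (sandwich 1 (D.word (D.wB a))) h1
    have h3 : sandwich 1 (D.e (D.tgt a)) (f (σB a) - f (σW a)) = f (σB a) - f (σW a) := by
      rw [map_sub]
      congr 1
      · rw [← H.src_black, hfr]
      · rw [← H.src_white, hfr]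
    rw [sandwich_comp, H.black.word_mul_x, map_zero, ← H.central] at h2
    rw [← h3, sandwich_comp]
    exact h2
  have hsrc : ∀ a b, D.src a = D.src b → f a = f b := fun a b hab =>
    (H.sameCycle a b hab).apply_eq fun a => by
      rw [Equiv.Perm.mul_apply, heq, ← Equiv.Perm.mul_apply, mul_inv_cancel, Equiv.Perm.one_apply]
  choose a ha using H.exists_src_eq
  have hF : ∀ b i, D.src b = i → f (a i) = f b := fun b i h => hsrc _ _ (by rw [ha, h])
  obtain ⟨pr, G⟩ := H.exists_grading
  have hmem : ∀ i, f (a i) ∈ LinearMap.range ((loopDiff ω).restrictScalars ℂ) := by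
    refine H.mem_of_transport G _ ?_ ?_ ?_ ?_ _ ?_ ?_
    · rintro α _ ⟨t, rfl⟩
      refine ⟨(pr α).rTensor A t, ?_⟩
      change loopDiff ω _ = (pr α).rTensor A (loopDiff ω t)
      rw [loopDiff_apply, loopDiff_apply, map_sub, IsGrading.rTensor_sandwich_right,
        IsGrading.rTensor_sandwich_left (G.mul_loop α)]
    · rintro y _ ⟨t, rfl⟩
      exact ⟨_, loopDiff_sandwich H.central _ _ _⟩
    · rintro y _ ⟨t, rfl⟩
      exact ⟨_, loopDiff_sandwich H.central _ _ _⟩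
    -- If `(ω ⊗ 1) t = loopDiff ω g`, then `(1 ⊗ ω) g` is divisible by `ω ⊗ 1`, hence so is `g`, and
    -- its quotient `s` satisfies `loopDiff ω s = t`.
    · rintro t ⟨g, hg⟩
      change loopDiff ω g = _ at hg
      rw [loopDiff_apply, sub_eq_iff_eq_add, ← map_add] at hg
      obtain ⟨s, rfl⟩ := H.exists_of_sandwich_eq _ _ hg
      refine ⟨s, ?_⟩
      change loopDiff ω s = t
      rw [← sub_eq_zero]
      refine H.sandwich_left_injective _ ?_
      rw [map_sub, ← loopDiff_sandwich H.central, loopDiff_apply, hg, map_add]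
      abel
    · intro i
      have := hfl (a i)
      rwa [ha] at this
    · intro b
      rw [hF (σB b) _ (H.src_black b), hF b _ rfl, hB]
      exact ⟨_, rfl⟩
  choose S hS using hmem
  refine ⟨fun i => sandwich (D.e i) (D.e i) (S i), ?_⟩
  funext b
  rw [← sub_eq_zero]
  refine H.loopDiff_injective _ ?_
  have hS' : ∀ b i, D.src b = i → loopDiff ω (sandwich (D.e i) (D.e i) (S i)) = f b := by
    rintro b i rfl
    rw [loopDiff_sandwich H.central]
    have : loopDiff ω (S (D.src b)) = f b := (hS _).trans (hF b _ rfl)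
    rw [this]
    conv_rhs => rw [← hfl, ← hfr, sandwich_comp]
    simp only [one_mul]
  rw [map_sub, bdry₃_apply, sandwich_comp, sandwich_comp, H.e_mul_self, H.e_mul_self, H.x_mul_e,
    H.e_mul_x, ← hB, map_sub]
  have h1 : sandwich (D.e (D.tgt b)) (D.x b) (S (D.tgt b)) =
      sandwich 1 (D.x b) (sandwich (D.e (D.tgt b)) (D.e (D.tgt b)) (S (D.tgt b))) := by
    rw [sandwich_comp, mul_one, H.x_mul_e]
  have h2 : sandwich (D.x b) (D.e (D.src b)) (S (D.src b)) =
      sandwich (D.x b) 1 (sandwich (D.e (D.src b)) (D.e (D.src b)) (S (D.src b))) := by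
    rw [sandwich_comp, one_mul, H.e_mul_x]
  rw [h1, h2, loopDiff_sandwich H.central 1 (D.x b), loopDiff_sandwich H.central (D.x b) 1, hS' _ _ (H.src_black b),
    hS' _ _ rfl, sub_self]

end ArrowData

/-! ### Dualising the bimodule complex. -/

namespace ArrowData

/-- A map of left modules out of a power of `A ⊗ A` with values in the range of `g` factors
through `g`. -/
theorem exists_comp_eq {ι A M N : Type u} [Fintype ι] [Ring A] [Algebra ℂ A] [AddCommGroup M]
    [Module ℂ M] [Module A M] [IsScalarTower ℂ A M] [AddCommGroup N] [Module ℂ N] [Module A N]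
    [IsScalarTower ℂ A N] (f : (ι → A ⊗[ℂ] A) →ₗ[A] N) (g : M →ₗ[A] N)
    (h : ∀ y, f y ∈ LinearMap.range g) : ∃ k : (ι → A ⊗[ℂ] A) →ₗ[A] M, g ∘ₗ k = f := by
  classical
  have hk : ∀ i, ∃ φ : A →ₗ[ℂ] M, ∀ v, g (φ v) = f (Pi.single i ((1 : A) ⊗ₜ[ℂ] v)) := by
    intro i
    let gr : M →ₗ[ℂ] LinearMap.range g := (g.rangeRestrict).restrictScalars ℂ
    let fr : A →ₗ[ℂ] LinearMap.range g := ((f.codRestrict _ h).restrictScalars ℂ) ∘ₗ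
      (LinearMap.single A (fun _ => A ⊗[ℂ] A) i).restrictScalars ℂ ∘ₗ TensorProduct.mk ℂ A A 1
    -- A left linear map on `A ⊗ A` is freely determined by a linear map on the right factor, so
    -- lifting over the field `ℂ` suffices.
    obtain ⟨φ, hφ⟩ := Module.projective_lifting_property gr fr g.surjective_rangeRestrict
    exact ⟨φ, fun v => congrArg Subtype.val (LinearMap.congr_fun hφ v)⟩
  choose φ hφ using hk
  refine ⟨∑ i, pairing (φ i) ∘ₗ LinearMap.proj i,
    LinearMap.pi_ext' fun i => tensor_hom_ext fun v => ?_⟩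
  rw [LinearMap.comp_apply, LinearMap.comp_apply, LinearMap.comp_apply, LinearMap.single_apply,
    LinearMap.sum_apply, Finset.sum_eq_single i]
  · simp [hφ]
  · intro j _ hj
    simp [Pi.single_eq_of_ne hj]
  · simp

variable {V E A : Type u} [Ring A] [Algebra ℂ A] {D : ArrowData V E A}

section functional

variable {ι : Type u} [Fintype ι]

/-- The functional on a power of `A ⊗ A` that corresponds to a family of linear maps
`e_{t b} A → e_{s b} A`. -/
def functional (s t : ι → V) (ψ : ∀ b, D.HomC (t b) (s b)) : (ι → A ⊗[ℂ] A) →ₗ[A] A :=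
  ∑ b, pairing ((D.corner (s b)).subtype ∘ₗ (ψ b : D.corner (t b) →ₗ[ℂ] D.corner (s b)) ∘ₗ
    D.toCorner (t b)) ∘ₗ LinearMap.proj b

theorem functional_apply (s t : ι → V) (ψ : ∀ b, D.HomC (t b) (s b)) (y : ι → A ⊗[ℂ] A) :
    functional s t ψ y = ∑ b, pairing ((D.corner (s b)).subtype ∘ₗ
      (ψ b : D.corner (t b) →ₗ[ℂ] D.corner (s b)) ∘ₗ D.toCorner (t b)) (y b) := by
  simp [functional]

theorem functional_single [DecidableEq ι] (s t : ι → V) (ψ : ∀ b, D.HomC (t b) (s b)) (b : ι)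
    (u v : A) : functional s t ψ (Pi.single b (u ⊗ₜ[ℂ] v)) =
      u * (ψ b (D.toCorner (t b) v) : A) := by
  rw [functional_apply, Finset.sum_eq_single b]
  · rw [Pi.single_eq_same, pairing_tmul]
    rfl
  · intro c _ hc
    rw [Pi.single_eq_of_ne hc, map_zero]
  · simp

theorem toCorner_coe (h : ∀ i, D.e i * D.e i = D.e i) {i : V} (v : D.corner i) :
    D.toCorner i v = v := by
  obtain ⟨_, v, rfl⟩ := v
  exact Subtype.ext (by simp [coe_toCorner, ← mul_assoc, h])

theorem functional_injective (h : ∀ i, D.e i * D.e i = D.e i) (s t : ι → V) :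
    Function.Injective (functional (D := D) s t) := by
  classical
  intro φ ψ hφψ
  funext b
  refine D.homC_ext fun v => Subtype.ext ?_
  have := LinearMap.congr_fun hφψ (Pi.single b ((1 : A) ⊗ₜ[ℂ] (v : A)))
  rwa [functional_single, functional_single, toCorner_coe h, one_mul, one_mul] at this

theorem functional_zero (s t : ι → V) : functional (D := D) s t 0 = 0 := by
  classical
  refine LinearMap.pi_ext' fun b => tensor_hom_ext fun v => ?_
  rw [LinearMap.comp_apply, LinearMap.single_apply, functional_single]
  exact mul_zero _

-- Only the part of `G` on `⊕ Aeₛ ⊗ eₜA` comes from maps between corners, so `G` is recovered after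
-- composing with that projection.
open Classical in
theorem exists_functional_eq (s t : ι → V) (G : (ι → A ⊗[ℂ] A) →ₗ[A] A) :
    ∃ ψ : ∀ b, D.HomC (t b) (s b), functional s t ψ =
      G ∘ₗ LinearMap.pi fun b => sandwich (D.e (s b)) (D.e (t b)) ∘ₗ LinearMap.proj b := by
  let ψ : ∀ b, D.HomC (t b) (s b) := fun b => D.toCorner (s b) ∘ₗ G.restrictScalars ℂ ∘ₗ
    (LinearMap.single A (fun _ => A ⊗[ℂ] A) b).restrictScalars ℂ ∘ₗ TensorProduct.mk ℂ A A 1 ∘ₗ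
      (D.corner (t b)).subtype
  refine ⟨ψ, LinearMap.pi_ext' fun b => tensor_hom_ext fun v => ?_⟩
  rw [LinearMap.comp_apply, LinearMap.comp_apply, LinearMap.comp_apply, LinearMap.single_apply,
    functional_single, one_mul]
  change D.e (s b) * G (Pi.single b (1 ⊗ₜ[ℂ] (D.e (t b) * v))) = _
  rw [← smul_eq_mul, ← map_smul, ← Pi.single_smul, TensorProduct.smul_tmul', smul_eq_mul, mul_one]
  congr 1
  funext c
  by_cases hc : c = b
  · subst hc
    simp
  · simp [Pi.single_eq_of_ne hc]

end functional

variable [Fintype V] {σB σW : Equiv.Perm E} {ω : A} {θ : E → ℚ}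

/-- This and the next results identify `ev`, `d`, `r` and `p` with precomposition by `bdry₀`,
`bdry₁`, `bdry₂` and `bdry₃`. -/
theorem functional_ev (H : D.IsTiling σB σW ω θ) (x : A) :
    functional (fun i => i) (fun i => i) (D.ev x) =
      LinearMap.toSpanSingleton A A x ∘ₗ D.bdry₀ := by
  classical
  refine LinearMap.pi_ext' fun i => tensor_hom_ext fun v => ?_
  rw [LinearMap.comp_apply, LinearMap.comp_apply, LinearMap.comp_apply, LinearMap.single_apply,
    functional_single, bdry₀_single, sandwich_tmul, pairing_tmul, one_mul, one_mul,
    LinearMap.id_apply, smul_eq_mul, LinearMap.toSpanSingleton_apply, smul_eq_mul, ← mul_assoc,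
    H.e_mul_self]
  rfl

variable [Fintype E]

theorem functional_d (H : D.IsTiling σB σW ω θ) (φ : D.VertexTerm) :
    functional D.src D.tgt (D.d φ) = functional (fun i => i) (fun i => i) φ ∘ₗ D.bdry₁ := by
  classical
  refine LinearMap.pi_ext' fun a => tensor_hom_ext fun v => ?_
  rw [LinearMap.comp_apply, LinearMap.comp_apply, LinearMap.comp_apply, LinearMap.single_apply,
    functional_single, bdry₁_single, map_sub, sandwich_tmul, sandwich_tmul, functional_single,
    functional_single, one_mul, one_mul, one_mul]
  change D.e _ * (D.x a * (φ (D.tgt a) (D.toCorner (D.tgt a) v) : A)) -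
    (φ (D.src a) (D.toCorner (D.src a) (D.x a * (D.e (D.tgt a) * v))) : A) = _
  have h1 : D.toCorner (D.tgt a) (D.e (D.tgt a) * v) = D.toCorner (D.tgt a) v :=
    toCorner_coe H.e_mul_self (D.toCorner (D.tgt a) v)
  have h2 : ∀ z : D.corner (D.src a), D.e (D.src a) * (z : A) = z := fun z =>
    congrArg Subtype.val (toCorner_coe H.e_mul_self z)
  rw [← mul_assoc, H.e_mul_x, ← mul_assoc (D.x a), H.x_mul_e, h1, h2]

theorem functional_placements (ψ : D.ArrowTerm) (w : List E) (u v : A) :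
    functional D.src D.tgt ψ (D.placements w (u ⊗ₜ[ℂ] v)) = u * D.along ψ w v := by
  classical
  induction w generalizing u with
  | nil => simp [placements, along]
  | cons b w ih =>
    rw [placements, LinearMap.add_apply, LinearMap.comp_apply, LinearMap.comp_apply,
      LinearMap.single_apply, sandwich_tmul, sandwich_tmul, map_add, one_mul, mul_one, ih,
      along_cons, mul_add, mul_assoc]
    congr 1
    convert functional_single D.src D.tgt ψ b u (D.word w * v)

theorem functional_r (ψ : D.ArrowTerm) :
    functional D.tgt D.src (D.r ψ) = functional D.src D.tgt ψ ∘ₗ D.bdry₂ := by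
  classical
  refine LinearMap.pi_ext' fun a => tensor_hom_ext fun v => ?_
  rw [LinearMap.comp_apply, LinearMap.comp_apply, LinearMap.comp_apply, LinearMap.single_apply,
    functional_single, bdry₂_single, map_sub, sandwich_tmul, functional_placements,
    functional_placements, one_mul, one_mul, ← mul_sub]
  rfl

open Classical in
theorem functional_p (H : D.IsTiling σB σW ω θ) (ν : D.CoarrowTerm) :
    functional (fun i => i) (fun i => i) (D.p ν) = functional D.tgt D.src ν ∘ₗ D.bdry₃ := by
  refine LinearMap.pi_ext' fun i => tensor_hom_ext fun v => ?_
  have h1 : ∀ i v, D.toCorner i (D.e i * v) = D.toCorner i v := fun i v =>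
    toCorner_coe H.e_mul_self (D.toCorner i v)
  rw [LinearMap.comp_apply, LinearMap.comp_apply, LinearMap.comp_apply, LinearMap.single_apply,
    functional_single, one_mul]
  change D.e i * D.around ν i (D.e i * v) = _
  rw [around_apply, functional_apply, mul_sub, Finset.mul_sum, Finset.mul_sum, Finset.sum_filter,
    Finset.sum_filter, ← Finset.sum_sub_distrib]
  refine Finset.sum_congr rfl fun a _ => ?_
  rw [bdry₃_apply, map_sub]
  congr 1
  · split_ifs with h
    · subst h
      rw [Pi.single_eq_same, sandwich_tmul, pairing_tmul, one_mul, smul_eq_mul, ← mul_assoc (D.x a),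
        H.x_mul_e]
      rfl
    · rw [Pi.single_eq_of_ne h, map_zero, map_zero]
  · split_ifs with h
    · subst h
      rw [Pi.single_eq_same, sandwich_tmul, pairing_tmul, one_mul, smul_eq_mul, ← mul_assoc,
        H.e_mul_x]
      rfl
    · rw [Pi.single_eq_of_ne h, map_zero, map_zero]

end ArrowData

/-! ### The left linear contraction, and exactness of the dual. -/

namespace ArrowData

variable {V E A : Type u} [Ring A] [Algebra ℂ A] {D : ArrowData V E A} [Fintype V] [Fintype E]
  {σB σW : Equiv.Perm E} {ω : A} {θ : E → ℚ}

theorem IsTiling.projVertex_comp_self (H : D.IsTiling σB σW ω θ) :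
    D.projVertex ∘ₗ D.projVertex = D.projVertex := by
  refine LinearMap.ext fun s => funext fun i => ?_
  rw [LinearMap.comp_apply, projVertex_apply, projVertex_apply, sandwich_comp, H.e_mul_self]

theorem IsTiling.projArrow_comp_self (H : D.IsTiling σB σW ω θ) :
    D.projArrow ∘ₗ D.projArrow = D.projArrow := by
  refine LinearMap.ext fun s => funext fun i => ?_
  rw [LinearMap.comp_apply, projArrow_apply, projArrow_apply, sandwich_comp, H.e_mul_self,
    H.e_mul_self]

theorem IsTiling.projCoarrow_comp_self (H : D.IsTiling σB σW ω θ) :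
    D.projCoarrow ∘ₗ D.projCoarrow = D.projCoarrow := by
  refine LinearMap.ext fun s => funext fun i => ?_
  rw [LinearMap.comp_apply, projCoarrow_apply, projCoarrow_apply, sandwich_comp, H.e_mul_self,
    H.e_mul_self]

theorem IsTiling.bdry₃_comp_projVertex (H : D.IsTiling σB σW ω θ) :
    D.bdry₃ ∘ₗ D.projVertex = D.bdry₃ := by
  refine LinearMap.ext fun s => funext fun a => ?_
  rw [LinearMap.comp_apply, bdry₃_apply, bdry₃_apply, projVertex_apply, projVertex_apply,
    sandwich_comp, sandwich_comp, H.e_mul_self, H.e_mul_self, H.x_mul_e, H.e_mul_x]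

theorem IsTiling.projCoarrow_comp_bdry₃ (H : D.IsTiling σB σW ω θ) :
    D.projCoarrow ∘ₗ D.bdry₃ = D.bdry₃ := LinearMap.ext H.projCoarrow_bdry₃

theorem IsTiling.bdry₂_comp_projCoarrow (H : D.IsTiling σB σW ω θ) :
    D.bdry₂ ∘ₗ D.projCoarrow = D.bdry₂ := by
  refine LinearMap.ext fun c => ?_
  rw [LinearMap.comp_apply, bdry₂_apply, bdry₂_apply, ← LinearMap.comp_apply,
    H.projCoarrow_comp_self]

theorem IsTiling.projArrow_comp_bdry₂ (H : D.IsTiling σB σW ω θ) :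
    D.projArrow ∘ₗ D.bdry₂ = D.bdry₂ := by
  refine LinearMap.ext fun c => funext fun b => ?_
  have hl : ∀ {σ : Equiv.Perm E} {w : E → List E}, D.IsColour σ w ω →
      sandwich (D.e (D.src b)) (D.e (D.tgt b)) (cycleSum D.x σ (D.projCoarrow c) b) =
        cycleSum D.x σ (D.projCoarrow c) b := by
    intro σ w C
    rw [cycleSum, map_sum]
    refine Finset.sum_congr rfl fun k hk => ?_
    rw [Finset.mem_range] at hk
    have h2 : (σ ^ k) ((σ⁻¹ ^ k) b) = b := by
      rw [inv_pow, ← Equiv.Perm.mul_apply, mul_inv_cancel, Equiv.Perm.one_apply]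
    have e1 : D.tgt ((σ⁻¹ ^ (k + 1)) b) = D.src ((σ⁻¹ ^ k) b) := by
      rw [← C.src_apply, ← Equiv.Perm.mul_apply, pow_succ', ← mul_assoc, mul_inv_cancel, one_mul]
    have e2 : D.e (D.src ((σ⁻¹ ^ k) b)) * (iterProd D.x σ ((σ⁻¹ ^ k) b) k * D.e (D.src b)) =
        D.e (D.src ((σ⁻¹ ^ k) b)) * iterProd D.x σ ((σ⁻¹ ^ k) b) k := by
      cases k with
      | zero =>
        simp only [iterProd_zero, pow_zero, Equiv.Perm.one_apply, one_mul, mul_one]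
        exact H.e_mul_self _
      | succ k =>
        have := C.iterProd_succ_mul_e ((σ⁻¹ ^ (k + 1)) b) k
        rw [h2] at this
        rw [this]
    have e3 : D.e (D.tgt b) * iterProd D.x σ (σ b) (Function.minimalPeriod σ b - 1 - 1 - k) *
        D.e (D.src ((σ⁻¹ ^ (k + 1)) b)) =
        iterProd D.x σ (σ b) (Function.minimalPeriod σ b - 1 - 1 - k) *
          D.e (D.src ((σ⁻¹ ^ (k + 1)) b)) := by
      rw [← C.src_apply]
      rcases h : Function.minimalPeriod σ b - 1 - 1 - k with _ | m
      · have : (σ⁻¹ ^ (k + 1)) b = σ b := by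
          rw [σ.inv_pow_apply_eq b (by omega),
            show Function.minimalPeriod σ b - (k + 1) = 1 by omega, pow_one]
        rw [this, iterProd_zero, mul_one, H.e_mul_self, one_mul]
      · rw [C.e_mul_iterProd_succ]
    rw [projCoarrow_apply, sandwich_comp, sandwich_comp, sandwich_comp, e1, e2, e3]
  rw [LinearMap.comp_apply, projArrow_apply, H.bdry₂_apply_apply, map_sub, hl H.black, hl H.white]

theorem IsTiling.bdry₁_comp_projArrow (H : D.IsTiling σB σW ω θ) :
    D.bdry₁ ∘ₗ D.projArrow = D.bdry₁ := by
  classical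
  refine LinearMap.ext fun c => ?_
  rw [LinearMap.comp_apply, bdry₁_apply, bdry₁_apply]
  refine Finset.sum_congr rfl fun a _ => ?_
  rw [projArrow_apply, sandwich_comp, sandwich_comp, H.e_mul_self, H.e_mul_self, H.x_mul_e,
    H.e_mul_x]

theorem IsTiling.projVertex_comp_bdry₁ (H : D.IsTiling σB σW ω θ) :
    D.projVertex ∘ₗ D.bdry₁ = D.bdry₁ := by
  classical
  have h : ∀ i t, D.projVertex (Pi.single i t) = Pi.single i (sandwich (D.e i) (D.e i) t) := by
    intro i t
    funext j
    by_cases hj : j = i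
    · subst hj
      simp [projVertex_apply]
    · simp [projVertex_apply, Pi.single_eq_of_ne hj]
  refine LinearMap.ext fun c => ?_
  rw [LinearMap.comp_apply, bdry₁_apply, map_sum]
  refine Finset.sum_congr rfl fun a _ => ?_
  rw [map_sub, h, h, sandwich_comp, sandwich_comp, H.e_mul_self, H.e_mul_self, H.x_mul_e,
    H.e_mul_x]

/-- The complex of bimodules is contractible as a complex of left modules. -/
theorem IsTiling.exists_contraction (H : D.IsTiling σB σW ω θ) :
    ∃ (h₀ : (V → A ⊗[ℂ] A) →ₗ[A] (E → A ⊗[ℂ] A)) (h₁ : (E → A ⊗[ℂ] A) →ₗ[A] (E → A ⊗[ℂ] A))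
      (h₂ : (E → A ⊗[ℂ] A) →ₗ[A] (V → A ⊗[ℂ] A)),
      D.bdry₁ ∘ₗ h₀ + D.sect₀ ∘ₗ D.bdry₀ = D.projVertex ∧
      D.bdry₂ ∘ₗ h₁ + h₀ ∘ₗ D.bdry₁ = D.projArrow ∧
      D.bdry₃ ∘ₗ h₂ + h₁ ∘ₗ D.bdry₂ = D.projCoarrow ∧
      h₂ ∘ₗ D.bdry₃ = D.projVertex := by
  -- The usual inductive contraction, starting from the section of `bdry₀`. Composing each lift with
  -- a projection keeps it in the right summand of the powers of `A ⊗ A`.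
  obtain ⟨k₀, hk₀⟩ := exists_comp_eq (D.projVertex - D.sect₀ ∘ₗ D.bdry₀) D.bdry₁
    H.projVertex_sub_sect₀_mem
  let h₀ := D.projArrow ∘ₗ k₀
  have eh₀ : ∀ s, D.bdry₁ (h₀ s) + D.sect₀ (D.bdry₀ s) = D.projVertex s := fun s => by
    have h1 := LinearMap.congr_fun hk₀ s
    have h2 := LinearMap.congr_fun H.bdry₁_comp_projArrow (k₀ s)
    simp only [LinearMap.comp_apply, LinearMap.sub_apply] at h1 h2
    simp only [h₀, LinearMap.comp_apply]
    rw [h2, h1, sub_add_cancel]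
  have hp : ∀ c, D.projArrow (D.projArrow c) = D.projArrow c :=
    LinearMap.congr_fun H.projArrow_comp_self
  have hq : ∀ c, D.projCoarrow (D.projCoarrow c) = D.projCoarrow c :=
    LinearMap.congr_fun H.projCoarrow_comp_self
  obtain ⟨k₁, hk₁⟩ := exists_comp_eq (D.projArrow - h₀ ∘ₗ D.bdry₁) D.bdry₂ fun c => by
    have h1 : (D.projArrow - h₀ ∘ₗ D.bdry₁) c =
        D.projArrow ((D.projArrow - h₀ ∘ₗ D.bdry₁) c) := by
      simp only [h₀, LinearMap.sub_apply, LinearMap.comp_apply, map_sub, hp]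
    rw [h1]
    refine H.projArrow_mem _ ?_
    have h2 := LinearMap.congr_fun H.bdry₁_comp_projArrow c
    have h3 := LinearMap.congr_fun H.projVertex_comp_bdry₁ c
    have h4 := eh₀ (D.bdry₁ c)
    rw [LinearMap.comp_apply] at h2 h3
    rw [H.bdry₀_bdry₁, map_zero, add_zero, h3] at h4
    rw [LinearMap.sub_apply, LinearMap.comp_apply, map_sub, h2, h4, sub_self]
  let h₁ := D.projCoarrow ∘ₗ k₁
  have eh₁ : ∀ c, D.bdry₂ (h₁ c) + h₀ (D.bdry₁ c) = D.projArrow c := fun c => by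
    have h1 := LinearMap.congr_fun hk₁ c
    have h2 := LinearMap.congr_fun H.bdry₂_comp_projCoarrow (k₁ c)
    simp only [LinearMap.comp_apply, LinearMap.sub_apply] at h1 h2
    simp only [h₁, LinearMap.comp_apply]
    rw [h2, h1, sub_add_cancel]
  obtain ⟨k₂, hk₂⟩ := exists_comp_eq (D.projCoarrow - h₁ ∘ₗ D.bdry₂) D.bdry₃ fun c => by
    have h1 : (D.projCoarrow - h₁ ∘ₗ D.bdry₂) c =
        D.projCoarrow ((D.projCoarrow - h₁ ∘ₗ D.bdry₂) c) := by
      simp only [h₁, LinearMap.sub_apply, LinearMap.comp_apply, map_sub, hq]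
    rw [h1]
    refine H.projCoarrow_mem _ ?_
    have h2 := LinearMap.congr_fun H.bdry₂_comp_projCoarrow c
    have h3 := LinearMap.congr_fun H.projArrow_comp_bdry₂ c
    have h4 := eh₁ (D.bdry₂ c)
    rw [LinearMap.comp_apply] at h2 h3
    rw [H.bdry₁_bdry₂, map_zero, add_zero, h3] at h4
    rw [LinearMap.sub_apply, LinearMap.comp_apply, map_sub, h2, h4, sub_self]
  let h₂ := D.projVertex ∘ₗ k₂
  have eh₂ : ∀ c, D.bdry₃ (h₂ c) + h₁ (D.bdry₂ c) = D.projCoarrow c := fun c => by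
    have h1 := LinearMap.congr_fun hk₂ c
    have h2 := LinearMap.congr_fun H.bdry₃_comp_projVertex (k₂ c)
    simp only [LinearMap.comp_apply, LinearMap.sub_apply] at h1 h2
    simp only [h₂, LinearMap.comp_apply]
    rw [h2, h1, sub_add_cancel]
  refine ⟨h₀, h₁, h₂, LinearMap.ext eh₀, LinearMap.ext eh₁, LinearMap.ext eh₂,
    LinearMap.ext fun s => ?_⟩
  have hv : ∀ s, D.projVertex (D.projVertex s) = D.projVertex s :=
    LinearMap.congr_fun H.projVertex_comp_self
  -- The difference is killed by `bdry₃`, which is injective on `⊕ᵢ Aeᵢ ⊗ eᵢA`.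
  have h1 : D.projVertex (D.projVertex s - h₂ (D.bdry₃ s)) = 0 := by
    refine H.projVertex_eq_zero _ ?_
    have h2 := LinearMap.congr_fun H.bdry₃_comp_projVertex s
    have h3 := eh₂ (D.bdry₃ s)
    rw [LinearMap.comp_apply] at h2
    rw [H.bdry₂_bdry₃, map_zero, add_zero, H.projCoarrow_bdry₃] at h3
    rw [map_sub, h2, h3, sub_self]
  simp only [h₂, LinearMap.comp_apply, map_sub, hv] at h1
  exact (sub_eq_zero.1 h1).symm

/-- Precomposition with the contraction contracts the dual: a cocycle is the coboundary of its
composite with the homotopy. -/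
theorem IsTiling.exact (H : D.IsTiling σB σW ω θ) :
    Function.Injective D.ev ∧ Function.Exact D.ev D.d ∧ Function.Exact D.d D.r ∧
      Function.Exact D.r D.p ∧ Function.Surjective D.p := by
  obtain ⟨h₀, h₁, h₂, e₀, e₁, e₂, e₃⟩ := H.exists_contraction
  have injV := functional_injective (D := D) H.e_mul_self (fun i : V => i) (fun i => i)
  have injA := functional_injective (D := D) H.e_mul_self D.src D.tgt
  have injC := functional_injective (D := D) H.e_mul_self D.tgt D.src
  have good : ∀ {ι : Type u} [Fintype ι] (s t : ι → V) (ψ : ∀ b, D.HomC (t b) (s b)),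
      (functional s t ψ) ∘ₗ (LinearMap.pi fun b => sandwich (D.e (s b)) (D.e (t b)) ∘ₗ
        LinearMap.proj b) = functional s t ψ := by
    classical
    intro ι _ s t ψ
    refine LinearMap.pi_ext' fun b => tensor_hom_ext fun v => ?_
    have h1 : (LinearMap.pi fun b => sandwich (D.e (s b)) (D.e (t b)) ∘ₗ LinearMap.proj b)
        (Pi.single b ((1 : A) ⊗ₜ[ℂ] v)) = Pi.single b (D.e (s b) ⊗ₜ[ℂ] (D.e (t b) * v)) := by
      funext c
      by_cases hc : c = b
      · subst hc
        simp
      · simp [Pi.single_eq_of_ne hc]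
    rw [LinearMap.comp_apply, LinearMap.comp_apply, LinearMap.comp_apply, LinearMap.single_apply,
      h1, functional_single, functional_single, one_mul]
    have h2 : D.toCorner (t b) (D.e (t b) * v) = D.toCorner (t b) v :=
      toCorner_coe H.e_mul_self (D.toCorner (t b) v)
    have h3 := congrArg Subtype.val (toCorner_coe H.e_mul_self (ψ b (D.toCorner (t b) v)))
    rw [h2]
    exact h3
  refine ⟨?_, ?_, ?_, ?_, ?_⟩
  · intro x y hxy
    have h := congrArg (functional (D := D) (fun i : V => i) fun i => i) hxy
    rw [functional_ev H, functional_ev H] at h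
    have := LinearMap.congr_fun h (D.sect₀ 1)
    rw [LinearMap.comp_apply, LinearMap.comp_apply, H.bdry₀_sect₀] at this
    simpa using this
  · intro φ
    constructor
    · intro h
      have h1 : functional (fun i => i) (fun i => i) φ ∘ₗ D.bdry₁ = 0 := by
        rw [← functional_d H, h, functional_zero]
      refine ⟨functional (fun i => i) (fun i => i) φ (D.sect₀ 1), injV ?_⟩
      rw [functional_ev H]
      refine LinearMap.ext fun s => ?_
      have h2 : functional (fun i => i) (fun i => i) φ (D.projVertex s) =
        functional (fun i => i) (fun i => i) φ s := LinearMap.congr_fun (good _ _ φ) s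
      have h3 := LinearMap.congr_fun h1 (h₀ s)
      rw [LinearMap.comp_apply] at h3
      rw [← h2, ← e₀, LinearMap.add_apply, map_add, LinearMap.comp_apply, LinearMap.comp_apply,
        LinearMap.comp_apply, h3, LinearMap.zero_apply, zero_add, LinearMap.toSpanSingleton_apply,
        ← map_smul, ← map_smul, smul_eq_mul, mul_one]
    · rintro ⟨x, rfl⟩
      refine injA ?_
      rw [functional_d H, functional_ev H, LinearMap.comp_assoc]
      have : D.bdry₀ ∘ₗ D.bdry₁ = 0 := LinearMap.ext H.bdry₀_bdry₁
      rw [this, LinearMap.comp_zero, functional_zero]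
  · intro ψ
    constructor
    · intro h
      have h1 : functional D.src D.tgt ψ ∘ₗ D.bdry₂ = 0 := by
        rw [← functional_r, h, functional_zero]
      obtain ⟨φ, hφ⟩ := exists_functional_eq (D := D) (fun i => i) (fun i => i)
        (functional D.src D.tgt ψ ∘ₗ h₀)
      refine ⟨φ, injA ?_⟩
      rw [functional_d H, hφ]
      change (_ ∘ₗ D.projVertex) ∘ₗ _ = _
      rw [LinearMap.comp_assoc, H.projVertex_comp_bdry₁, ← good D.src D.tgt ψ]
      change _ = _ ∘ₗ D.projArrow
      rw [good D.src D.tgt ψ, ← e₁, LinearMap.comp_add, ← LinearMap.comp_assoc, h1,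
        LinearMap.zero_comp, zero_add, LinearMap.comp_assoc]
    · rintro ⟨φ, rfl⟩
      refine injC ?_
      rw [functional_r, functional_d H, LinearMap.comp_assoc]
      have : D.bdry₁ ∘ₗ D.bdry₂ = 0 := LinearMap.ext H.bdry₁_bdry₂
      rw [this, LinearMap.comp_zero, functional_zero]
  · intro ν
    constructor
    · intro h
      have h1 : functional D.tgt D.src ν ∘ₗ D.bdry₃ = 0 := by
        rw [← functional_p H, h, functional_zero]
      obtain ⟨ψ, hψ⟩ := exists_functional_eq (D := D) D.src D.tgt
        (functional D.tgt D.src ν ∘ₗ h₁)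
      refine ⟨ψ, injC ?_⟩
      rw [functional_r, hψ]
      change (_ ∘ₗ D.projArrow) ∘ₗ _ = _
      rw [LinearMap.comp_assoc, H.projArrow_comp_bdry₂, ← good D.tgt D.src ν]
      change _ = _ ∘ₗ D.projCoarrow
      rw [good D.tgt D.src ν, ← e₂, LinearMap.comp_add, ← LinearMap.comp_assoc, h1,
        LinearMap.zero_comp, zero_add, LinearMap.comp_assoc]
    · rintro ⟨ψ, rfl⟩
      refine injV ?_
      rw [functional_p H, functional_r, LinearMap.comp_assoc]
      have : D.bdry₂ ∘ₗ D.bdry₃ = 0 := LinearMap.ext H.bdry₂_bdry₃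
      rw [this, LinearMap.comp_zero, functional_zero]
  · intro φ
    obtain ⟨ν, hν⟩ := exists_functional_eq (D := D) D.tgt D.src
      (functional (fun i => i) (fun i => i) φ ∘ₗ h₂)
    refine ⟨ν, injV ?_⟩
    rw [functional_p H, hν]
    change (_ ∘ₗ D.projCoarrow) ∘ₗ _ = _
    rw [LinearMap.comp_assoc, H.projCoarrow_comp_bdry₃, LinearMap.comp_assoc, e₃]
    exact good _ _ φ

end ArrowData

/-! ### Injective dimension, and injectivity of the terms. -/

section InjectiveDimension

open CategoryTheory

theorem ModuleCat.hasInjectiveDimensionLE_of_exact {R M N P : Type u} [Ring R] [AddCommGroup M]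
    [AddCommGroup N] [AddCommGroup P] [Module R M] [Module R N] [Module R P]
    [Module.Injective R N] {f : M →ₗ[R] N} {g : N →ₗ[R] P} (hf : Function.Injective f)
    (hfg : Function.Exact f g) (hg : Function.Surjective g) {n : ℕ}
    (hP : HasInjectiveDimensionLE (ModuleCat.of R P) n) :
    HasInjectiveDimensionLE (ModuleCat.of R M) (n + 1) := by
  let S : ShortComplex (ModuleCat.{u} R) :=
    ModuleCat.shortComplexOfCompEqZero f g hfg.linearMap_comp_eq_zero
  have hS := ModuleCat.shortComplex_shortExact S hfg hf hg
  have hN : Injective S.X₂ := Module.injective_object_of_injective_module R N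
  exact (hS.hasInjectiveDimensionLT_X₃_iff n hN).1 hP

theorem ModuleCat.hasInjectiveDimensionLE_zero {R M : Type u} [Ring R] [AddCommGroup M]
    [Module R M] [Module.Injective R M] : HasInjectiveDimensionLE (ModuleCat.of R M) 0 := by
  have : Injective (ModuleCat.of R M) := Module.injective_object_of_injective_module R M
  exact injective_iff_hasInjectiveDimensionLT_one.1 this

end InjectiveDimension

namespace ArrowData

variable {V E A : Type u} [Ring A] [Algebra ℂ A] {D : ArrowData V E A}

/-- The module is coinduced: a left linear map `g : X → Hom(eᵢA, eⱼA)` is determined by the linear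
map `x ↦ g x eᵢ`, via `g x v = g (v x) eᵢ`. Linear maps extend along injections over `ℂ`. -/
theorem injective_homC (i j : V) (h : D.e i * D.e i = D.e i) :
    Module.Injective A (D.HomC i j) := by
  refine ⟨fun X Y _ _ _ _ f hf g => ?_⟩
  let _ : Module ℂ X := Module.compHom X (algebraMap ℂ A)
  let _ : Module ℂ Y := Module.compHom Y (algebraMap ℂ A)
  have smX : ∀ (c : ℂ) (x : X), c • x = algebraMap ℂ A c • x := fun _ _ => rfl
  have smY : ∀ (c : ℂ) (y : Y), c • y = algebraMap ℂ A c • y := fun _ _ => rfl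
  let ei : D.corner i := D.toCorner i 1
  have hei : (ei : A) = D.e i := mul_one _
  have hcoe : ∀ v : D.corner i, D.e i * (v : A) = v := by
    rintro ⟨_, v, rfl⟩
    simp [← mul_assoc, h]
  let fC : X →ₗ[ℂ] Y :=
    { toFun := f
      map_add' := map_add f
      map_smul' := fun c x => by rw [smX, map_smul, smY]; rfl }
  obtain ⟨k, hk⟩ := fC.exists_leftInverse_of_injective (LinearMap.ker_eq_bot.2 hf)
  have hk' : ∀ x, k (f x) = x := fun x => LinearMap.congr_fun hk x
  let γ : X →ₗ[ℂ] D.corner j :=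
    { toFun := fun x => g x ei
      map_add' := fun x y => by rw [map_add]; rfl
      map_smul' := fun c x => by
        have e : D.mulRight i (algebraMap ℂ A c) ei = c • ei := Subtype.ext (by
          rw [coe_mulRight, Submodule.coe_smul, Algebra.smul_def, Algebra.commutes])
        rw [smX, map_smul, smul_apply, e, RingHom.id_apply]
        exact LinearMap.map_smul (g x : D.corner i →ₗ[ℂ] D.corner j) c ei }
  -- Here `γ ∘ k` extends `x ↦ g x eᵢ` from `X` to `Y`.
  let ext (y : Y) : D.corner i →ₗ[ℂ] D.corner j :=
    { toFun := fun v => γ (k ((v : A) • y))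
      map_add' := fun v w => by rw [Submodule.coe_add, add_smul, map_add, map_add]
      map_smul' := fun c v => by
        rw [Submodule.coe_smul, Algebra.smul_def, mul_smul, ← smY, map_smul, map_smul]
        rfl }
  refine ⟨{ toFun := ext, map_add' := fun y z => ?_, map_smul' := fun b y => ?_ }, fun x => ?_⟩
  · refine D.homC_ext fun v => ?_
    change γ (k ((v : A) • (y + z))) = γ (k ((v : A) • y)) + γ (k ((v : A) • z))
    rw [smul_add, map_add, map_add]
  · refine D.homC_ext fun v => ?_
    change γ (k ((v : A) • b • y)) = γ (k (((v : A) * b) • y))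
    rw [mul_smul]
  · refine D.homC_ext fun v => ?_
    change γ (k ((v : A) • f x)) = g x v
    rw [← map_smul, hk']
    change g ((v : A) • x) ei = g x v
    rw [map_smul, smul_apply]
    congr 1
    refine Subtype.ext ?_
    rw [coe_mulRight, hei, hcoe]

variable [Fintype V] [Fintype E] {σB σW : Equiv.Perm E} {ω : A} {θ : E → ℚ}

theorem IsTiling.isInjectiveResolution (H : D.IsTiling σB σW ω θ) : D.IsInjectiveResolution := by
  have h : ∀ i j, Module.Injective A (D.HomC i j) := fun i j => injective_homC i j (H.e_mul_self i)
  exact ⟨Module.Injective.pi A _, Module.Injective.pi A _, Module.Injective.pi A _, H.exact⟩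

theorem IsInjectiveResolution.hasInjectiveDimensionLE (h : D.IsInjectiveResolution) :
    CategoryTheory.HasInjectiveDimensionLE (ModuleCat.of A A) 3 := by
  obtain ⟨i₀, i₁, i₂, hev, h₀, h₁, h₂, hp⟩ := h
  -- The resolution is cut at the images of `d` and `r` into three short exact sequences, each
  -- raising the bound on the dimension by one.
  have e₂ : Function.Exact (LinearMap.range D.r).subtype D.p := by
    intro y
    rw [h₂ y]
    simp
  have e₁ : Function.Exact (LinearMap.range D.d).subtype D.r.rangeRestrict := by
    intro y
    rw [← Submodule.coe_eq_zero]
    change D.r y = 0 ↔ _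
    rw [h₁ y]
    simp
  have e₀ : Function.Exact D.ev D.d.rangeRestrict := by
    intro y
    rw [← Submodule.coe_eq_zero]
    exact h₀ y
  exact ModuleCat.hasInjectiveDimensionLE_of_exact hev e₀ D.d.surjective_rangeRestrict
    (ModuleCat.hasInjectiveDimensionLE_of_exact (Submodule.subtype_injective _) e₁
      D.r.surjective_rangeRestrict
      (ModuleCat.hasInjectiveDimensionLE_of_exact (Submodule.subtype_injective _) e₂ hp
        ModuleCat.hasInjectiveDimensionLE_zero))

/-- The ring `A` as a right module over itself. -/
def opLinearEquiv (A : Type u) [Ring A] : A ≃ₗ[Aᵐᵒᵖ] Aᵐᵒᵖ :=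
  { MulOpposite.opAddEquiv with map_smul' := fun _ _ => rfl }

theorem IsInjectiveResolution.isGorensteinRing {D : ArrowData V E A} {D' : ArrowData V E Aᵐᵒᵖ}
    (h : D.IsInjectiveResolution) (h' : D'.IsInjectiveResolution) : IsGorensteinRing A :=
  ⟨⟨3, h.hasInjectiveDimensionLE⟩, ⟨3,
    (ModuleCat.hasInjectiveDimensionLE_iff_of_linearEquiv
      (M := ModuleCat.of Aᵐᵒᵖ A) (N := ModuleCat.of Aᵐᵒᵖ Aᵐᵒᵖ) (opLinearEquiv A) 3).2
      h'.hasInjectiveDimensionLE⟩⟩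

end ArrowData

/-! ### The opposite data -/

theorem Equiv.Perm.minimalPeriod_inv {E : Type*} (σ : Equiv.Perm E) (a : E) :
    Function.minimalPeriod (σ⁻¹ : Equiv.Perm E) a = Function.minimalPeriod σ a := by
  have h : ∀ n, Function.IsPeriodicPt (σ⁻¹ : Equiv.Perm E) n a ↔ Function.IsPeriodicPt σ n a := by
    intro n
    rw [Function.IsPeriodicPt, Function.IsPeriodicPt, Function.IsFixedPt, Function.IsFixedPt,
      ← Equiv.Perm.coe_pow, ← Equiv.Perm.coe_pow, inv_pow, Equiv.Perm.inv_eq_iff_eq, eq_comm]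
  exact Nat.dvd_antisymm
    (((h _).2 (Function.isPeriodicPt_minimalPeriod σ a)).minimalPeriod_dvd)
    (((h _).1 (Function.isPeriodicPt_minimalPeriod _ a)).minimalPeriod_dvd)

theorem BraneTiling.vertexCycle_inv_tail {E : Type*} (σ : Equiv.Perm E) (a : E) :
    (BraneTiling.vertexCycle σ⁻¹ a).tail = (BraneTiling.vertexCycle σ a).tail.reverse := by
  rw [vertexCycle_tail, vertexCycle_tail, σ.minimalPeriod_inv]
  refine List.ext_getElem (by simp) fun k h1 h2 => ?_
  simp only [List.length_map, List.length_range] at h1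
  simp only [List.getElem_map, List.getElem_range, List.getElem_reverse, List.length_map,
    List.length_range]
  rw [← Equiv.Perm.mul_apply, ← Equiv.Perm.mul_apply, ← pow_succ, ← pow_succ,
    σ.inv_pow_apply_eq a (by omega)]
  congr 2
  omega

theorem CompleteOrthogonalIdempotents.op {R I : Type*} [Ring R] [Fintype I] {e : I → R}
    (h : CompleteOrthogonalIdempotents e) :
    CompleteOrthogonalIdempotents fun i => MulOpposite.op (e i) where
  idem i := congrArg MulOpposite.op (h.idem i)
  ortho i j hij := congrArg MulOpposite.op (h.ortho (Ne.symm hij))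
  complete := by
    rw [← MulOpposite.op_one, ← h.complete]
    exact (map_sum MulOpposite.opAddEquiv e _).symm

namespace ArrowData

variable {V E A : Type u} [Ring A] {D : ArrowData V E A}

theorem op_word_reverse (l : List E) : D.op.word l.reverse = MulOpposite.op (D.word l) := by
  induction l with
  | nil => rfl
  | cons a l ih =>
    rw [List.reverse_cons, word, List.map_append, List.prod_append, ← word, ih,
      show D.word (a :: l) = D.x a * D.word l by simp [word],
      MulOpposite.op_mul]
    simp [ArrowData.op]

theorem IsPath.append {i j k : V} {l m : List E} (h : D.IsPath i l j) (h' : D.IsPath j m k) :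
    D.IsPath i (l ++ m) k := by
  induction h with
  | nil i => exact h'
  | cons _ ih => exact .cons (ih h')

theorem IsPath.reverse {i j : V} {l : List E} (h : D.IsPath i l j) :
    D.op.IsPath j l.reverse i := by
  induction h with
  | nil i => exact .nil i
  | @cons a l j _ ih =>
    rw [List.reverse_cons]
    refine ih.append ?_
    exact IsPath.cons (D := D.op) (a := a) (IsPath.nil _)

variable [Algebra ℂ A] [Fintype V] [Finite E] {σB σW : Equiv.Perm E} {ω : A} {θ : E → ℚ}

/-- Reversing all arrows inverts both rotations and reverses the broken loops; `ω` and `θ` stay the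
same. The tile at the end of an arrow then takes the role of the tile at its start. -/
theorem IsTiling.op (H : D.IsTiling σB σW ω θ) :
    D.op.IsTiling σB⁻¹ σW⁻¹ (MulOpposite.op ω) θ where
  idem := H.idem.op
  e_mul_x a := congrArg MulOpposite.op (H.x_mul_e a)
  x_mul_e a := congrArg MulOpposite.op (H.e_mul_x a)
  src_black a := by
    change D.tgt (σB⁻¹ a) = D.src a
    rw [← H.src_black, ← Equiv.Perm.mul_apply, mul_inv_cancel, Equiv.Perm.one_apply]
  src_white a := by
    change D.tgt (σW⁻¹ a) = D.src a
    rw [← H.src_white, ← Equiv.Perm.mul_apply, mul_inv_cancel, Equiv.Perm.one_apply]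
  sameCycle a b hab := by
    change D.tgt a = D.tgt b at hab
    rw [← H.src_white, ← H.src_white] at hab
    have h1 := H.sameCycle _ _ hab
    -- Arrows with a common end are followed by arrows with a common start; conjugating by `σW`
    -- translates between the two descriptions of a tile.
    rw [show σB * σW⁻¹ = σW * (σB⁻¹ * σW)⁻¹ * σW⁻¹ by group, Equiv.Perm.sameCycle_conj,
      Equiv.Perm.sameCycle_inv] at h1
    rw [inv_inv]
    simpa only [← Equiv.Perm.mul_apply, inv_mul_cancel, Equiv.Perm.one_apply] using h1
  wB_eq a := by
    rw [BraneTiling.vertexCycle_inv_tail, ← H.wB_eq]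
    rfl
  wW_eq a := by
    rw [BraneTiling.vertexCycle_inv_tail, ← H.wW_eq]
    rfl
  word_eq a := by
    change D.op.word (D.wB a).reverse = D.op.word (D.wW a).reverse
    rw [op_word_reverse, op_word_reverse, H.word_eq]
  loop_eq a := by
    change MulOpposite.op (D.x a) * D.op.word (D.wB a).reverse =
      MulOpposite.op (D.e (D.tgt a)) * MulOpposite.op ω
    rw [op_word_reverse, ← MulOpposite.op_mul, ← MulOpposite.op_mul, H.black.word_mul_x, H.central]
  central y := by
    refine MulOpposite.unop_injective ?_
    exact (H.central y.unop).symm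
  regular y hy := by
    refine MulOpposite.unop_injective (H.regular _ ?_)
    rw [H.central]
    exact congrArg MulOpposite.unop hy
  separated y hy := by
    refine MulOpposite.unop_injective (H.separated _ fun n => ?_)
    obtain ⟨z, rfl⟩ := hy n
    refine ⟨z.unop, ?_⟩
    rw [MulOpposite.unop_mul, MulOpposite.unop_pow, MulOpposite.unop_op]
    exact (Commute.pow_left (H.central z.unop) n).symm
  degree_black a := by
    change θ a + ((D.wB a).reverse.map θ).sum = 0
    rw [List.map_reverse, List.sum_reverse, H.degree_black]
  degree_white a := by
    change θ a + ((D.wW a).reverse.map θ).sum = 0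
    rw [List.map_reverse, List.sum_reverse, H.degree_white]
  exists_degree_ne_zero i := by
    obtain ⟨l, hl, h⟩ := H.exists_degree_ne_zero i
    exact ⟨l.reverse, hl.reverse, by rwa [List.map_reverse, List.sum_reverse]⟩
  exists_lift B _ _ ε y hε h1 h2 h3 := by
    have hrev : ∀ l : List E, (l.map fun a => MulOpposite.op (y a)).prod =
        MulOpposite.op (l.reverse.map y).prod := by
      intro l
      rw [MulOpposite.op_list_prod, List.map_map, ← List.map_reverse, List.reverse_reverse]
      rfl
    obtain ⟨f, hfe, hfx⟩ := H.exists_lift Bᵐᵒᵖ (fun i => MulOpposite.op (ε i))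
      (fun a => MulOpposite.op (y a)) hε.op
      (fun a => congrArg MulOpposite.op (h2 a)) (fun a => congrArg MulOpposite.op (h1 a))
      (fun a => by rw [hrev, hrev]; exact congrArg MulOpposite.op (h3 a))
    refine ⟨AlgHom.opComm f, fun i => ?_, fun a => ?_⟩
    · exact congrArg MulOpposite.unop (hfe i)
    · exact congrArg MulOpposite.unop (hfx a)
  adjoin_eq_top := by
    have h := congrArg Subalgebra.op H.adjoin_eq_top
    rw [Subalgebra.op_adjoin, Subalgebra.op_top] at h
    rw [← h]
    congr 1
    ext z
    simp only [Set.mem_union, Set.mem_range, Set.mem_preimage]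
    constructor
    · rintro (⟨i, rfl⟩ | ⟨a, rfl⟩)
      · exact Or.inl ⟨i, rfl⟩
      · exact Or.inr ⟨a, rfl⟩
    · rintro (⟨i, hi⟩ | ⟨a, ha⟩)
      · exact Or.inl ⟨i, MulOpposite.unop_injective hi⟩
      · exact Or.inr ⟨a, MulOpposite.unop_injective ha⟩

end ArrowData

/-! ### The algebra of a tiling -/

namespace PathAlgebra

variable {V : Type u} [Quiver.{u} V]

/-- The trivial path at a vertex. -/
abbrev idem (i : V) : PathAlgebra V := ofPath (Quiver.Path.nil : Quiver.Path i i)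

theorem idem_mul_ofPath {i j : V} (p : Quiver.Path i j) : idem i * ofPath p = ofPath p := by
  rw [ofPath_mul_ofPath, Quiver.Path.nil_comp]

theorem ofPath_mul_idem {i j : V} (p : Quiver.Path i j) : ofPath p * idem j = ofPath p := by
  rw [ofPath_mul_ofPath, Quiver.Path.comp_nil]

theorem completeOrthogonalIdempotents [Fintype V] :
    CompleteOrthogonalIdempotents (idem : V → PathAlgebra V) where
  idem i := idem_mul_ofPath _
  ortho _ _ hij := ofPath_mul_ofPath_of_ne _ _ (Ne.symm hij)
  complete := by
    rw [one_def]
    congr 1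
    ext
    simp

/-- The value of a path in an algebra with chosen idempotents and elements for the arrows. -/
def eval {B : Type u} [Mul B] (ε : V → B) (y : ∀ i j : V, (i ⟶ j) → B) :
    {i j : V} → Quiver.Path i j → B
  | i, _, .nil => ε i
  | _, _, .cons q b => eval ε y q * y _ _ b

variable {B : Type u} [Ring B] [Algebra ℂ B] {ε : V → B} {y : ∀ i j : V, (i ⟶ j) → B}

theorem eval_mul_idem (h : ∀ i, ε i * ε i = ε i) (h2 : ∀ i j b, y i j b * ε j = y i j b) {i j : V}
    (p : Quiver.Path i j) : eval ε y p * ε j = eval ε y p := by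
  cases p with
  | nil => rw [eval, h]
  | cons q b => rw [eval, mul_assoc, h2]

theorem idem_mul_eval (h : ∀ i, ε i * ε i = ε i) {i j : V}
    (p : Quiver.Path i j) : ε i * eval ε y p = eval ε y p := by
  induction p with
  | nil => rw [eval, h]
  | cons q b ih => rw [eval, ← mul_assoc, ih]

theorem eval_comp (h : ∀ i, ε i * ε i = ε i) (h2 : ∀ i j b, y i j b * ε j = y i j b) {i j k : V}
    (p : Quiver.Path i j) (q : Quiver.Path j k) :
    eval ε y (p.comp q) = eval ε y p * eval ε y q := by
  induction q with
  | nil => rw [Quiver.Path.comp_nil, eval, eval_mul_idem h h2]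
  | cons q b ih => rw [Quiver.Path.comp_cons, eval, eval, ih, mul_assoc]

/-- The universal property of the path algebra. -/
theorem exists_algHom [Finite V] [Fintype V] (hε : CompleteOrthogonalIdempotents ε)
    (h2 : ∀ i j b, y i j b * ε j = y i j b) :
    ∃ f : PathAlgebra V →ₐ[ℂ] B, ∀ (i j : V) (p : Quiver.Path i j),
      f (ofPath p) = eval ε y p := by
  let L : PathAlgebra V →ₗ[ℂ] B := lift fun p => eval ε y p.2.2
  have hL : ∀ {i j : V} (p : Quiver.Path i j), L (ofPath p) = eval ε y p :=
    fun p => lift_ofPath _ p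
  have h1 : L 1 = 1 := by
    rw [← completeOrthogonalIdempotents.complete, map_sum, ← hε.complete]
    exact Finset.sum_congr rfl fun i _ => (hL _).trans (by rw [eval])
  have hmul : ∀ z w, L (z * w) = L z * L w := by
    have key : ∀ {i j : V} (p : Quiver.Path i j) (w), L (ofPath p * w) = L (ofPath p) * L w := by
      intro i j p w
      have : L ∘ₗ LinearMap.mulLeft ℂ (ofPath p) = LinearMap.mulLeft ℂ (L (ofPath p)) ∘ₗ L := by
        refine hom_ext fun k l q => ?_
        rw [LinearMap.comp_apply, LinearMap.comp_apply, LinearMap.mulLeft_apply,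
          LinearMap.mulLeft_apply, hL, hL]
        by_cases hk : k = j
        · subst hk
          rw [ofPath_mul_ofPath, hL, eval_comp hε.idem h2]
        · rw [ofPath_mul_ofPath_of_ne _ _ hk, map_zero, ← eval_mul_idem hε.idem h2 p,
            ← idem_mul_eval hε.idem q, mul_assoc, ← mul_assoc (ε j), hε.ortho (Ne.symm hk),
            zero_mul, mul_zero]
      exact LinearMap.congr_fun this w
    intro z w
    have : L ∘ₗ LinearMap.mulRight ℂ w = LinearMap.mulRight ℂ (L w) ∘ₗ L :=
      hom_ext fun i j p => key p w
    exact LinearMap.congr_fun this z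
  exact ⟨AlgHom.ofLinearMap L h1 hmul, fun i j p => hL p⟩

end PathAlgebra

/-! ### The cyclic derivatives of the potential, and the presentation of the algebra. -/

namespace BraneTiling

variable {E : Type u} [Finite E] (F : BraneTiling E)

theorem ofPath_toPath {i j : F.Tile} (b : i ⟶ j) : PathAlgebra.ofPath b.toPath = F.X b.1 := by
  obtain ⟨e, rfl, rfl⟩ := b
  rfl

theorem idem_mul_X (e : E) : PathAlgebra.idem (F.t e) * F.X e = F.X e :=
  PathAlgebra.idem_mul_ofPath _

theorem X_mul_idem (e : E) : F.X e * PathAlgebra.idem (F.h e) = F.X e :=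
  PathAlgebra.ofPath_mul_idem _

-- The cycles in the potential are products of variables, while `derivAux` acts on paths. This
-- supplies the path behind a product together with the value of `derivAux` on it, for an arbitrary
-- accumulator `r`.
open Classical in
theorem exists_iterPath {σ : Equiv.Perm E} (hσ : ∀ e, F.t (σ e) = F.h e) (e : E) (n : ℕ) :
    ∃ p : Quiver.Path (F.t e) (F.t ((σ ^ n) e)),
      PathAlgebra.ofPath p = PathAlgebra.idem (F.t e) * iterProd F.X σ e n ∧
      ∀ a r, F.derivAux a p r = ∑ k ∈ Finset.range n, if (σ ^ k) e = a then
        iterProd F.X σ ((σ ^ (k + 1)) e) (n - 1 - k) * r *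
          (PathAlgebra.idem (F.t e) * iterProd F.X σ e k) else 0 := by
  induction n with
  | zero =>
    refine ⟨Quiver.Path.nil, ?_, fun a r => ?_⟩
    · rw [iterProd_zero, mul_one]; rfl
    · rw [Finset.sum_range_zero]
      exact derivAux.eq_1 F a (F.t e) r
  | succ n ih =>
    obtain ⟨p, hp, hd⟩ := ih
    let b : F.t ((σ ^ n) e) ⟶ F.t ((σ ^ (n + 1)) e) :=
      ⟨(σ ^ n) e, rfl, by rw [pow_succ', Equiv.Perm.mul_apply, hσ]⟩
    refine ⟨p.cons b, ?_, fun a r => ?_⟩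
    · have : p.cons b = p.comp b.toPath := rfl
      rw [this, ← PathAlgebra.ofPath_mul_ofPath, ofPath_toPath, hp, iterProd_succ, mul_assoc]
    · have h1 : F.derivAux a (p.cons b) r = (if (σ ^ n) e = a then r * PathAlgebra.ofPath p else 0) +
          F.derivAux a p (PathAlgebra.ofPath b.toPath * r) := by
        rw [derivAux]
      rw [h1, hd, Finset.sum_range_succ, add_comm, hp, ofPath_toPath]
      refine congrArg₂ (· + ·) ?_ ?_
      · refine Finset.sum_congr rfl fun k hk => ?_
        rw [Finset.mem_range] at hk
        have h2 : iterProd F.X σ ((σ ^ (k + 1)) e) (n + 1 - 1 - k) =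
            iterProd F.X σ ((σ ^ (k + 1)) e) (n - 1 - k) * F.X b.1 := by
          rw [show n + 1 - 1 - k = (n - 1 - k) + 1 by omega, iterProd_succ, ← Equiv.Perm.mul_apply,
            ← pow_add, show n - 1 - k + (k + 1) = n by omega]
        rw [h2]
        simp only [mul_assoc]
      · rw [Nat.add_sub_cancel, Nat.sub_self, iterProd_zero, one_mul]

theorem wordElem_vertexCycle (σ : Equiv.Perm E) (e : E) :
    F.wordElem (vertexCycle σ e) = iterProd F.X σ e (Function.minimalPeriod σ e) :=
  map_range_prod F.X σ e _

theorem wordElem_vertexCycle_tail (σ : Equiv.Perm E) (e : E) :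
    F.wordElem (vertexCycle σ e).tail =
      iterProd F.X σ (σ e) (Function.minimalPeriod σ e - 1) := by
  rw [vertexCycle_tail, wordElem, map_range_prod]

-- Up to the minimal period the iterates are distinct, so `a` occurs at most once in the cycle, and
-- deleting it after rotation leaves its broken loop.
open Classical in
theorem cyclicDeriv_vertexCycle {σ : Equiv.Perm E} (hσ : ∀ e, F.t (σ e) = F.h e)
    (h3 : ∀ e, 3 ≤ Function.minimalPeriod σ e) (a e : E) :
    F.cyclicDeriv a (F.wordElem (vertexCycle σ e)) =
      if σ.SameCycle e a then F.wordElem (vertexCycle σ a).tail else 0 := by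
  have hl : ∀ e n, PathAlgebra.idem (F.t e) * iterProd F.X σ e (n + 1) =
      iterProd F.X σ e (n + 1) := fun e n => by
    rw [iterProd_succ', ← mul_assoc, idem_mul_X]
  have hr : ∀ e n, iterProd F.X σ e (n + 1) * PathAlgebra.idem (F.t ((σ ^ (n + 1)) e)) =
      iterProd F.X σ e (n + 1) := fun e n => by
    rw [iterProd_succ, mul_assoc, pow_succ', Equiv.Perm.mul_apply, hσ, X_mul_idem]
  have hii : ∀ i : F.Tile, PathAlgebra.idem i * PathAlgebra.idem i = PathAlgebra.idem i :=
    fun i => PathAlgebra.idem_mul_ofPath _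
  set d := Function.minimalPeriod σ e with hd
  have hd3 : 3 ≤ d := h3 e
  obtain ⟨p, hp, hder⟩ := F.exists_iterPath hσ e d
  have hpe : (σ ^ d) e = e := σ.pow_minimalPeriod_apply e
  have h1 : F.wordElem (vertexCycle σ e) = PathAlgebra.ofPath p := by
    rw [hp, wordElem_vertexCycle, ← hd, show d = d - 1 + 1 by omega, hl]
  have h2 : F.cyclicDeriv a (PathAlgebra.ofPath p) =
      F.derivAux a p (PathAlgebra.idem (F.t ((σ ^ d) e))) :=
    PathAlgebra.lift_ofPath _ p
  have key : ∀ k < d, (σ ^ k) e = a →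
      iterProd F.X σ ((σ ^ (k + 1)) e) (d - 1 - k) * PathAlgebra.idem (F.t e) *
        (PathAlgebra.idem (F.t e) * iterProd F.X σ e k) = F.wordElem (vertexCycle σ a).tail := by
    rintro k hk rfl
    have e1 : (σ ^ (d - 1 - k)) ((σ ^ (k + 1)) e) = e := by
      rw [← Equiv.Perm.mul_apply, ← pow_add, show d - 1 - k + (k + 1) = d by omega, hpe]
    have e2 : iterProd F.X σ ((σ ^ (k + 1)) e) (d - 1 - k) * iterProd F.X σ e k =
        F.wordElem (vertexCycle σ ((σ ^ k) e)).tail := by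
      have := iterProd_add F.X σ ((σ ^ (k + 1)) e) (d - 1 - k) k
      rw [e1, show d - 1 - k + k = d - 1 by omega] at this
      rw [← this, wordElem_vertexCycle_tail, σ.minimalPeriod_pow_apply, ← Equiv.Perm.mul_apply,
        ← pow_succ']
    rw [mul_assoc, ← mul_assoc (PathAlgebra.idem _), hii]
    cases k with
    | zero =>
      have := hr ((σ ^ (0 + 1)) e) (d - 2)
      rw [show d - 2 + 1 = d - 1 - 0 by omega, e1] at this
      rw [← mul_assoc, this, e2]
    | succ k => rw [hl, e2]
  rw [h1, h2, hder, hpe]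
  split_ifs with h
  · obtain ⟨k, hk, hka⟩ : ∃ k < d, (σ ^ k) e = a := by
      obtain ⟨m, rfl⟩ : ∃ m : ℕ, (σ ^ m) e = a := h.exists_nat_pow_eq
      refine ⟨m % d, Nat.mod_lt _ (by omega), ?_⟩
      rw [Equiv.Perm.coe_pow, Equiv.Perm.coe_pow, hd, Function.iterate_mod_minimalPeriod_eq]
    rw [Finset.sum_eq_single k]
    · rw [if_pos hka, key k hk hka]
    · intro m hm hmk
      refine if_neg fun hma => hmk ?_
      rw [← hka, Equiv.Perm.coe_pow, Equiv.Perm.coe_pow] at hma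
      exact (Function.iterate_eq_iterate_iff_of_lt_minimalPeriod (Finset.mem_range.1 hm) hk).1 hma
    · exact fun hk' => absurd (Finset.mem_range.2 hk) hk'
  · exact Finset.sum_eq_zero fun k _ => if_neg fun hk => h ⟨k, by rw [zpow_natCast, hk]⟩

theorem cyclicDeriv_sum {σ : Equiv.Perm E} (hσ : ∀ e, F.t (σ e) = F.h e)
    (h3 : ∀ e, 3 ≤ Function.minimalPeriod σ e) (a : E) :
    F.cyclicDeriv a (∑ᶠ v : Quotient (Equiv.Perm.SameCycle.setoid σ),
      F.wordElem (vertexCycle σ (Quotient.out v))) = F.wordElem (vertexCycle σ a).tail := by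
  classical
  have := Fintype.ofFinite (Quotient (Equiv.Perm.SameCycle.setoid σ))
  rw [finsum_eq_sum_of_fintype, map_sum, Finset.sum_eq_single (Quotient.mk _ a)]
  · rw [cyclicDeriv_vertexCycle F hσ h3, if_pos]
    exact Quotient.mk_out (s := Equiv.Perm.SameCycle.setoid σ) a
  · intro v _ hv
    rw [cyclicDeriv_vertexCycle F hσ h3, if_neg]
    intro h
    exact hv ((Quotient.out_eq v).symm.trans
      (Quotient.sound (s := Equiv.Perm.SameCycle.setoid σ) h))
  · simp

theorem cyclicDeriv_potential (a : E) :
    F.cyclicDeriv a F.potential = F.wordElem (F.brokenB a) - F.wordElem (F.brokenW a) := by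
  rw [potential, map_sub]
  congr 1
  · exact F.cyclicDeriv_sum (fun _ => rfl) F.three_le_black a
  · exact F.cyclicDeriv_sum (fun e => (F.h_eq_t_white e).symm) F.three_le_white a

theorem data_word (l : List E) : F.data.word l = F.toAlg (F.wordElem l) := by
  rw [ArrowData.word, wordElem, map_list_prod, List.map_map]
  rfl

theorem word_brokenB_eq (a : E) : F.data.word (F.brokenB a) = F.data.word (F.brokenW a) := by
  rw [data_word, data_word, ← sub_eq_zero, ← map_sub, ← cyclicDeriv_potential]
  have h := RingQuot.mkAlgHom_rel ℂ
    (s := fun x y : PathAlgebra F.Tile => ∃ a : E, x = F.cyclicDeriv a F.potential ∧ y = 0)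
    ⟨a, rfl, rfl⟩
  rw [map_zero] at h
  exact h

theorem data_idem [Fintype F.Tile] : CompleteOrthogonalIdempotents F.data.e :=
  PathAlgebra.completeOrthogonalIdempotents.map F.toAlg.toRingHom

theorem data_e_mul_x (a : E) : F.data.e (F.t a) * F.data.x a = F.data.x a := by
  have := congrArg F.toAlg (F.idem_mul_X a)
  rwa [map_mul] at this

theorem data_x_mul_e (a : E) : F.data.x a * F.data.e (F.h a) = F.data.x a := by
  have := congrArg F.toAlg (F.X_mul_idem a)
  rwa [map_mul] at this

theorem data_exists_lift [Fintype F.Tile] (B : Type u) [Ring B] [Algebra ℂ B] (ε : F.Tile → B)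
    (y : E → B) (hε : CompleteOrthogonalIdempotents ε) (h1 : ∀ a, ε (F.t a) * y a = y a)
    (h2 : ∀ a, y a * ε (F.h a) = y a)
    (h3 : ∀ a, ((F.brokenB a).map y).prod = ((F.brokenW a).map y).prod) :
    ∃ f : F.Alg →ₐ[ℂ] B, (∀ i, f (F.data.e i) = ε i) ∧ ∀ a, f (F.data.x a) = y a := by
  obtain ⟨f, hf⟩ := PathAlgebra.exists_algHom (V := F.Tile) (ε := ε) (y := fun i j (b : i ⟶ j) => y b.1) hε
    (by rintro _ _ ⟨e, rfl, rfl⟩; exact h2 e)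
  have hX : ∀ e, f (F.X e) = y e := fun e => (hf _ _ _).trans (by
    rw [Quiver.Hom.toPath, PathAlgebra.eval, PathAlgebra.eval]
    exact h1 e)
  have hw : ∀ l, f (F.wordElem l) = (l.map y).prod := fun l => by
    rw [wordElem, map_list_prod, List.map_map]
    congr 2
    funext e
    exact hX e
  have hrel : ∀ ⦃z w : PathAlgebra F.Tile⦄,
      (∃ a : E, z = F.cyclicDeriv a F.potential ∧ w = 0) → f z = f w := by
    rintro _ _ ⟨a, rfl, rfl⟩
    rw [cyclicDeriv_potential, map_sub, hw, hw, h3, sub_self, map_zero]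
  refine ⟨RingQuot.liftAlgHom ℂ ⟨f, hrel⟩, fun i => ?_, fun a => ?_⟩
  · exact (RingQuot.liftAlgHom_mkAlgHom_apply ℂ f hrel _).trans
      ((hf _ _ _).trans (by rw [PathAlgebra.eval]))
  · exact (RingQuot.liftAlgHom_mkAlgHom_apply ℂ f hrel _).trans (hX a)

theorem data_adjoin : Algebra.adjoin ℂ (Set.range F.data.e ∪ Set.range F.data.x) = ⊤ := by
  rw [eq_top_iff]
  rintro z -
  obtain ⟨z, rfl⟩ := RingQuot.mkAlgHom_surjective ℂ _ z
  change F.toAlg z ∈ _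
  have hpath : ∀ {i j : F.Tile} (p : Quiver.Path i j),
      F.cls p ∈ Algebra.adjoin ℂ (Set.range F.data.e ∪ Set.range F.data.x) := by
    intro i j p
    induction p with
    | nil => exact Algebra.subset_adjoin (Or.inl ⟨i, rfl⟩)
    | cons q b ih =>
      have : F.cls (q.cons b) = F.cls q * F.data.x b.1 := by
        have h : q.cons b = q.comp b.toPath := rfl
        rw [cls, h, ← PathAlgebra.ofPath_mul_ofPath, map_mul, ofPath_toPath]
        rfl
      rw [this]
      exact mul_mem ih (Algebra.subset_adjoin (Or.inr ⟨_, rfl⟩))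
  let S := (Subalgebra.toSubmodule
    (Algebra.adjoin ℂ (Set.range F.data.e ∪ Set.range F.data.x))).mkQ ∘ₗ F.toAlg.toLinearMap
  have hS : S = 0 := PathAlgebra.hom_ext fun i j p => by
    rw [LinearMap.comp_apply, Submodule.mkQ_apply]
    exact (Submodule.Quotient.mk_eq_zero _).2 (hpath p)
  have := LinearMap.congr_fun hS z
  rw [LinearMap.comp_apply, Submodule.mkQ_apply, LinearMap.zero_apply,
    Submodule.Quotient.mk_eq_zero] at this
  exact this

end BraneTiling

/-! ### Linear independence of the classes of paths. -/

namespace ArrowData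

variable {V E A : Type u} [Ring A] [Algebra ℂ A] (D : ArrowData V E A)

/-- The triples consisting of the ends of a path and its class. -/
def pathClasses : Set (V × V × A) :=
  {m | ∃ l, D.IsPath m.1 l m.2.1 ∧ m.2.2 = D.e m.1 * D.word l}

variable {D}

theorem IsPath.eq_of_nil {i j : V} (h : D.IsPath i [] j) : i = j := by
  cases h
  rfl

theorem prod_map_mul_of_isPath {B : Type*} [Monoid B] {y : E → B} {ε : V → B}
    (h : ∀ a, y a * ε (D.tgt a) = y a) {i j : V} {l : List E} (hl : D.IsPath i l j) (hne : l ≠ []) :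
    (l.map y).prod * ε j = (l.map y).prod := by
  induction hl with
  | nil => exact absurd rfl hne
  | @cons a l j hl ih =>
    rw [List.map_cons, List.prod_cons]
    cases l with
    | nil => rw [List.map_nil, List.prod_nil, mul_one, ← hl.eq_of_nil, h]
    | cons => rw [mul_assoc, ih (List.cons_ne_nil _ _)]

open Classical in
/-- `A` embeds in the space with basis the classes of paths. -/
theorem exists_basis_embedding [Fintype V] (hidem : CompleteOrthogonalIdempotents D.e)
    (h1 : ∀ a, D.e (D.src a) * D.x a = D.x a) (h2 : ∀ a, D.x a * D.e (D.tgt a) = D.x a)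
    (hB : ∀ a, D.IsPath (D.tgt a) (D.wB a) (D.src a)) (hB' : ∀ a, D.wB a ≠ [])
    (hW : ∀ a, D.IsPath (D.tgt a) (D.wW a) (D.src a)) (hW' : ∀ a, D.wW a ≠ [])
    (hw : ∀ a, D.word (D.wB a) = D.word (D.wW a))
    (hlift : ∀ (B : Type u) [Ring B] [Algebra ℂ B] (ε : V → B) (y : E → B),
      CompleteOrthogonalIdempotents ε → (∀ a, ε (D.src a) * y a = y a) →
      (∀ a, y a * ε (D.tgt a) = y a) →
      (∀ a, ((D.wB a).map y).prod = ((D.wW a).map y).prod) →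
      ∃ f : A →ₐ[ℂ] B, (∀ i, f (D.e i) = ε i) ∧ ∀ a, f (D.x a) = y a)
    (hadj : Algebra.adjoin ℂ (Set.range D.e ∪ Set.range D.x) = ⊤)
    {ω : A} (hω : ∀ i, ∃ l, D.IsPath i l i ∧ D.e i * ω = D.e i * D.word l) :
    ∃ Θ : A →ₗ[ℂ] (V × V × A →₀ ℂ), Function.Injective Θ ∧
      (∀ z, Θ z ∈ Finsupp.supported ℂ ℂ D.pathClasses) ∧
      ∀ z, Θ (z * ω) = Finsupp.mapDomain (fun m => (m.1, m.2.1, m.2.2 * ω)) (Θ z) := by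
  let M := V × V × A →₀ ℂ
  -- On the span of all triples (start, end, element) let an arrow prepend itself to a triple that
  -- starts at its end, and kill the others. The relations hold because the third entry lives in
  -- `A`.
  let ε : V → Module.End ℂ M := fun i =>
    Finsupp.linearCombination ℂ fun m => if m.1 = i then Finsupp.single m 1 else 0
  let y : E → Module.End ℂ M := fun a => Finsupp.linearCombination ℂ fun m =>
    if m.1 = D.tgt a then Finsupp.single (D.src a, m.2.1, D.x a * m.2.2) 1 else 0
  have hε : ∀ i m, ε i (Finsupp.single m 1) = if m.1 = i then Finsupp.single m 1 else 0 :=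
    fun i m => (Finsupp.linearCombination_single ℂ 1 m).trans (one_smul _ _)
  have hy : ∀ a m, y a (Finsupp.single m 1) =
      if m.1 = D.tgt a then Finsupp.single (D.src a, m.2.1, D.x a * m.2.2) 1 else 0 :=
    fun a m => (Finsupp.linearCombination_single ℂ 1 m).trans (one_smul _ _)
  have ext : ∀ {f g : Module.End ℂ M},
      (∀ m, f (Finsupp.single m 1) = g (Finsupp.single m 1)) → f = g := fun h =>
    Finsupp.lhom_ext' fun m => LinearMap.ext_ring (h m)
  have hεi : CompleteOrthogonalIdempotents ε :=
    { idem := fun i => ext fun m => by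
        rw [Module.End.mul_apply, hε]
        split_ifs with h
        · rw [hε, if_pos h]
        · rw [map_zero]
      ortho := fun i j hij => ext fun m => by
        rw [Module.End.mul_apply, hε]
        split_ifs with h
        · rw [hε, if_neg (fun h' => hij (h'.symm.trans h))]
          rfl
        · rw [map_zero]
          rfl
      complete := ext fun m => by
        rw [LinearMap.sum_apply, Finset.sum_eq_single m.1]
        · rw [hε, if_pos rfl]
          rfl
        · intro i _ hi
          rw [hε, if_neg (Ne.symm hi)]
        · simp }
  have hεy : ∀ a, ε (D.src a) * y a = y a := fun a => ext fun m => by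
    rw [Module.End.mul_apply, hy]
    split_ifs with h
    · rw [hε, if_pos rfl]
    · rw [map_zero]
  have hyε : ∀ a, y a * ε (D.tgt a) = y a := fun a => ext fun m => by
    rw [Module.End.mul_apply, hε, hy]
    split_ifs with h
    · rw [hy, if_pos h]
    · rw [map_zero]
  have hword : ∀ {i j : V} {l : List E}, D.IsPath i l j → ∀ (k : V) (z : A),
      (l.map y).prod (Finsupp.single (j, k, z) 1) = Finsupp.single (i, k, D.word l * z) 1 := by
    intro i j l hl k z
    induction hl with
    | nil => simp [word]
    | @cons a l j _ ih =>
      rw [List.map_cons, List.prod_cons, Module.End.mul_apply, ih, hy, if_pos rfl, word_cons,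
        mul_assoc]
  obtain ⟨f, hfe, hfx⟩ := hlift (Module.End ℂ M) ε y hεi hεy hyε fun a => ext fun m => by
    -- As the broken loops are non-empty, both sides vanish on triples that do not start at `D.src
    -- a`.
    rw [← prod_map_mul_of_isPath hyε (hB a) (hB' a), ← prod_map_mul_of_isPath hyε (hW a) (hW' a),
      Module.End.mul_apply, Module.End.mul_apply, hε]
    split_ifs with h
    · obtain ⟨j, k, z⟩ := m
      obtain rfl : j = D.src a := h
      rw [hword (hB a), hword (hW a), hw]
    · rw [map_zero, map_zero]
  -- Acting on the sum of the trivial paths sends the class of a path to its own basis vector.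
  let u₀ : M := ∑ j, Finsupp.single (j, j, D.e j) 1
  let Θ : A →ₗ[ℂ] M := LinearMap.applyₗ u₀ ∘ₗ f.toLinearMap
  have hΘ1 : Θ 1 = u₀ := by
    change f 1 u₀ = u₀
    rw [map_one]
    rfl
  have hΘe : ∀ i z, Θ (D.e i * z) = ε i (Θ z) := fun i z => by
    change f (D.e i * z) u₀ = ε i (f z u₀)
    rw [map_mul, hfe, Module.End.mul_apply]
  have hΘx : ∀ a z, Θ (D.x a * z) = y a (Θ z) := fun i z => by
    change f (D.x i * z) u₀ = y i (f z u₀)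
    rw [map_mul, hfx, Module.End.mul_apply]
  have hΘpath : ∀ {i j : V} {l : List E}, D.IsPath i l j →
      Θ (D.e i * D.word l) = Finsupp.single (i, j, D.e i * D.word l) 1 := by
    intro i j l hl
    induction hl with
    | nil i =>
      rw [word_nil, hΘe, hΘ1, mul_one, map_sum, Finset.sum_eq_single i]
      · rw [hε, if_pos rfl]
      · intro j _ hj
        rw [hε, if_neg hj]
      · simp
    | @cons a l j _ ih =>
      have e1 : D.e (D.src a) * D.word (a :: l) = D.x a * (D.e (D.tgt a) * D.word l) := by
        rw [word_cons, ← mul_assoc, ← mul_assoc, h1, h2]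
      rw [e1, hΘx, ih, hy, if_pos rfl]
  -- Forgetting the ends is a left inverse of `Θ`, which gives injectivity.
  let ev : M →ₗ[ℂ] A := Finsupp.linearCombination ℂ fun m => D.e m.1 * m.2.2
  have hev : ∀ m, ev (Finsupp.single m 1) = D.e m.1 * m.2.2 := fun m =>
    (Finsupp.linearCombination_single ℂ 1 m).trans (one_smul _ _)
  have hevε : ∀ i w, ev (ε i w) = D.e i * ev w := by
    intro i w
    have : ev ∘ₗ ε i = LinearMap.mulLeft ℂ (D.e i) ∘ₗ ev :=
      Finsupp.lhom_ext' fun m => LinearMap.ext_ring (by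
        change ev (ε i (Finsupp.single m 1)) = D.e i * ev (Finsupp.single m 1)
        rw [hε, hev, ← mul_assoc]
        split_ifs with h
        · rw [hev, h, hidem.idem]
        · rw [map_zero, hidem.ortho (Ne.symm h), zero_mul])
    exact LinearMap.congr_fun this w
  have hevy : ∀ a w, ev (y a w) = D.x a * ev w := by
    intro a w
    have : ev ∘ₗ y a = LinearMap.mulLeft ℂ (D.x a) ∘ₗ ev :=
      Finsupp.lhom_ext' fun m => LinearMap.ext_ring (by
        change ev (y a (Finsupp.single m 1)) = D.x a * ev (Finsupp.single m 1)
        rw [hy, hev, ← mul_assoc]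
        split_ifs with h
        · rw [hev, h, ← mul_assoc, h1, h2]
        · rw [map_zero, ← h2, mul_assoc (D.x a), hidem.ortho (Ne.symm h), mul_zero, zero_mul])
    exact LinearMap.congr_fun this w
  have hevΘ : ∀ z, ev (Θ z) = z := by
    intro z
    have hmem : ∀ z, z ∈ LinearMap.ker (ev ∘ₗ Θ - LinearMap.id) ↔ ev (Θ z) = z := fun z => by
      rw [LinearMap.mem_ker, LinearMap.sub_apply, sub_eq_zero]
      rfl
    refine (hmem z).1 (mem_of_mul_mem hadj _ ?_ ?_ ?_ z)
    · rw [hmem, hΘ1, map_sum, ← hidem.complete]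
      exact Finset.sum_congr rfl fun j _ => by rw [hev, hidem.idem]
    · intro i z hz
      rw [hmem] at hz ⊢
      rw [hΘe, hevε, hz]
    · intro a z hz
      rw [hmem] at hz ⊢
      rw [hΘx, hevy, hz]
  refine ⟨Θ, fun z w h => by rw [← hevΘ z, h, hevΘ], fun z => ?_, fun z => ?_⟩
  · have hmap : ∀ g : Module.End ℂ M, (∀ m ∈ D.pathClasses,
        g (Finsupp.single m 1) ∈ Finsupp.supported ℂ ℂ D.pathClasses) →
        ∀ w ∈ Finsupp.supported ℂ ℂ D.pathClasses, g w ∈ Finsupp.supported ℂ ℂ D.pathClasses := by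
      intro g hg w hw
      rw [Finsupp.supported_eq_span_single] at hw
      induction hw using Submodule.span_induction with
      | mem w hw =>
        obtain ⟨m, hm, rfl⟩ := hw
        exact hg m hm
      | zero => rw [map_zero]; exact Submodule.zero_mem _
      | add w w' _ _ h h' => rw [map_add]; exact Submodule.add_mem _ h h'
      | smul c w _ h => rw [map_smul]; exact Submodule.smul_mem _ c h
    refine mem_of_mul_mem hadj ((Finsupp.supported ℂ ℂ D.pathClasses).comap Θ) ?_ ?_ ?_ z
    · rw [Submodule.mem_comap, hΘ1]
      exact Submodule.sum_mem _ fun j _ => Finsupp.single_mem_supported ℂ 1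
        ⟨[], IsPath.nil j, (mul_one _).symm⟩
    · intro i z hz
      rw [Submodule.mem_comap] at hz ⊢
      rw [hΘe]
      refine hmap _ (fun m hm => ?_) _ hz
      rw [hε]
      split_ifs
      · exact Finsupp.single_mem_supported ℂ 1 hm
      · exact Submodule.zero_mem _
    · intro a z hz
      rw [Submodule.mem_comap] at hz ⊢
      rw [hΘx]
      refine hmap _ (fun m hm => ?_) _ hz
      rw [hy]
      split_ifs with h
      · refine Finsupp.single_mem_supported ℂ 1 ?_
        obtain ⟨j, k, z⟩ := m
        obtain rfl : j = D.tgt a := h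
        obtain ⟨l, hl, rfl⟩ : ∃ l, D.IsPath (D.tgt a) l k ∧ z = D.e (D.tgt a) * D.word l := hm
        exact ⟨a :: l, .cons hl, by
          change D.x a * (D.e (D.tgt a) * D.word l) = D.e (D.src a) * D.word (a :: l)
          rw [word_cons, ← mul_assoc, ← mul_assoc, h1, h2]⟩
      · exact Submodule.zero_mem _
  · let R : M →ₗ[ℂ] M := Finsupp.lmapDomain ℂ ℂ fun m => (m.1, m.2.1, m.2.2 * ω)
    have hR : ∀ m, R (Finsupp.single m 1) = Finsupp.single (m.1, m.2.1, m.2.2 * ω) 1 :=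
      fun m => Finsupp.mapDomain_single
    have hRε : ∀ i w, R (ε i w) = ε i (R w) := fun i w => by
      have : R ∘ₗ ε i = ε i ∘ₗ R := ext fun m => by
        rw [LinearMap.comp_apply, LinearMap.comp_apply, hε, hR, hε]
        split_ifs
        · rw [hR]
        · rw [map_zero]
      exact LinearMap.congr_fun this w
    have hRy : ∀ a w, R (y a w) = y a (R w) := fun a w => by
      have : R ∘ₗ y a = y a ∘ₗ R := ext fun m => by
        rw [LinearMap.comp_apply, LinearMap.comp_apply, hy, hR, hy]
        split_ifs
        · rw [hR, mul_assoc]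
        · rw [map_zero]
      exact LinearMap.congr_fun this w
    change Θ (z * ω) = R (Θ z)
    have hmem : ∀ z, z ∈ LinearMap.ker (Θ ∘ₗ LinearMap.mulRight ℂ ω - R ∘ₗ Θ) ↔
        Θ (z * ω) = R (Θ z) := fun z => by
      rw [LinearMap.mem_ker, LinearMap.sub_apply, sub_eq_zero]
      rfl
    refine (hmem z).1 (mem_of_mul_mem hadj _ ?_ ?_ ?_ z)
    · rw [hmem, hΘ1, ← hidem.complete, Finset.sum_mul, map_sum, map_sum]
      refine Finset.sum_congr rfl fun i _ => ?_
      obtain ⟨l, hl, h⟩ := hω i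
      rw [hR, h, hΘpath hl]
    · intro i z hz
      rw [hmem] at hz ⊢
      rw [mul_assoc, hΘe, hΘe, hz, hRε]
    · intro a z hz
      rw [hmem] at hz ⊢
      rw [mul_assoc, hΘx, hΘx, hz, hRy]

end ArrowData

/-! ### Regularity of `ω`, and vanishing of the intersection of the ideals generated by its powers.
-/

namespace ArrowData

variable {V E A : Type u} [Ring A] [Algebra ℂ A] {D : ArrowData V E A}

/-- If cancellation of `ω` holds for classes of paths, then `ω` is regular in `A`. -/
theorem eq_zero_of_mul_eq_zero {ω : A} {Θ : A →ₗ[ℂ] (V × V × A →₀ ℂ)}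
    (hinj : Function.Injective Θ) (hsupp : ∀ z, Θ z ∈ Finsupp.supported ℂ ℂ D.pathClasses)
    (hmul : ∀ z, Θ (z * ω) = Finsupp.mapDomain (fun m => (m.1, m.2.1, m.2.2 * ω)) (Θ z))
    (hcancel : ∀ {i i' j : V} {l l' : List E}, D.IsPath i l j → D.IsPath i' l' j →
      D.e i * D.word l * ω = D.e i' * D.word l' * ω → D.e i * D.word l = D.e i' * D.word l')
    {z : A} (hz : z * ω = 0) : z = 0 := by
  refine hinj ?_
  have h := hmul z
  rw [hz, map_zero] at h
  rw [map_zero]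
  -- In the basis of path classes, multiplication by `ω` maps basis vectors to basis vectors, and
  -- cancellation says that it is injective on them.
  refine Finsupp.mapDomain_injOn D.pathClasses (f := fun m => (m.1, m.2.1, m.2.2 * ω)) ?_
    (hsupp z) (Submodule.zero_mem (Finsupp.supported ℂ ℂ D.pathClasses))
    (h.symm.trans Finsupp.mapDomain_zero.symm)
  rintro ⟨i, j, x⟩ ⟨l, hl, hx⟩ ⟨i', j', x'⟩ ⟨l', hl', hx'⟩ heq
  simp only [Prod.mk.injEq] at heq hl hl' hx hx' ⊢
  obtain ⟨rfl, rfl, heq⟩ := heq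
  rw [hx, hx'] at heq
  exact ⟨rfl, rfl, by rw [hx, hx', hcancel hl hl' heq]⟩

theorem exists_mul_word_eq {ω : A} (h1 : ∀ a, D.e (D.src a) * D.x a = D.x a)
    (h2 : ∀ a, D.x a * D.e (D.tgt a) = D.x a) (hi : ∀ i, D.e i * D.e i = D.e i)
    (hω : ∀ y, ω * y = y * ω) (hw : ∀ a, D.word (D.wB a) * D.x a = D.e (D.tgt a) * ω)
    {i j : V} {l : List E} (hl : D.IsPath i l j) :
    ∃ (y : A) (n : ℕ), y * D.word l = D.e j * ω ^ n := by
  induction hl with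
  | nil i => exact ⟨D.e i, 0, by simp [word]⟩
  | @cons a l j hl ih =>
    obtain ⟨y, n, h⟩ := ih
    refine ⟨y * D.word (D.wB a), n + 1, ?_⟩
    calc y * D.word (D.wB a) * D.word (a :: l)
        = y * (D.word (D.wB a) * D.x a) * D.word l := by rw [word_cons]; simp only [mul_assoc]
      _ = y * (D.e (D.tgt a) * D.word l) * ω := by
          rw [hw, mul_assoc y, mul_assoc (D.e _), hω (D.word l), ← mul_assoc (D.e _), ← mul_assoc y]
      _ = D.e j * ω ^ (n + 1) := by
          have hc : ω ^ n * D.e j = D.e j * ω ^ n := Commute.pow_left (hω (D.e j)) n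
          rw [hl.e_mul_word h1 h2, ← mul_assoc, h, mul_assoc (D.e j), hc, ← mul_assoc, hi,
            mul_assoc, ← pow_succ]

/-- If `y ≠ 0`, every path class occurring in `y` is divisible by all powers of `ω`. But such a
class can be completed on the left to `eⱼ ωᵏ`; its divisibility by `ω ^ (k + 1)` would make `eⱼ`
divisible by `ω` after cancelling. -/
theorem eq_zero_of_forall_exists_pow_mul {ω : A} {Θ : A →ₗ[ℂ] (V × V × A →₀ ℂ)}
    (hinj : Function.Injective Θ) (hsupp : ∀ z, Θ z ∈ Finsupp.supported ℂ ℂ D.pathClasses)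
    (hmul : ∀ z, Θ (z * ω) = Finsupp.mapDomain (fun m => (m.1, m.2.1, m.2.2 * ω)) (Θ z))
    (h1 : ∀ a, D.e (D.src a) * D.x a = D.x a)
    (h2 : ∀ a, D.x a * D.e (D.tgt a) = D.x a) (hi : ∀ i, D.e i * D.e i = D.e i)
    (hω : ∀ y, ω * y = y * ω) (hw : ∀ a, D.word (D.wB a) * D.x a = D.e (D.tgt a) * ω)
    (hreg : ∀ y, ω * y = 0 → y = 0) (hne : ∀ i y, D.e i ≠ ω * y) {y : A}
    (hy : ∀ n : ℕ, ∃ z, y = ω ^ n * z) : y = 0 := by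
  by_contra hy0
  have hΘ : Θ y ≠ 0 := fun h => hy0 (hinj (h.trans (map_zero _).symm))
  obtain ⟨m, hm⟩ := Finsupp.support_nonempty_iff.2 hΘ
  obtain ⟨l, hl, hml⟩ := hsupp y hm
  obtain ⟨w, k, hk⟩ := exists_mul_word_eq h1 h2 hi hω hw hl
  have hpow : ∀ n : ℕ, ∀ z, ∀ m ∈ (Θ (z * ω ^ n)).support, ∃ v : A, m.2.2 = v * ω ^ n := by
    intro n
    induction n with
    | zero => exact fun z m _ => ⟨m.2.2, by simp⟩
    | succ n ih =>
      intro z m hm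
      rw [pow_succ, ← mul_assoc, hmul] at hm
      classical
      obtain ⟨m', hm', rfl⟩ := Finset.mem_image.1 (Finsupp.mapDomain_support hm)
      obtain ⟨v, hv⟩ := ih z m' hm'
      exact ⟨v, by rw [hv, pow_succ, mul_assoc]⟩
  obtain ⟨z, hz⟩ := hy (k + 1)
  rw [(Commute.pow_left (hω z) (k + 1) : Commute (ω ^ (k + 1)) z).eq] at hz
  obtain ⟨v, hv⟩ := hpow (k + 1) z m (hz ▸ hm)
  have hregn : ∀ n : ℕ, ∀ u, ω ^ n * u = 0 → u = 0 := by
    intro n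
    induction n with
    | zero => intro u hu; simpa using hu
    | succ n ih =>
      intro u hu
      rw [pow_succ, mul_assoc] at hu
      exact hreg _ (ih _ hu)
  refine hne m.2.1 (w * v) (sub_eq_zero.1 (hregn k _ ?_))
  have hc : ∀ u, ω ^ k * u = u * ω ^ k := fun u => Commute.pow_left (hω u) k
  have e1 : w * m.2.2 = D.e m.2.1 * ω ^ k := by
    rw [hml, hl.e_mul_word h1 h2, ← mul_assoc, hk, mul_assoc, hc, ← mul_assoc, hi]
  rw [mul_sub, hc, ← e1, hv, hω, hc, pow_succ', mul_assoc, mul_assoc, sub_self]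

end ArrowData

/-! ### The central element given by the simple loops, and the use of consistency. -/

namespace BraneTiling

variable {E : Type u} [Finite E] (F : BraneTiling E)

/-- The class of the simple loop that starts with the arrow `a`. -/
theorem x_mul_word_brokenB (a : E) :
    F.data.x a * F.data.word (F.brokenB a) =
      iterProd F.data.x F.σB a (Function.minimalPeriod F.σB a) := by
  rw [brokenB, vertexCycle_tail, ArrowData.word, map_range_prod, ← iterProd_succ',
    Nat.sub_add_cancel (F.σB.minimalPeriod_pos a)]

theorem word_mul_x_eq (σ : Equiv.Perm E) (a : E) :
    F.data.word (vertexCycle σ a).tail * F.data.x a =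
      F.data.x (σ a) * F.data.word (vertexCycle σ (σ a)).tail := by
  have h := σ.minimalPeriod_pos a
  rw [vertexCycle_tail, vertexCycle_tail, ArrowData.word, ArrowData.word, map_range_prod,
    map_range_prod, ← iterProd_succ', σ.minimalPeriod_apply', iterProd_succ]
  have : (σ ^ (Function.minimalPeriod σ a - 1)) (σ a) = a := by
    rw [← Equiv.Perm.mul_apply, ← pow_succ, Nat.sub_add_cancel h, σ.pow_minimalPeriod_apply]
  rw [this]

theorem simpleLoop_eq (a : E) : F.simpleLoop a = F.data.x a * F.data.word (F.brokenB a) := by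
  rw [x_mul_word_brokenB, simpleLoop, ← data_word, vertexCycle, ArrowData.word, map_range_prod]

/-- Going around a tile, neighbouring corners share an arrow. Its two broken loops have equal
classes, so the simple loops around its black and its white vertex agree. -/
theorem simpleLoop_eq_of_t_eq {a b : E} (h : F.t a = F.t b) : F.simpleLoop a = F.simpleLoop b := by
  refine Equiv.Perm.SameCycle.apply_eq (σ := F.σB * F.σW⁻¹) (fun c => ?_) (Quotient.exact h)
  have h1 := F.word_mul_x_eq F.σB (F.σW⁻¹ c)
  have h2 := F.word_mul_x_eq F.σW (F.σW⁻¹ c)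
  rw [← Equiv.Perm.mul_apply F.σW, mul_inv_cancel, Equiv.Perm.one_apply] at h2
  rw [← Equiv.Perm.mul_apply F.σB] at h1
  rw [simpleLoop_eq, simpleLoop_eq, word_brokenB_eq F c]
  refine h1.symm.trans (Eq.trans ?_ h2)
  exact congrArg (· * _) (F.word_brokenB_eq _)

/-- The sum over the tiles of the classes of the simple loops. -/
def loopSum [Fintype F.Tile] : F.Alg := ∑ i : F.Tile, F.simpleLoop (Quotient.out i)

variable [Fintype F.Tile]

theorem t_out (i : F.Tile) : F.t (Quotient.out i) = i := Quotient.out_eq i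

theorem e_mul_loopSum (a : E) : F.data.e (F.t a) * F.loopSum = F.simpleLoop a := by
  rw [loopSum, Finset.mul_sum, Finset.sum_eq_single (F.t a)]
  · have h := F.t_out (F.t a)
    rw [← F.simpleLoop_eq_of_t_eq h, simpleLoop_eq, ← mul_assoc]
    congr 1
    have := F.data_e_mul_x (Quotient.out (F.t a))
    rwa [h] at this
  · intro j _ hj
    rw [simpleLoop_eq, ← F.data_e_mul_x, F.t_out, ← mul_assoc, ← mul_assoc,
      F.data_idem.ortho (Ne.symm hj), zero_mul, zero_mul]
  · simp

theorem isColour_black : F.data.IsColour F.σB F.data.wB F.loopSum where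
  e_mul_x := F.data_e_mul_x
  x_mul_e := F.data_x_mul_e
  src_apply _ := rfl
  word_eq _ := rfl
  loop_eq a := by
    change F.data.x a * F.data.word (F.brokenB a) = F.data.e (F.t a) * F.loopSum
    rw [e_mul_loopSum, simpleLoop_eq]

theorem isColour_white : F.data.IsColour F.σW F.data.wW F.loopSum where
  e_mul_x := F.data_e_mul_x
  x_mul_e := F.data_x_mul_e
  src_apply a := (F.h_eq_t_white a).symm
  word_eq _ := rfl
  loop_eq a := by
    change F.data.x a * F.data.word (F.brokenW a) = F.data.e (F.t a) * F.loopSum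
    rw [e_mul_loopSum, simpleLoop_eq, word_brokenB_eq]

theorem simpleLoop_mul_e (a : E) : F.simpleLoop a * F.data.e (F.t a) = F.simpleLoop a := by
  have h := (F.isColour_black.isPath a).e_mul_word F.data_e_mul_x F.data_x_mul_e
  rw [simpleLoop_eq, mul_assoc]
  change _ * (F.data.word (F.data.wB a) * F.data.e (F.data.src a)) = _
  rw [← h, ← mul_assoc]
  change F.data.x a * F.data.e (F.h a) * _ = _
  rw [data_x_mul_e]
  rfl

theorem loopSum_mul_e (a : E) : F.loopSum * F.data.e (F.t a) = F.simpleLoop a := by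
  rw [loopSum, Finset.sum_mul, Finset.sum_eq_single (F.t a)]
  · have h := F.t_out (F.t a)
    rw [← F.simpleLoop_eq_of_t_eq h]
    have := F.simpleLoop_mul_e (Quotient.out (F.t a))
    rwa [h] at this
  · intro j _ hj
    rw [← simpleLoop_mul_e, F.t_out, mul_assoc, F.data_idem.ortho hj, mul_zero]
  · simp

/-- It commutes with an arrow `a` because the loop around the black vertex followed by `a` is also
`a` followed by the rotated loop. -/
theorem loopSum_central (y : F.Alg) : F.loopSum * y = y * F.loopSum := by
  have he : ∀ i, F.loopSum * F.data.e i = F.data.e i * F.loopSum := fun i => by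
    rw [← F.t_out i, loopSum_mul_e, e_mul_loopSum]
  have hx : ∀ a, F.loopSum * F.data.x a = F.data.x a * F.loopSum := fun a => by
    have h1 : F.loopSum * F.data.x a = F.simpleLoop a * F.data.x a := by
      rw [← loopSum_mul_e, mul_assoc, data_e_mul_x]
    have h2 : F.data.x a * F.loopSum = F.data.x a * F.simpleLoop (F.σB a) := by
      rw [← e_mul_loopSum, ← mul_assoc]
      exact congrArg (· * _) (F.data_x_mul_e a).symm
    rw [h1, h2, simpleLoop_eq, simpleLoop_eq, mul_assoc]
    congr 1
    exact F.word_mul_x_eq F.σB a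
  refine ArrowData.mem_of_mul_mem F.data_adjoin
    (LinearMap.ker (LinearMap.mulLeft ℂ F.loopSum - LinearMap.mulRight ℂ F.loopSum)) ?_ ?_ ?_ y
    |> fun h => sub_eq_zero.1 h
  · change F.loopSum * 1 - 1 * F.loopSum = 0
    rw [mul_one, one_mul, sub_self]
  · intro i z hz
    have hz' : F.loopSum * z - z * F.loopSum = 0 := hz
    change F.loopSum * (F.data.e i * z) - F.data.e i * z * F.loopSum = 0
    rw [← mul_assoc, he, mul_assoc, mul_assoc, ← mul_sub, hz', mul_zero]
  · intro i z hz
    have hz' : F.loopSum * z - z * F.loopSum = 0 := hz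
    change F.loopSum * (F.data.x i * z) - F.data.x i * z * F.loopSum = 0
    rw [← mul_assoc, hx, mul_assoc, mul_assoc, ← mul_sub, hz', mul_zero]

theorem brokenB_ne_nil (a : E) : F.brokenB a ≠ [] := by
  have := F.three_le_black a
  rw [brokenB, vertexCycle_tail]
  intro h
  have := congrArg List.length h
  simp at this
  omega

theorem brokenW_ne_nil (a : E) : F.brokenW a ≠ [] := by
  have := F.three_le_white a
  rw [brokenW, vertexCycle_tail]
  intro h
  have := congrArg List.length h
  simp at this
  omega

theorem data_isPath_brokenB (a : E) : F.data.IsPath (F.h a) (F.brokenB a) (F.t a) :=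
  F.isColour_black.isPath a

theorem cls_arrow_comp (a : E) {j : F.Tile} (u : Quiver.Path (F.h a) j) :
    F.cls ((F.arrow a).toPath.comp u) = F.data.x a * F.cls u := by
  rw [cls, ← PathAlgebra.ofPath_mul_ofPath, map_mul]
  rfl

theorem exists_path_cls_eq {i j : F.Tile} {l : List E} (h : F.data.IsPath i l j) :
    ∃ u : Quiver.Path i j, F.cls u = F.data.e i * F.data.word l := by
  induction h with
  | nil i => exact ⟨Quiver.Path.nil, by simp [ArrowData.word, data]⟩
  | @cons a l j _ ih =>
    obtain ⟨u, hu⟩ := ih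
    refine ⟨(F.arrow a).toPath.comp u, (F.cls_arrow_comp a u).trans ?_⟩
    refine (congrArg (F.data.x a * ·) hu).trans ?_
    rw [ArrowData.word_cons, ← mul_assoc, ← mul_assoc]
    change F.data.x a * F.data.e (F.h a) * _ = F.data.e (F.t a) * F.data.x a * _
    rw [data_x_mul_e, data_e_mul_x]

theorem IsConsistent.cancel {F : BraneTiling E} [Fintype F.Tile] (hF : F.IsConsistent)
    {i i' j : F.Tile} {l l' : List E} (hl : F.data.IsPath i l j) (hl' : F.data.IsPath i' l' j)
    (h : F.data.e i * F.data.word l * F.loopSum = F.data.e i' * F.data.word l' * F.loopSum) :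
    F.data.e i * F.data.word l = F.data.e i' * F.data.word l' := by
  obtain ⟨u, hu⟩ := F.exists_path_cls_eq hl
  obtain ⟨v, hv⟩ := F.exists_path_cls_eq hl'
  rw [← hu, ← hv] at h ⊢
  have he : ∀ {i : F.Tile} (w : Quiver.Path i j), F.cls w * F.data.e j = F.cls w := fun w => by
    have := congrArg F.toAlg (PathAlgebra.ofPath_mul_idem w)
    rwa [map_mul] at this
  -- On paths ending at `j`, right multiplication by `F.loopSum` is multiplication by the simple
  -- loop at `j`, so weak equivalence with exponent `1` applies.
  refine hF i i' j u v ⟨Quotient.out j, 1, F.t_out j, ?_⟩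
  rw [pow_one, ← e_mul_loopSum, F.t_out, ← mul_assoc, ← mul_assoc, he, he, h]

/-- Setting all arrows to zero respects the relations, as broken loops are not empty. It kills
`F.loopSum` but not the idempotents. -/
theorem data_e_ne_loopSum_mul (i : F.Tile) (y : F.Alg) : F.data.e i ≠ F.loopSum * y := by
  classical
  obtain ⟨f, hfe, hfx⟩ := F.data_exists_lift (F.Tile → ℂ) (fun i => Pi.single i 1) (fun _ => 0)
    (CompleteOrthogonalIdempotents.single _) (fun _ => mul_zero _) (fun _ => zero_mul _)
    (fun a => by
      have h : ∀ l : List E, l ≠ [] → (l.map fun _ => (0 : F.Tile → ℂ)).prod = 0 := by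
        intro l hl
        cases l with
        | nil => exact absurd rfl hl
        | cons b l => rw [List.map_cons, List.prod_cons, zero_mul]
      rw [h _ (F.brokenB_ne_nil a), h _ (F.brokenW_ne_nil a)])
  intro h
  have hω : f F.loopSum = 0 := by
    rw [loopSum, map_sum]
    refine Finset.sum_eq_zero fun j _ => ?_
    rw [simpleLoop_eq, map_mul, hfx, zero_mul]
  have := congrArg f h
  rw [map_mul, hω, zero_mul, hfe] at this
  have := congrFun this i
  simp at this

end BraneTiling

/-! ### The degree function from the topology of the surface, and the conclusion. -/

namespace BraneTiling

variable {E : Type u} [Finite E] (F : BraneTiling E)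

/-- The tiling is connected, and every arrow can be travelled backwards along its broken loop. -/
theorem exists_isPath [Fintype F.Tile] (i j : F.Tile) : ∃ l, F.data.IsPath i l j := by
  have hfwd : ∀ a, ∃ l, F.data.IsPath (F.t a) l (F.h a) := fun a =>
    ⟨[a], ArrowData.IsPath.cons (D := F.data) (a := a) (.nil _)⟩
  have hbwd : ∀ a, ∃ l, F.data.IsPath (F.h a) l (F.t a) := fun a => ⟨_, F.data_isPath_brokenB a⟩
  have key : ∀ g ∈ Subgroup.closure {F.σB, F.σW}, ∀ e,
      (∃ l, F.data.IsPath (F.t e) l (F.t (g e))) ∧ ∃ l, F.data.IsPath (F.t (g e)) l (F.t e) := by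
    intro g hg
    induction hg using Subgroup.closure_induction with
    | mem g hg =>
      intro e
      rcases hg with rfl | rfl
      · exact ⟨hfwd e, hbwd e⟩
      · rw [← h_eq_t_white]
        exact ⟨hfwd e, hbwd e⟩
    | one => exact fun e => ⟨⟨[], .nil _⟩, ⟨[], .nil _⟩⟩
    | mul g g' _ _ h h' =>
      intro e
      obtain ⟨⟨l₁, h₁⟩, ⟨l₂, h₂⟩⟩ := h (g' e)
      obtain ⟨⟨l₃, h₃⟩, ⟨l₄, h₄⟩⟩ := h' e
      exact ⟨⟨_, h₃.append h₁⟩, ⟨_, h₂.append h₄⟩⟩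
    | inv g _ h =>
      intro e
      have h' := h (g⁻¹ e)
      rw [← Equiv.Perm.mul_apply, mul_inv_cancel, Equiv.Perm.one_apply] at h'
      exact h'.symm
  have := F.connected
  obtain ⟨⟨g, hg⟩, h⟩ := MulAction.exists_smul_eq (Subgroup.closure {F.σB, F.σW})
    (Quotient.out i : E) (Quotient.out j : E)
  have h' : g (Quotient.out i : E) = (Quotient.out j : E) := h
  have := (key g hg (Quotient.out i : E)).1
  rwa [h', t_out, t_out] at this

/-- The sum of a function over the cycles of a permutation. -/
def cycleSums [Fintype E] (σ : Equiv.Perm E) :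
    (E → ℚ) →ₗ[ℚ] (Quotient (Equiv.Perm.SameCycle.setoid σ) → ℚ) := by
  classical
  exact LinearMap.pi fun v => ∑ e ∈ Finset.univ.filter (fun e => Quotient.mk _ e = v),
    LinearMap.proj e

open Classical in
theorem cycleSums_apply [Fintype E] (σ : Equiv.Perm E) (θ : E → ℚ)
    (v : Quotient (Equiv.Perm.SameCycle.setoid σ)) :
    cycleSums σ θ v = ∑ e ∈ Finset.univ.filter (fun e => Quotient.mk _ e = v), θ e := by
  simp [cycleSums]

theorem sum_cycleSums [Fintype E] (σ : Equiv.Perm E)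
    [Fintype (Quotient (Equiv.Perm.SameCycle.setoid σ))] (θ : E → ℚ) :
    ∑ v, cycleSums σ θ v = ∑ e, θ e := by
  classical
  simp only [cycleSums_apply]
  exact Finset.sum_fiberwise _ _ _

theorem cycleSums_mk [Fintype E] (σ : Equiv.Perm E) (θ : E → ℚ) (a : E) :
    cycleSums σ θ (Quotient.mk _ a) = θ a + ((vertexCycle σ a).tail.map θ).sum := by
  classical
  have h1 : θ a + ((vertexCycle σ a).tail.map θ).sum =
      ∑ k ∈ Finset.range (Function.minimalPeriod σ a), θ ((σ ^ k) a) := by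
    have hd := σ.minimalPeriod_pos a
    obtain ⟨d, hd⟩ : ∃ d, Function.minimalPeriod σ a = d + 1 :=
      ⟨_, (Nat.sub_add_cancel hd).symm⟩
    rw [vertexCycle_tail, hd, Finset.sum_range_succ', Nat.add_sub_cancel, List.map_map,
      add_comm]
    congr 1
  rw [h1, cycleSums_apply]
  symm
  refine Finset.sum_bij (fun k _ => (σ ^ k) a) ?_ ?_ ?_ ?_
  · intro k _
    rw [Finset.mem_filter]
    exact ⟨Finset.mem_univ _, Quotient.sound (s := Equiv.Perm.SameCycle.setoid σ)
      (Equiv.Perm.SameCycle.symm ⟨k, by rw [zpow_natCast]⟩)⟩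
  · intro k hk m hm h
    rw [Equiv.Perm.coe_pow, Equiv.Perm.coe_pow] at h
    exact (Function.iterate_eq_iterate_iff_of_lt_minimalPeriod (Finset.mem_range.1 hk)
      (Finset.mem_range.1 hm)).1 h
  · intro b hb
    have h : σ.SameCycle b a := Quotient.exact (Finset.mem_filter.1 hb).2
    obtain ⟨m, rfl⟩ : ∃ m : ℕ, (σ ^ m) a = b := h.symm.exists_nat_pow_eq
    refine ⟨m % Function.minimalPeriod σ a, Finset.mem_range.2 (Nat.mod_lt _
      (σ.minimalPeriod_pos a)), ?_⟩
    rw [Equiv.Perm.coe_pow, Equiv.Perm.coe_pow, Function.iterate_mod_minimalPeriod_eq]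
  · exact fun _ _ => rfl

/-- The map from functions on the tiles to functions on the arrows. -/
def coboundary : (F.Tile → ℚ) →ₗ[ℚ] (E → ℚ) :=
  LinearMap.pi fun a =>
    (LinearMap.proj (F.h a) : (F.Tile → ℚ) →ₗ[ℚ] ℚ) - LinearMap.proj (F.t a)

theorem coboundary_apply (f : F.Tile → ℚ) (a : E) :
    F.coboundary f a = f (F.h a) - f (F.t a) := rfl

/-- On a surface of positive genus there is a cocycle that is not a coboundary. -/
theorem exists_cocycle [Fintype E] {g : ℕ} (hg : 1 ≤ g) (hF : F.HasGenus g) :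
    ∃ θ : E → ℚ, cycleSums F.σB θ = 0 ∧ cycleSums F.σW θ = 0 ∧
      θ ∉ LinearMap.range F.coboundary := by
  classical
  have : Fintype F.Tile := Fintype.ofFinite _
  have instB : Fintype F.BlackVertex := Fintype.ofFinite _
  have instW : Fintype F.WhiteVertex := Fintype.ofFinite _
  let S : (E → ℚ) →ₗ[ℚ] ((F.BlackVertex → ℚ) × (F.WhiteVertex → ℚ)) :=
    (cycleSums F.σB).prod (cycleSums F.σW)
  let χ : ((F.BlackVertex → ℚ) × (F.WhiteVertex → ℚ)) →ₗ[ℚ] ℚ :=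
    (∑ v, LinearMap.proj v) ∘ₗ LinearMap.fst ℚ _ _ - (∑ v, LinearMap.proj v) ∘ₗ LinearMap.snd ℚ _ _
  have hχ : ∀ p, χ p = ∑ v, p.1 v - ∑ v, p.2 v := fun p => by simp [χ]
  obtain ⟨a₀⟩ := F.nonempty
  -- Each edge has one black and one white end, so the black sums and the white sums have the same
  -- total.
  have hrange : LinearMap.range S ≤ LinearMap.ker χ := by
    rintro _ ⟨θ, rfl⟩
    rw [LinearMap.mem_ker, hχ]
    have h₁ : ∑ v : F.BlackVertex, (S θ).1 v = ∑ e, θ e := @sum_cycleSums E _ _ F.σB instB θ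
    have h₂ : ∑ v : F.WhiteVertex, (S θ).2 v = ∑ e, θ e := @sum_cycleSums E _ _ F.σW instW θ
    rw [h₁, h₂, sub_self]
  have hχsurj : LinearMap.range χ = ⊤ := by
    rw [LinearMap.range_eq_top]
    intro c
    let v₀ : F.BlackVertex := Quotient.mk _ a₀
    refine ⟨(Pi.single v₀ c, 0), (hχ _).trans ?_⟩
    have h : ∑ v, (Pi.single v₀ c : F.BlackVertex → ℚ) v = c := by
      rw [Finset.sum_eq_single v₀ (fun b _ hb => by rw [Pi.single_eq_of_ne hb])
        fun h => (h (Finset.mem_univ _)).elim, Pi.single_eq_same]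
    simp [h]
  -- With `B`, `W` and `T` the numbers of black vertices, white vertices and tiles, the kernel of
  -- `S` has dimension at least `|E| - (B + W - 1) = T - 1 + 2g`. Coboundaries have dimension at
  -- most `T - 1`, since constants are killed.
  have d1 := Submodule.finrank_mono hrange
  have d2 := LinearMap.finrank_range_add_finrank_ker χ
  have d3 := LinearMap.finrank_range_add_finrank_ker S
  have d4 := LinearMap.finrank_range_add_finrank_ker F.coboundary
  rw [hχsurj, finrank_top, Module.finrank_self, Module.finrank_prod, Module.finrank_fintype_fun_eq_card,
    Module.finrank_fintype_fun_eq_card] at d2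
  rw [Module.finrank_fintype_fun_eq_card] at d3 d4
  have hker : 1 ≤ Module.finrank ℚ (LinearMap.ker F.coboundary) := by
    rw [Nat.one_le_iff_ne_zero, Ne, Submodule.finrank_eq_zero]
    intro h
    have : (fun _ => 1 : F.Tile → ℚ) ∈ LinearMap.ker F.coboundary := by
      rw [LinearMap.mem_ker]
      funext a
      rw [coboundary_apply, sub_self]
      rfl
    rw [h, Submodule.mem_bot] at this
    exact one_ne_zero (congrFun this (F.t a₀))
  rw [HasGenus, Nat.card_eq_fintype_card, Nat.card_eq_fintype_card, Nat.card_eq_fintype_card,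
    Nat.card_eq_fintype_card] at hF
  have hlt : ¬ LinearMap.ker S ≤ LinearMap.range F.coboundary := by
    intro hle
    have d5 := Submodule.finrank_mono hle
    omega
  obtain ⟨θ, hθ, hθ'⟩ := Set.not_subset.1 hlt
  have hθ0 : S θ = 0 := hθ
  exact ⟨θ, congrArg Prod.fst hθ0, congrArg Prod.snd hθ0, hθ'⟩

/-- If all closed paths at `i` had degree `0`, the degree of a path from `i` to `j` would define a
potential for `θ`. Closing up the paths to `h a` and to `t a` by the same return path from `h a`
compares its two values. -/
theorem exists_degree_ne_zero [Fintype F.Tile] {θ : E → ℚ}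
    (hθ : θ ∉ LinearMap.range F.coboundary) (i : F.Tile) :
    ∃ l, F.data.IsPath i l i ∧ (l.map θ).sum ≠ 0 := by
  by_contra! h
  choose p hp using F.exists_isPath i
  choose q hq using fun j => F.exists_isPath j i
  refine hθ ⟨fun j => ((p j).map θ).sum, ?_⟩
  funext a
  have h1 := h _ ((hp (F.h a)).append (hq (F.h a)))
  have h2 := h _ ((hp (F.t a)).append (ArrowData.IsPath.cons (D := F.data) (a := a) (hq (F.h a))))
  rw [List.map_append, List.sum_append] at h1 h2
  rw [List.map_cons, List.sum_cons] at h2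
  rw [coboundary_apply]
  linarith

/-- The genus enters only through `θ`, and consistency only through the regularity of `F.loopSum`,
from which separatedness is then derived. -/
theorem exists_isTiling [Fintype E] [Fintype F.Tile] {g : ℕ} (hg : 1 ≤ g) (hF : F.HasGenus g)
    (hcons : F.IsConsistent) : ∃ θ, F.data.IsTiling F.σB F.σW F.loopSum θ := by
  obtain ⟨θ, hB, hW, hθ⟩ := F.exists_cocycle hg hF
  obtain ⟨Θ, hinj, hsupp, hmul⟩ := ArrowData.exists_basis_embedding F.data_idem F.data_e_mul_x
    F.data_x_mul_e F.isColour_black.isPath F.brokenB_ne_nil F.isColour_white.isPath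
    F.brokenW_ne_nil F.word_brokenB_eq F.data_exists_lift F.data_adjoin (ω := F.loopSum)
    (fun i => ⟨(Quotient.out i : E) :: F.brokenB (Quotient.out i : E), by
        have := ArrowData.IsPath.cons (D := F.data) (F.data_isPath_brokenB (Quotient.out i : E))
        change F.data.IsPath (F.t _) _ (F.t _) at this
        rwa [t_out] at this, by
        have := F.e_mul_loopSum (Quotient.out i : E)
        rw [t_out] at this
        rw [this, ArrowData.word_cons, simpleLoop_eq, ← mul_assoc]
        have h := F.data_e_mul_x (Quotient.out i : E)
        rw [t_out] at h
        rw [h]⟩)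
  have hreg : ∀ y, F.loopSum * y = 0 → y = 0 := fun y hy =>
    ArrowData.eq_zero_of_mul_eq_zero hinj hsupp hmul hcons.cancel (by rw [← loopSum_central, hy])
  exact ⟨θ, {
    idem := F.data_idem
    e_mul_x := F.data_e_mul_x
    x_mul_e := F.data_x_mul_e
    src_black := fun _ => rfl
    src_white := fun a => (F.h_eq_t_white a).symm
    sameCycle := fun a b h => Quotient.exact h
    wB_eq := fun _ => rfl
    wW_eq := fun _ => rfl
    word_eq := F.word_brokenB_eq
    loop_eq := F.isColour_black.loop_eq
    central := F.loopSum_central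
    regular := hreg
    separated := fun y hy => ArrowData.eq_zero_of_forall_exists_pow_mul hinj hsupp hmul
      F.data_e_mul_x F.data_x_mul_e F.data_idem.idem F.loopSum_central
      F.isColour_black.word_mul_x hreg F.data_e_ne_loopSum_mul hy
    degree_black := fun a => (cycleSums_mk F.σB θ a).symm.trans (by rw [hB]; rfl)
    degree_white := fun a => (cycleSums_mk F.σW θ a).symm.trans (by rw [hW]; rfl)
    exists_degree_ne_zero := F.exists_degree_ne_zero hθ
    exists_lift := F.data_exists_lift
    adjoin_eq_top := F.data_adjoin }⟩

end BraneTiling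

end

theorem theorem3p5 {E : Type u} [Fintype E] (F : BraneTiling E) (g : ℕ) (hg : 1 ≤ g)
    (hF : F.HasGenus g) (hcons : F.IsConsistent) :
    -- an injective resolution of `A_F` as a left module
    F.data.IsInjectiveResolution ∧
    -- the analogous one of `A_F` as a right module, i.e. as a left module over the opposite algebra
    F.data.op.IsInjectiveResolution ∧
    IsGorensteinRing F.Alg := by
  have : Fintype F.Tile := Fintype.ofFinite _
  obtain ⟨θ, H⟩ := F.exists_isTiling hg hF hcons
  exact ⟨H.isInjectiveResolution, H.op.isInjectiveResolution,
    H.isInjectiveResolution.isGorensteinRing H.op.isInjectiveResolution⟩
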